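/- Let $f:\mathbb R^n\to\mathbb R^k$, $\mathcal D:\mathbb R^m\to\mathbb R^n$ and $g:\mathbb R^m\to\mathbb R$ be measurable, $y\in\mathbb R^k$, $\sigma_v,\rho>0$, $\lambda\in\mathbb R$, with $Z_g:=\int e^{-\lambda g(z)}\,dz<\infty$. Let $p(z_0)=e^{-\lambda g(z_0)}/Z_g$ be the prior on $z_0$, and let $p(z_0,x_0\mid y)$ be the augmented posterior, with density $\frac1Z\exp\big(-\frac{1}{2\sigma_v^2}\|y-f(x_0)\|^2-\lambda g(z_0)-\frac1{2\rho^2}\|x_0-\mathcal D(z_0)\|^2\big)$ on $\mathbb R^m\times\mathbb R^n$, where $Z$ is the normalising constant. Put $C:=\log Z-\log Z_g$. Let $0<T\le\infty$ and let $\beta$ be continuous and positive on $[0,T)$. Consider the variance-preserving diffusion $dz_t=-\frac12\beta(t)z_t\,dt+\sqrt{\beta(t)}\,dW_t$, whose transition law is $z_t\mid z_0\sim\mathcal N(\alpha_t z_0,\sigma_t^2 I)$ with $\alpha_t=e^{-\frac12\int_0^t\beta(s)ds}$, $\sigma_t^2=1-\alpha_t^2$ for $0<t\le T$ (with $\alpha_T=0$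 if $\int_0^T\beta=\infty$). For a probability measure $q(z_0,x_0\mid y)$ on $\mathbb R^m\times\mathbb R^n$, let $q(z_t\mid y)$ and $p(z_t)$ be the laws of $z_t$ when $z_0$ is distributed according to the $z_0$-marginal $q(z_0\mid y)$ of $q$ and according to the prior $p(z_0)$, respectively. Define the variational bound $$\mathcal B_T(q)=\mathbb E_{q(z_0\mid y)}\big[H(q(x_0\mid z_0,y))\big]+\mathbb E_{q}\Big[\tfrac1{2\sigma_v^2}\|y-f(x_0)\|^2\Big]+\mathbb E_{q}\Big[\tfrac1{2\rho^2}\|x_0-\mathcal D(z_0)\|^2\Big]+\int_0^T\tfrac{\beta(t)}2\,\mathbb E_{q(z_t\mid y)}\big[\|\nabla\log q(z_t\mid y)-\nabla\log p(z_t)\|^2\big]dt,$$ where $H(r)=\int r\log r$ (minus the Shannon entropy). Set $\mathcal B_T(q)=+\infty$ if $q$ has no density or if $\log q(x_0\mid z_0,y)$, the misfit or the coupling is not $q$-integrable or the last integral is infinite. Then: (1) For every probability measure $q$, $$\mathrm{KL}\big(q(z_0,x_0\mid y)\,\|\,p(z_0,x_0\mid y)\big)=\mathcal B_T(q)+C+\mathrm{KL}\big(q(z_T\mid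 y)\,\|\,p(z_T)\big)$$ as an identity in $(-\infty,+\infty]$; in particular $\mathcal B_T(q)+C$ is a lower bound of the KL divergence. (2) For every family $\mathcal Q$ of probability measures and every $q\in\mathcal Q$: $q$ minimises $\mathrm{KL}(\cdot\,\|\,p(z_0,x_0\mid y))$ over $\mathcal Q$ if and only if it minimises $\mathcal B_T(q)+\mathrm{KL}(q(z_T\mid y)\|p(z_T))$ over $\mathcal Q$. (3) If the diffusion ends in pure Gaussian noise, i.e. $\int_0^T\beta=\infty$, then $\mathrm{KL}(q\,\|\,p(z_0,x_0\mid y))=\mathcal B_T(q)+C$ for every probability measure $q$, and for every family $\mathcal Q$ of probability measures and every $q\in\mathcal Q$: $q$ minimises $\mathrm{KL}(\cdot\,\|\,p(z_0,x_0\mid y))$ over $\mathcal Q$ if and only if it minimises $\mathcal B_T$ over $\mathcal Q$. -/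

import Mathlib

open MeasureTheory InformationTheory
open scoped ENNReal

noncomputable section

namespace RSD

/-- Real `d`-dimensional space with its Euclidean norm and Lebesgue measure. -/
abbrev E (d : ℕ) : Type := EuclideanSpace ℝ (Fin d)

/-! ### The augmented posterior -/

/-- The measurement misfit `‖y - f x₀‖² / (2 σ_v²)`. -/
def misfit {n k : ℕ} (f : E n → E k) (y : E k) (σv : ℝ) (x : E n) : ℝ :=
  1 / (2 * σv ^ 2) * ‖y - f x‖ ^ 2

/-- The coupling `‖x₀ - D z₀‖² / (2 ρ²)` of the latent and the ambient variable. -/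
def coupling {m n : ℕ} (D : E m → E n) (ρ : ℝ) (w : E m × E n) : ℝ :=
  1 / (2 * ρ ^ 2) * ‖w.2 - D w.1‖ ^ 2

/-- The potential (negative unnormalised log-density) of the augmented posterior. -/
def potential {m n k : ℕ} (f : E n → E k) (D : E m → E n) (g : E m → ℝ) (y : E k)
    (σv lam ρ : ℝ) (w : E m × E n) : ℝ :=
  misfit f y σv w.2 + lam * g w.1 + coupling D ρ w

/-- The augmented posterior: the probability measure on pairs `(z₀, x₀)` whose Lebesgue density is
proportional to `exp (-potential)`. -/
def posterior {m n k : ℕ} (f : E n → E k) (D : E m → E n) (g : E m → ℝ) (y : E k)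
    (σv lam ρ : ℝ) : Measure (E m × E n) :=
  (volume : Measure (E m × E n)).tilted (fun w => -potential f D g y σv lam ρ w)

/-- The prior `p(z₀) ∝ exp (-λ g(z₀))` on the latent variable. -/
def prior {m : ℕ} (g : E m → ℝ) (lam : ℝ) : Measure (E m) :=
  (volume : Measure (E m)).tilted (fun z => -(lam * g z))

/-- The logarithm of `∫ exp (-potential) / ∫ exp (-λ g)`, i.e. the log-evidence of `y` up to the
normalising constants of the two Gaussian factors. It does not depend on `q`. -/
def logEvidence {m n k : ℕ} (f : E n → E k) (D : E m → E n) (g : E m → ℝ) (y : E k)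
    (σv lam ρ : ℝ) : ℝ :=
  Real.log (∫ w : E m × E n, Real.exp (-potential f D g y σv lam ρ w)) -
    Real.log (∫ z : E m, Real.exp (-(lam * g z)))

/-! ### The variance-preserving diffusion `dz = -½ β(t) z dt + √β(t) dW` on `[0, T]`, `T ≤ ∞` -/

/-- The open time interval `(0, T)`, where `T` may be `∞`. -/
def timeInterval (T : ℝ≥0∞) : Set ℝ := {t : ℝ | 0 < t ∧ ENNReal.ofReal t < T}

/-- The accumulated noise `∫₀ᵗ β(s) ds`, in `[0, ∞]`. -/
def accNoise (β : ℝ → ℝ) (t : ℝ≥0∞) : ℝ≥0∞ :=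
  ∫⁻ s in timeInterval t, ENNReal.ofReal (β s)

open Classical in
/-- The signal level `α_t = exp (-½ ∫₀ᵗ β)`, which is `0` if the accumulated noise is infinite. -/
def alpha (β : ℝ → ℝ) (t : ℝ≥0∞) : ℝ :=
  if accNoise β t = ∞ then 0 else Real.exp (-(accNoise β t).toReal / 2)

/-- The noise variance `σ_t² = 1 - α_t²`. -/
def sigmaSq (β : ℝ → ℝ) (t : ℝ≥0∞) : ℝ := 1 - alpha β t ^ 2

/-- The transition density of the diffusion from time `0` to time `t > 0`: the density at `z` of
`N(α_t z₀, σ_t² I)`. -/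
def transDensity {m : ℕ} (β : ℝ → ℝ) (t : ℝ≥0∞) (z₀ z : E m) : ℝ :=
  (2 * Real.pi * sigmaSq β t) ^ (-(m : ℝ) / 2) *
    Real.exp (-‖z - alpha β t • z₀‖ ^ 2 / (2 * sigmaSq β t))

/-- The density of `z_t` (`t > 0`) when `z₀` has law `μ`. -/
def diffusedDensity {m : ℕ} (β : ℝ → ℝ) (t : ℝ≥0∞) (μ : Measure (E m)) (z : E m) : ℝ :=
  ∫ z₀, transDensity β t z₀ z ∂μ

/-- The law of `z_t` (`t > 0`) when `z₀` has law `μ`. -/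
def diffusedLaw {m : ℕ} (β : ℝ → ℝ) (t : ℝ≥0∞) (μ : Measure (E m)) : Measure (E m) :=
  (volume : Measure (E m)).withDensity (fun z => ENNReal.ofReal (diffusedDensity β t μ z))

/-- The score `∇ log` of the density of `z_t` when `z₀` has law `μ`. -/
def score {m : ℕ} (β : ℝ → ℝ) (t : ℝ≥0∞) (μ : Measure (E m)) (z : E m) : E m :=
  gradient (fun z' => Real.log (diffusedDensity β t μ z')) z

/-- The Fisher divergence `E_{μ_t} ‖∇ log μ_t - ∇ log ν_t‖²` of the laws at time `t`. -/
def fisherDiv {m : ℕ} (β : ℝ → ℝ) (t : ℝ≥0∞) (μ ν : Measure (E m)) : ℝ≥0∞ :=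
  ∫⁻ z, ENNReal.ofReal (‖score β t μ z - score β t ν z‖ ^ 2) ∂(diffusedLaw β t μ)

/-- The score-matching integral `∫₀ᵀ (β(t)/2) E_{μ_t} ‖∇ log μ_t - ∇ log ν_t‖² dt`. -/
def scoreMatching {m : ℕ} (β : ℝ → ℝ) (T : ℝ≥0∞) (μ ν : Measure (E m)) : ℝ≥0∞ :=
  ∫⁻ t in timeInterval T, ENNReal.ofReal (β t / 2) * fisherDiv β (ENNReal.ofReal t) μ ν

/-! ### The variational bound -/

/-- The conditional density `q(x₀ | z₀) = q(z₀, x₀) / q(z₀)`. -/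
def condDensity {m n : ℕ} (q : Measure (E m × E n)) (z : E m) (x : E n) : ℝ :=
  (q.rnDeriv volume (z, x)).toReal / (q.fst.rnDeriv volume z).toReal

/-- The entropy term `∫ r log r` of a probability density `r`, in the sign convention in which it
enters a Kullback-Leibler divergence (minus the Shannon differential entropy). -/
def entropyTerm {n : ℕ} (r : E n → ℝ) : ℝ := ∫ x, r x * Real.log (r x)

/-- `q` has a density and all four terms of the variational bound are finite at `q`. -/
structure HasFiniteBound {m n k : ℕ} (f : E n → E k) (D : E m → E n) (g : E m → ℝ) (y : E k)
    (σv lam ρ : ℝ) (β : ℝ → ℝ) (T : ℝ≥0∞) (q : Measure (E m × E n)) : Prop where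
  absCont : q ≪ volume
  entropy : Integrable (fun w : E m × E n => Real.log (condDensity q w.1 w.2)) q
  misfit : Integrable (fun w : E m × E n => misfit f y σv w.2) q
  coupling : Integrable (fun w : E m × E n => coupling D ρ w) q
  score : scoreMatching β T q.fst (prior g lam) ≠ ∞

open Classical in
/-- The variational bound: expected conditional entropy term, plus expected misfit, plus expected
coupling, plus score-matching integral; it is `+∞` where one of these is not finite. -/
def bound {m n k : ℕ} (f : E n → E k) (D : E m → E n) (g : E m → ℝ) (y : E k)
    (σv lam ρ : ℝ) (β : ℝ → ℝ) (T : ℝ≥0∞) (q : Measure (E m × E n)) : EReal :=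
  if HasFiniteBound f D g y σv lam ρ β T q then
    (((∫ z, entropyTerm (condDensity q z) ∂q.fst)
      + (∫ w, misfit f y σv w.2 ∂q)
      + (∫ w, coupling D ρ w ∂q)
      + (scoreMatching β T q.fst (prior g lam)).toReal : ℝ) : EReal)
  else ⊤

/-- The Kullback-Leibler divergence `KL(q(z_T) ‖ p(z_T))` left at the end of the diffusion. -/
def terminalKL {m n : ℕ} (g : E m → ℝ) (lam : ℝ) (β : ℝ → ℝ) (T : ℝ≥0∞)
    (q : Measure (E m × E n)) : EReal :=
  ((klDiv (diffusedLaw β T q.fst) (diffusedLaw β T (prior g lam)) : ℝ≥0∞) : EReal)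

end RSD

end

/-! The log-ratio of `q` and the posterior splits pointwise into the log-ratio of the `z₀`-marginal
and the prior, the log conditional density, the misfit, the coupling and the constant `logEvidence`
(`llr_posterior_eq`). The theorem therefore reduces to a de Bruijn identity in `[0, ∞]`: the
divergence of the marginal from the prior equals the terminal divergence plus the score-matching
integral (`klDiv_prior_eq`).

For that identity the diffusion is turned into the heat flow. The variable `z_t / α_t` is `z₀` plus
Gaussian noise of variance `s = α_t⁻² - 1`. Divergence is invariant under dilation, Fisher
information picks up the factor `1 + s`, and `ds = (1 + s) β dt`, so the score-matching integral is
half the integral of the relative Fisher information of two heat flows (`scoreMatching_eq`).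

For two heat flows `u`, `v` the integrand `ent u v = u log (u / v) - u + v` is nonnegative, and two
integrations by parts against a cutoff show that its integral decreases at half the rate of the
Fisher information. The cutoff can be removed when `ent u v` is bounded by a multiple of `u + v`
(`heatEnt_dissipation`). No such bound is assumed, so the flows are replaced by the mixtures `u + c
v` and `v + c u`, whose ratio lies between `c` and `c⁻¹`. The mixed entropy is Lipschitz in `L¹`,
hence continuous at time `0` by strong continuity of the heat semigroup; it vanishes at infinite
time because the flow of a function of mass zero decays in `L¹`. As `c` decreases to `0`, mixed
entropy and mixed Fisher information both increase, so monotone convergence gives the identity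
without any finiteness or smoothness assumption (`lintegral_ent_eq_add`, `lintegral_ent_eq_top`).

It remains to match the infinite values. `integrable_llr_posterior_iff` shows that a finite
divergence makes every term of the chain rule integrable: each partial sum has an integrable lower
bound, where half of the coupling controls the negative part of the log conditional density.
Minimisers then agree because the two functionals differ by a real constant. -/

noncomputable section

namespace RSD

open Set Filter Topology

variable {m : ℕ}

/-! ### Kernels on `(0, ∞) × ℝᵐ` and their convolution with finite measures -/

/-- A kernel that is continuous for positive times and bounded away from time `0`. -/
structure AdmissibleKernel (k : ℝ → E m → ℝ) : Prop where
  continuousOn : ContinuousOn (fun p : ℝ × E m => k p.1 p.2) (Ioi 0 ×ˢ univ)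
  bounded : ∀ a : ℝ, 0 < a → ∃ C : ℝ, ∀ s, a ≤ s → ∀ y, |k s y| ≤ C

/-- The convolution of a time-dependent kernel with a measure. -/
def smear (k : ℝ → E m → ℝ) (μ : Measure (E m)) (s : ℝ) (x : E m) : ℝ :=
  ∫ z, k s (x - z) ∂μ

namespace AdmissibleKernel

variable {k k' : ℝ → E m → ℝ} {μ : Measure (E m)}

lemma continuous (hk : AdmissibleKernel k) {s : ℝ} (hs : 0 < s) : Continuous (k s) := by
  rw [← continuousOn_univ]
  exact hk.continuousOn.comp (f := fun y : E m => (s, y)) (by fun_prop) (fun y _ => ⟨hs, mem_univ _⟩)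

lemma integrable [IsFiniteMeasure μ] (hk : AdmissibleKernel k) {s : ℝ} (hs : 0 < s) (x : E m) :
    Integrable (fun z => k s (x - z)) μ := by
  obtain ⟨C, hC⟩ := hk.bounded s hs
  refine Integrable.of_bound (C := C) ?_ (ae_of_all _ fun z => hC s le_rfl _)
  exact ((hk.continuous hs).comp (by fun_prop)).aestronglyMeasurable

/-- Near a time `s > 0` all times exceed `s / 2`, where the kernel is bounded; a constant dominates
because `μ` is finite. The derivative lemmas for `smear` rest on the same domination. -/
lemma continuousOn_smear [IsFiniteMeasure μ] (hk : AdmissibleKernel k) :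
    ContinuousOn (fun p : ℝ × E m => smear k μ p.1 p.2) (Ioi 0 ×ˢ univ) := by
  have hopen : IsOpen (Ioi (0 : ℝ) ×ˢ (univ : Set (E m))) := isOpen_Ioi.prod isOpen_univ
  rintro ⟨s, x⟩ ⟨hs, -⟩
  replace hs : 0 < s := hs
  obtain ⟨C, hC⟩ := hk.bounded (s / 2) (by positivity)
  have hev : ∀ᶠ p : ℝ × E m in 𝓝 (s, x), s / 2 < p.1 :=
    (continuous_fst.tendsto (s, x)).eventually (lt_mem_nhds (by simp; linarith))
  refine ContinuousAt.continuousWithinAt ?_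
  refine continuousAt_of_dominated (bound := fun _ => C) ?_ ?_ (integrable_const _) ?_
  · filter_upwards [hev] with p hp
    exact (hk.integrable (by linarith : 0 < p.1) p.2).aestronglyMeasurable
  · filter_upwards [hev] with p hp
    exact ae_of_all _ fun z => hC _ hp.le _
  · refine ae_of_all _ fun z => ?_
    have h1 : ContinuousAt (fun p : ℝ × E m => k p.1 p.2) (s, x - z) :=
      hk.continuousOn.continuousAt (hopen.mem_nhds ⟨hs, mem_univ _⟩)
    exact ContinuousAt.comp (f := fun p : ℝ × E m => (p.1, p.2 - z)) (x := (s, x)) h1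
      (by fun_prop)

lemma hasDerivAt_smear [IsFiniteMeasure μ] (hk : AdmissibleKernel k) (hk' : AdmissibleKernel k')
    (h : ∀ s, 0 < s → ∀ y, HasDerivAt (fun t => k t y) (k' s y) s) {s : ℝ} (hs : 0 < s)
    (x : E m) : HasDerivAt (fun t => smear k μ t x) (smear k' μ s x) s := by
  obtain ⟨C, hC⟩ := hk'.bounded (s / 2) (by positivity)
  refine (hasDerivAt_integral_of_dominated_loc_of_deriv_le (bound := fun _ => C)
    (F := fun t z => k t (x - z)) (F' := fun t z => k' t (x - z)) (s := Ioi (s / 2))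
    (Ioi_mem_nhds (by linarith)) ?_ (hk.integrable hs x)
    (hk'.integrable hs x).aestronglyMeasurable ?_ (integrable_const _) ?_).2
  · filter_upwards [Ioi_mem_nhds hs] with t ht using (hk.integrable ht x).aestronglyMeasurable
  · exact ae_of_all _ fun z t ht => hC t (le_of_lt ht) _
  · exact ae_of_all _ fun z t ht => h t (lt_trans (by positivity) ht) _

lemma hasLineDerivAt_smear [IsFiniteMeasure μ] (hk : AdmissibleKernel k)
    (hk' : AdmissibleKernel k') {v : E m} {s : ℝ} (hs : 0 < s)
    (h : ∀ y, HasLineDerivAt ℝ (k s) (k' s y) y v) (x : E m) :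
    HasLineDerivAt ℝ (smear k μ s) (smear k' μ s x) x v := by
  obtain ⟨C, hC⟩ := hk'.bounded s hs
  have key := (hasDerivAt_integral_of_dominated_loc_of_deriv_le (bound := fun _ => C) (μ := μ)
    (F := fun t z => k s (x + t • v - z)) (F' := fun t z => k' s (x + t • v - z)) (s := univ)
    (x₀ := (0 : ℝ)) univ_mem
    (Eventually.of_forall fun t => (hk.integrable hs _).aestronglyMeasurable)
    (hk.integrable hs _) (hk'.integrable hs _).aestronglyMeasurable
    (ae_of_all _ fun z t _ => hC s le_rfl _) (integrable_const _) ?_).2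
  · simpa [HasLineDerivAt, smear] using key
  · refine ae_of_all _ fun z t _ => ?_
    have h1 := h (x + t • v - z)
    have h2 : HasDerivAt (fun r : ℝ => r - t) 1 t := by
      simpa using (hasDerivAt_id t).sub_const t
    -- The base point is written `t - t` so that the derivative composes with the shift `r ↦ r - t`.
    have h3 : HasDerivAt (fun r : ℝ => k s (x + t • v - z + r • v)) (k' s (x + t • v - z)) (t - t) := by
      simpa [HasLineDerivAt] using h1
    have h4 := HasDerivAt.comp (h := fun r : ℝ => r - t) t h3 h2
    simp only [mul_one] at h4
    refine h4.congr_of_eventuallyEq (Eventually.of_forall fun r => ?_)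
    simp only [Function.comp]
    congr 1
    module

end AdmissibleKernel

/-! ### The heat kernel -/

/-- The density of `N(0, s I)`. -/
def heatKernel (s : ℝ) (y : E m) : ℝ :=
  (2 * Real.pi * s) ^ (-(m : ℝ) / 2) * Real.exp (-(‖y‖ ^ 2 / (2 * s)))

/-- The spatial derivative of the heat kernel in the `i`-th coordinate. -/
def heatKernelD (i : Fin m) (s : ℝ) (y : E m) : ℝ := -(y i / s) * heatKernel s y

/-- The second spatial derivative of the heat kernel in the `i`-th coordinate. -/
def heatKernelDD (i : Fin m) (s : ℝ) (y : E m) : ℝ := ((y i / s) ^ 2 - 1 / s) * heatKernel s y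

/-- The time derivative of the heat kernel. -/
def heatKernelT (s : ℝ) (y : E m) : ℝ := (‖y‖ ^ 2 / s ^ 2 - m / s) / 2 * heatKernel s y

lemma heatKernel_pos {s : ℝ} (hs : 0 < s) (y : E m) : 0 < heatKernel s y := by
  unfold heatKernel; positivity

lemma add_mul_mul_exp_neg_le {A B t : ℝ} (hA : 0 ≤ A) (hB : 0 ≤ B) (ht : 0 ≤ t) :
    (A + B * t) * Real.exp (-t) ≤ A + B := by
  have h1 : Real.exp (-t) ≤ 1 := Real.exp_le_one_iff.2 (by linarith)
  have h2 : t * Real.exp (-t) ≤ 1 := by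
    rw [Real.exp_neg, ← div_eq_mul_inv, div_le_one (Real.exp_pos _)]
    linarith [Real.add_one_le_exp t]
  nlinarith

lemma continuousOn_heatKernel :
    ContinuousOn (fun p : ℝ × E m => heatKernel p.1 p.2) (Ioi 0 ×ˢ univ) := by
  unfold heatKernel
  refine ContinuousOn.mul (ContinuousOn.rpow_const (by fun_prop) ?_) ?_
  · rintro ⟨s, x⟩ ⟨hs, -⟩
    have : 0 < s := hs
    left; positivity
  · refine (ContinuousOn.neg (ContinuousOn.div (by fun_prop) (by fun_prop) ?_)).rexp
    rintro ⟨s, x⟩ ⟨hs, -⟩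
    have : 0 < s := hs
    positivity

/-- A prefactor that is affine in the Gaussian exponent `‖y‖² / (2 s)` is absorbed by the
exponential, and `(2 π s) ^ (-m / 2)` is largest at `s = a`. All derivatives of the heat kernel in
use have this form. -/
lemma admissibleKernel_mul_heatKernel {P : ℝ → E m → ℝ}
    (hc : ContinuousOn (fun p : ℝ × E m => P p.1 p.2) (Ioi 0 ×ˢ univ))
    (hP : ∀ a : ℝ, 0 < a → ∃ A B : ℝ, 0 ≤ A ∧ 0 ≤ B ∧ ∀ s, a ≤ s → ∀ y,
      |P s y| ≤ A + B * (‖y‖ ^ 2 / (2 * s))) :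
    AdmissibleKernel (fun s y => P s y * heatKernel s y) where
  continuousOn := hc.mul continuousOn_heatKernel
  bounded a ha := by
    obtain ⟨A, B, hA, hB, h⟩ := hP a ha
    refine ⟨(A + B) * (2 * Real.pi * a) ^ (-(m : ℝ) / 2), fun s hs y => ?_⟩
    have hs0 : 0 < s := ha.trans_le hs
    rw [abs_mul, abs_of_pos (heatKernel_pos hs0 y)]
    have h1 : (2 * Real.pi * s) ^ (-(m : ℝ) / 2) ≤ (2 * Real.pi * a) ^ (-(m : ℝ) / 2) := by
      refine Real.rpow_le_rpow_of_nonpos (by positivity) (by gcongr) ?_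
      have : (0 : ℝ) ≤ m := by positivity
      linarith
    have h2 := add_mul_mul_exp_neg_le hA hB (by positivity : 0 ≤ ‖y‖ ^ 2 / (2 * s))
    calc |P s y| * heatKernel s y
        ≤ (A + B * (‖y‖ ^ 2 / (2 * s))) * heatKernel s y :=
          mul_le_mul_of_nonneg_right (h s hs y) (heatKernel_pos hs0 y).le
      _ = ((A + B * (‖y‖ ^ 2 / (2 * s))) * Real.exp (-(‖y‖ ^ 2 / (2 * s)))) *
            (2 * Real.pi * s) ^ (-(m : ℝ) / 2) := by unfold heatKernel; ring
      _ ≤ _ := by gcongr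

lemma sq_apply_le (y : E m) (i : Fin m) : y i ^ 2 ≤ ‖y‖ ^ 2 := by
  rw [EuclideanSpace.real_norm_sq_eq]
  exact Finset.single_le_sum (f := fun j => y j ^ 2) (fun j _ => sq_nonneg _) (Finset.mem_univ i)

lemma admissibleKernel_heatKernel : AdmissibleKernel (heatKernel (m := m)) := by
  have := admissibleKernel_mul_heatKernel (m := m) (P := fun _ _ => 1) (by fun_prop)
    (fun a _ => ⟨1, 0, by norm_num, le_rfl, fun s _ y => by simp⟩)
  simpa using this

lemma admissibleKernel_heatKernelD (i : Fin m) : AdmissibleKernel (heatKernelD i) := by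
  refine admissibleKernel_mul_heatKernel (P := fun s y => -(y i / s)) ?_ ?_
  · refine (ContinuousOn.div (by fun_prop) (by fun_prop) ?_).neg
    rintro ⟨s, x⟩ ⟨hs, -⟩
    exact ne_of_gt hs
  · refine fun a ha => ⟨1 / (2 * a), 1, by positivity, zero_le_one, fun s hs y => ?_⟩
    have hs0 : 0 < s := ha.trans_le hs
    have h1 : 1 / (2 * s) ≤ 1 / (2 * a) := by gcongr
    rw [abs_neg, abs_div, abs_of_pos hs0]
    have h2 := sq_apply_le y i
    have h3 : |y i| / s ≤ 1 / (2 * s) + ‖y‖ ^ 2 / (2 * s) := by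
      rw [← add_div, div_le_div_iff₀ hs0 (by positivity)]
      have := sq_abs (y i)
      nlinarith [sq_nonneg (|y i| - 1)]
    linarith

lemma admissibleKernel_heatKernelDD (i : Fin m) : AdmissibleKernel (heatKernelDD i) := by
  refine admissibleKernel_mul_heatKernel (P := fun s y => (y i / s) ^ 2 - 1 / s) ?_ ?_
  · refine ContinuousOn.sub (ContinuousOn.pow (ContinuousOn.div (by fun_prop) (by fun_prop) ?_) 2)
      (ContinuousOn.div (by fun_prop) (by fun_prop) ?_)
    all_goals
      rintro ⟨s, x⟩ ⟨hs, -⟩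
      exact ne_of_gt hs
  · refine fun a ha => ⟨1 / a, 2 / a, by positivity, by positivity, fun s hs y => ?_⟩
    have hs0 : 0 < s := ha.trans_le hs
    have h1 : 1 / s ≤ 1 / a := by gcongr
    have h2 : (y i / s) ^ 2 ≤ 2 / a * (‖y‖ ^ 2 / (2 * s)) := by
      calc (y i / s) ^ 2 = 2 / s * (y i ^ 2 / (2 * s)) := by field_simp
        _ ≤ _ := by
          gcongr ?_ * (?_ / _)
          · gcongr
          · exact sq_apply_le y i
    rw [abs_le]
    have h3 : 0 ≤ 1 / s := by positivity
    have h4 := sq_nonneg (y i / s)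
    constructor <;> linarith

lemma admissibleKernel_heatKernelT : AdmissibleKernel (heatKernelT (m := m)) := by
  refine admissibleKernel_mul_heatKernel (P := fun s y => (‖y‖ ^ 2 / s ^ 2 - m / s) / 2) ?_ ?_
  · refine (ContinuousOn.sub (ContinuousOn.div (by fun_prop) (by fun_prop) ?_)
      (ContinuousOn.div (by fun_prop) (by fun_prop) ?_)).div_const 2
    all_goals
      rintro ⟨s, x⟩ ⟨hs, -⟩
      have : s ≠ 0 := ne_of_gt hs
      positivity
  · refine fun a ha => ⟨m / a, 1 / a, by positivity, by positivity, fun s hs y => ?_⟩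
    have hs0 : 0 < s := ha.trans_le hs
    have h1 : (m : ℝ) / s ≤ m / a := by gcongr
    have h2 : ‖y‖ ^ 2 / s ^ 2 / 2 ≤ 1 / a * (‖y‖ ^ 2 / (2 * s)) := by
      calc ‖y‖ ^ 2 / s ^ 2 / 2 = 1 / s * (‖y‖ ^ 2 / (2 * s)) := by field_simp
        _ ≤ _ := by gcongr
    rw [abs_le]
    have h3 : 0 ≤ (m : ℝ) / s := by positivity
    have h4 : 0 ≤ ‖y‖ ^ 2 / s ^ 2 := by positivity
    constructor <;> linarith

/-- The heat equation with generator `Δ / 2`. -/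
lemma heatKernelT_eq (s : ℝ) (y : E m) : heatKernelT s y = (∑ i, heatKernelDD i s y) / 2 := by
  unfold heatKernelT heatKernelDD
  rw [← Finset.sum_mul, Finset.sum_sub_distrib, EuclideanSpace.real_norm_sq_eq, Finset.sum_div]
  simp only [div_pow, Finset.sum_const, Finset.card_univ, Fintype.card_fin, nsmul_eq_mul]
  ring

lemma hasDerivAt_heatKernel {s : ℝ} (hs : 0 < s) (y : E m) :
    HasDerivAt (fun t => heatKernel t y) (heatKernelT s y) s := by
  have h1 : HasDerivAt (fun t : ℝ => 2 * Real.pi * t) (2 * Real.pi) s := by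
    simpa using (hasDerivAt_id s).const_mul (2 * Real.pi)
  have hne : 2 * Real.pi * s ≠ 0 := by positivity
  have h2 := h1.rpow_const (p := -(m : ℝ) / 2) (Or.inl hne)
  have h3 : HasDerivAt (fun t : ℝ => -(‖y‖ ^ 2 / (2 * t))) (‖y‖ ^ 2 / (2 * s ^ 2)) s := by
    have := (((hasDerivAt_id s).const_mul 2).inv (by simpa using hs.ne')).const_mul (-‖y‖ ^ 2)
    refine (this.congr_deriv ?_).congr_of_eventuallyEq (Eventually.of_forall fun t => ?_)
    · simp only [id]; field_simp
    · simp only [Pi.inv_apply, id]; ring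
  refine (h2.mul h3.exp).congr_deriv ?_
  unfold heatKernelT heatKernel
  rw [Real.rpow_sub_one hne]
  field_simp
  ring

lemma hasDerivAt_norm_add_smul_sq (y : E m) (i : Fin m) :
    HasDerivAt (fun t : ℝ => ‖y + t • EuclideanSpace.single i (1 : ℝ)‖ ^ 2) (2 * y i) 0 := by
  have h : HasDerivAt (fun t : ℝ => y + t • EuclideanSpace.single i (1 : ℝ))
      (EuclideanSpace.single i (1 : ℝ)) 0 := by
    simpa using ((hasDerivAt_id (0 : ℝ)).smul_const (EuclideanSpace.single i (1 : ℝ))).const_add y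
  have := h.norm_sq
  simpa [EuclideanSpace.inner_single_right] using this

lemma hasLineDerivAt_heatKernel (s : ℝ) (y : E m) (i : Fin m) :
    HasLineDerivAt ℝ (heatKernel s) (heatKernelD i s y) y (EuclideanSpace.single i 1) := by
  have h := ((hasDerivAt_norm_add_smul_sq y i).div_const (2 * s)).neg.exp.const_mul
    ((2 * Real.pi * s) ^ (-(m : ℝ) / 2))
  refine h.congr_deriv ?_
  unfold heatKernelD heatKernel
  simp only [zero_smul, add_zero, Pi.neg_apply]
  rw [mul_div_mul_left _ _ two_ne_zero]
  ring

lemma hasLineDerivAt_heatKernelD (s : ℝ) (y : E m) (i : Fin m) :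
    HasLineDerivAt ℝ (heatKernelD i s) (heatKernelDD i s y) y (EuclideanSpace.single i 1) := by
  have h1 : HasDerivAt (fun t : ℝ => -((y + t • EuclideanSpace.single i (1 : ℝ)) i / s))
      (-(1 / s)) 0 := by
    have := (((hasDerivAt_id (0 : ℝ)).const_add (y i)).div_const s).neg
    simpa [Pi.neg_def] using this
  have h := h1.mul (hasLineDerivAt_heatKernel s y i)
  refine h.congr_deriv ?_
  unfold heatKernelDD heatKernelD
  simp only [zero_smul, add_zero]
  ring

/-! ### The heat flow of a finite measure -/

/-- The density at time `s` of the heat flow started at `μ`. -/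
def heat (μ : Measure (E m)) (s : ℝ) (x : E m) : ℝ := smear heatKernel μ s x

/-- The `i`-th spatial derivative of `heat`. -/
def heatD (μ : Measure (E m)) (i : Fin m) (s : ℝ) (x : E m) : ℝ := smear (heatKernelD i) μ s x

/-- The second `i`-th spatial derivative of `heat`. -/
def heatDD (μ : Measure (E m)) (i : Fin m) (s : ℝ) (x : E m) : ℝ := smear (heatKernelDD i) μ s x

section Heat

variable (μ ν : Measure (E m)) [IsFiniteMeasure μ] [IsFiniteMeasure ν]

lemma heat_pos [NeZero μ] {s : ℝ} (hs : 0 < s) (x : E m) : 0 < heat μ s x := by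
  have h : 0 < ∫ z, heatKernel s (x - z) ∂μ := by
    rw [integral_pos_iff_support_of_nonneg (fun z => (heatKernel_pos hs _).le)
      (admissibleKernel_heatKernel.integrable hs x)]
    have : Function.support (fun z => heatKernel s (x - z)) = univ :=
      eq_univ_of_forall fun z => (heatKernel_pos hs _).ne'
    rw [this]
    exact (Measure.measure_univ_pos).2 (NeZero.ne μ)
  exact h

lemma hasDerivAt_heat {s : ℝ} (hs : 0 < s) (x : E m) :
    HasDerivAt (fun t => heat μ t x) ((∑ i, heatDD μ i s x) / 2) s := by
  refine (admissibleKernel_heatKernel.hasDerivAt_smear admissibleKernel_heatKernelT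
    (fun s hs y => hasDerivAt_heatKernel hs y) hs x).congr_deriv ?_
  unfold heatDD smear
  simp_rw [heatKernelT_eq]
  rw [integral_div, integral_finsetSum]
  exact fun i _ => (admissibleKernel_heatKernelDD i).integrable hs x

lemma hasLineDerivAt_heat {s : ℝ} (hs : 0 < s) (x : E m) (i : Fin m) :
    HasLineDerivAt ℝ (heat μ s) (heatD μ i s x) x (EuclideanSpace.single i 1) :=
  admissibleKernel_heatKernel.hasLineDerivAt_smear (admissibleKernel_heatKernelD i) hs
    (fun y => hasLineDerivAt_heatKernel s y i) x

lemma hasLineDerivAt_heatD {s : ℝ} (hs : 0 < s) (x : E m) (i : Fin m) :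
    HasLineDerivAt ℝ (heatD μ i s) (heatDD μ i s x) x (EuclideanSpace.single i 1) :=
  (admissibleKernel_heatKernelD i).hasLineDerivAt_smear (admissibleKernel_heatKernelDD i) hs
    (fun y => hasLineDerivAt_heatKernelD s y i) x

lemma continuousOn_heat :
    ContinuousOn (fun p : ℝ × E m => heat μ p.1 p.2) (Ioi 0 ×ˢ univ) :=
  admissibleKernel_heatKernel.continuousOn_smear

lemma continuousOn_heatD (i : Fin m) :
    ContinuousOn (fun p : ℝ × E m => heatD μ i p.1 p.2) (Ioi 0 ×ˢ univ) :=
  (admissibleKernel_heatKernelD i).continuousOn_smear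

lemma continuousOn_heatDD (i : Fin m) :
    ContinuousOn (fun p : ℝ × E m => heatDD μ i p.1 p.2) (Ioi 0 ×ˢ univ) :=
  (admissibleKernel_heatKernelDD i).continuousOn_smear

/-- `score` is defined by `gradient`, for which line derivatives do not suffice; hence the Fréchet
derivative under the integral sign. -/
lemma differentiableAt_heat {s : ℝ} (hs : 0 < s) (x : E m) : DifferentiableAt ℝ (heat μ s) x := by
  have hb : ∀ y : E m, ‖y‖ / s * heatKernel s y ≤
      (1 / (2 * s) + 1) * (2 * Real.pi * s) ^ (-(m : ℝ) / 2) := by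
    intro y
    have h2 := add_mul_mul_exp_neg_le (by positivity : 0 ≤ 1 / (2 * s)) zero_le_one
      (by positivity : 0 ≤ ‖y‖ ^ 2 / (2 * s))
    have h3 : ‖y‖ / s ≤ 1 / (2 * s) + 1 * (‖y‖ ^ 2 / (2 * s)) := by
      rw [one_mul, ← add_div, div_le_div_iff₀ hs (by positivity)]
      nlinarith [sq_nonneg (‖y‖ - 1)]
    calc ‖y‖ / s * heatKernel s y
        ≤ (1 / (2 * s) + 1 * (‖y‖ ^ 2 / (2 * s))) * heatKernel s y :=
          mul_le_mul_of_nonneg_right h3 (heatKernel_pos hs y).le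
      _ = ((1 / (2 * s) + 1 * (‖y‖ ^ 2 / (2 * s))) * Real.exp (-(‖y‖ ^ 2 / (2 * s)))) *
            (2 * Real.pi * s) ^ (-(m : ℝ) / 2) := by unfold heatKernel; ring
      _ ≤ _ := by gcongr
  have hd : ∀ y : E m, HasFDerivAt (heatKernel s) (-(heatKernel s y / s) • innerSL ℝ y) y := by
    intro y
    have h := (((hasStrictFDerivAt_norm_sq y).hasFDerivAt.mul_const (2 * s)⁻¹).neg.exp).const_mul
      ((2 * Real.pi * s) ^ (-(m : ℝ) / 2))
    refine (h.congr_fderiv ?_).congr_of_eventuallyEq (Eventually.of_forall fun t => ?_)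
    · ext v
      simp [heatKernel, div_eq_mul_inv]
      field_simp
    · simp [heatKernel, div_eq_mul_inv]
  have hcont : Continuous (heatKernel (m := m) s) := admissibleKernel_heatKernel.continuous hs
  refine (hasFDerivAt_integral_of_dominated_of_fderiv_le (μ := μ) (𝕜 := ℝ)
    (F := fun x z => heatKernel s (x - z))
    (F' := fun x z => -(heatKernel s (x - z) / s) • innerSL ℝ (x - z))
    (s := univ) univ_mem
    (Eventually.of_forall fun x =>
      (admissibleKernel_heatKernel.integrable hs x).aestronglyMeasurable)
    (admissibleKernel_heatKernel.integrable hs x) ?_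
    (ae_of_all _ fun z x _ => ?_) (integrable_const
      ((1 / (2 * s) + 1) * (2 * Real.pi * s) ^ (-(m : ℝ) / 2))) ?_).differentiableAt
  · refine Continuous.aestronglyMeasurable ?_
    have h1 : Continuous fun z : E m => heatKernel s (x - z) := hcont.comp (by fun_prop)
    have h2 : Continuous fun z : E m => innerSL ℝ (x - z) :=
      (innerSL ℝ).continuous.comp (by fun_prop)
    exact (h1.div_const s).neg.smul h2
  · rw [norm_smul, innerSL_apply_norm, norm_neg, Real.norm_eq_abs, abs_of_nonneg
      (div_nonneg (heatKernel_pos hs _).le hs.le)]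
    refine le_trans (le_of_eq ?_) (hb (x - z))
    ring
  · refine ae_of_all _ fun z x _ => ?_
    exact (hd (x - z)).comp x ((hasFDerivAt_id x).sub_const z)

end Heat

/-! ### Mass of the heat flow -/

lemma integral_heatKernel {s : ℝ} (hs : 0 < s) : ∫ y : E m, heatKernel s y = 1 := by
  have h := GaussianFourier.integral_rexp_neg_mul_sq_norm (V := E m) (b := 1 / (2 * s))
    (by positivity)
  unfold heatKernel
  rw [integral_const_mul]
  have h2 : ∀ y : E m, Real.exp (-(‖y‖ ^ 2 / (2 * s))) = Real.exp (-(1 / (2 * s)) * ‖y‖ ^ 2) := by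
    intro y; congr 1; ring
  simp_rw [h2, h, finrank_euclideanSpace, Fintype.card_fin]
  have h3 : Real.pi / (1 / (2 * s)) = 2 * Real.pi * s := by field_simp
  rw [h3, ← Real.rpow_add (by positivity)]
  simp [neg_div]

lemma integrable_heatKernel {s : ℝ} (hs : 0 < s) :
    Integrable (fun y : E m => heatKernel s y) := by
  -- A non-integrable function would have integral `0` by convention, not `1`.
  by_contra h
  have := integral_heatKernel (m := m) hs
  rw [integral_undef h] at this
  exact zero_ne_one this

lemma heat_nonneg (μ : Measure (E m)) {s : ℝ} (hs : 0 < s) (x : E m) : 0 ≤ heat μ s x :=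
  integral_nonneg fun _ => (heatKernel_pos hs _).le

section Mass

variable (μ : Measure (E m)) [IsFiniteMeasure μ]

lemma integrable_heatKernel_prod {s : ℝ} (hs : 0 < s) :
    Integrable (fun p : E m × E m => heatKernel s (p.1 - p.2)) (volume.prod μ) := by
  have hc : Continuous fun p : E m × E m => heatKernel s (p.1 - p.2) :=
    (admissibleKernel_heatKernel.continuous hs).comp (by fun_prop)
  rw [integrable_prod_iff' hc.aestronglyMeasurable]
  refine ⟨ae_of_all _ fun z => (integrable_heatKernel hs).comp_sub_right z, ?_⟩
  have : ∀ z : E m, ∫ x : E m, ‖heatKernel s (x - z)‖ = 1 := by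
    intro z
    simp_rw [Real.norm_of_nonneg (heatKernel_pos hs _).le]
    rw [integral_sub_right_eq_self (fun x : E m => heatKernel s x) z, integral_heatKernel hs]
  simp only [this]
  exact integrable_const _

lemma integrable_heat {s : ℝ} (hs : 0 < s) : Integrable (heat μ s) :=
  (integrable_heatKernel_prod μ hs).integral_prod_left

lemma integral_heat {s : ℝ} (hs : 0 < s) : ∫ x, heat μ s x = μ.real univ := by
  unfold heat smear
  rw [integral_integral_swap (integrable_heatKernel_prod μ hs)]
  simp_rw [integral_sub_right_eq_self (fun x : E m => heatKernel s x), integral_heatKernel hs]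
  simp

lemma integrable_heat_prod {a b : ℝ} (ha : 0 < a) :
    Integrable (fun p : ℝ × E m => heat μ p.1 p.2) ((volume.restrict (Ioc a b)).prod volume) := by
  have hsub : Ioc a b ×ˢ (univ : Set (E m)) ⊆ Ioi 0 ×ˢ univ :=
    prod_mono (fun s hs => ha.trans hs.1) Subset.rfl
  have hmeas : AEStronglyMeasurable (fun p : ℝ × E m => heat μ p.1 p.2)
      ((volume.restrict (Ioc a b)).prod volume) := by
    rw [← Measure.restrict_univ (μ := (volume : Measure (E m))), Measure.prod_restrict]
    exact ((continuousOn_heat μ).mono hsub).aestronglyMeasurable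
      (measurableSet_Ioc.prod MeasurableSet.univ)
  rw [integrable_prod_iff hmeas]
  constructor
  · filter_upwards [ae_restrict_mem measurableSet_Ioc] with s hs
    exact integrable_heat μ (ha.trans hs.1)
  · refine (integrable_const (μ.real univ)).congr ?_
    filter_upwards [ae_restrict_mem measurableSet_Ioc] with s hs
    simp_rw [Real.norm_of_nonneg (heat_nonneg μ (ha.trans hs.1) _)]
    exact (integral_heat μ (ha.trans hs.1)).symm

end Mass

/-! ### The relative entropy integrand -/

/-- The integrand `u log (u / v) - u + v` of the Kullback-Leibler divergence of two densities. -/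
def ent (u v : ℝ) : ℝ := u * Real.log u - u * Real.log v - u + v

/-- This is the inequality `log x ≤ x - 1` at `x = r v / u`. The left side is linear in `(u, v)` and
attains `ent u v` at `r = u / v`, so `ent` is a supremum of linear functions. Inserting the ratio of
another pair of densities compares two entropies. -/
lemma ent_ge {u v r : ℝ} (hu : 0 ≤ u) (hv : 0 < v) (hr : 0 < r) :
    u * Real.log r + v * (1 - r) ≤ ent u v := by
  unfold ent
  rcases hu.eq_or_lt with rfl | hu
  · simp; nlinarith
  have h1 := Real.log_le_sub_one_of_pos (by positivity : 0 < r * v / u)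
  rw [Real.log_div (by positivity) hu.ne', Real.log_mul hr.ne' hv.ne'] at h1
  have h2 : u * (Real.log r + Real.log v - Real.log u) ≤ u * (r * v / u - 1) := by gcongr
  have h3 : u * (r * v / u - 1) = r * v - u := by field_simp
  linarith

lemma ent_nonneg {u v : ℝ} (hu : 0 ≤ u) (hv : 0 < v) : 0 ≤ ent u v := by
  have := ent_ge hu hv one_pos
  simpa using this

/-- The right side is the symmetrised entropy `ent u v + ent v u`. It is linear in `|u - v|` once
the log-ratio is bounded. -/
lemma ent_le {u v : ℝ} (hu : 0 < u) (hv : 0 < v) :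
    ent u v ≤ (Real.log u - Real.log v) * (u - v) := by
  unfold ent
  have h1 := Real.log_le_sub_one_of_pos (by positivity : 0 < u / v)
  rw [Real.log_div hu.ne' hv.ne'] at h1
  have h2 : v * (Real.log u - Real.log v) ≤ v * (u / v - 1) := by gcongr
  have h3 : v * (u / v - 1) = u - v := by field_simp
  linarith

lemma HasDerivAt.ent {u v : ℝ → ℝ} {u' v' t : ℝ} (hu : HasDerivAt u u' t) (hv : HasDerivAt v v' t)
    (hu0 : u t ≠ 0) (hv0 : v t ≠ 0) :
    HasDerivAt (fun r => ent (u r) (v r))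
      ((Real.log (u t) - Real.log (v t)) * u' + (1 - u t / v t) * v') t := by
  refine ((((hu.mul (hu.log hu0)).sub (hu.mul (hv.log hv0))).sub hu).add hv).congr_deriv ?_
  field_simp
  ring

/-! ### Cutoff functions and integration by parts -/

/-- A compactly supported cutoff function with its first and second coordinate derivatives. -/
structure Cutoff (m : ℕ) where
  /-- the cutoff function -/
  fn : E m → ℝ
  /-- its first coordinate derivatives -/
  d : Fin m → E m → ℝ
  /-- its second coordinate derivatives -/
  dd : Fin m → E m → ℝ
  cont : Continuous fn
  cont_d : ∀ i, Continuous (d i)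
  cont_dd : ∀ i, Continuous (dd i)
  supp : HasCompactSupport fn
  supp_d : ∀ i, HasCompactSupport (d i)
  supp_dd : ∀ i, HasCompactSupport (dd i)
  deriv_d : ∀ i x, HasLineDerivAt ℝ fn (d i x) x (EuclideanSpace.single i 1)
  deriv_dd : ∀ i x, HasLineDerivAt ℝ (d i) (dd i x) x (EuclideanSpace.single i 1)
  nonneg : ∀ x, 0 ≤ fn x
  le_one : ∀ x, fn x ≤ 1

/-- The cutoffs are dilations `f (x / (n + 1))` of one bump; their second derivatives carry the
factor `(n + 1)⁻²`. Only second derivatives need control, since both derivatives are moved from the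
entropy to the cutoff. -/
lemma exists_cutoff_seq (m : ℕ) : ∃ (χ : ℕ → Cutoff m) (M : ℝ),
    (∀ x, Tendsto (fun n => (χ n).fn x) atTop (𝓝 1)) ∧
    (∀ i x, Tendsto (fun n => (χ n).dd i x) atTop (𝓝 0)) ∧
    (∀ n i x, |(χ n).dd i x| ≤ M) := by
  let f : ContDiffBump (0 : E m) := ⟨1, 2, one_pos, one_lt_two⟩
  let e : Fin m → E m := fun i => EuclideanSpace.single i 1
  have hf : ContDiff ℝ 2 (f : E m → ℝ) := f.contDiff
  have hfs : HasCompactSupport (f : E m → ℝ) := f.hasCompactSupport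
  let f1 : Fin m → E m → ℝ := fun i x => fderiv ℝ f x (e i)
  have hf1 : ∀ i, ContDiff ℝ 1 (f1 i) := fun i =>
    (hf.fderiv_right (m := 1) (by norm_num)).clm_apply contDiff_const
  have hf1s : ∀ i, HasCompactSupport (f1 i) := fun i => hfs.fderiv_apply ℝ (e i)
  let f2 : Fin m → E m → ℝ := fun i x => fderiv ℝ (f1 i) x (e i)
  have hf2 : ∀ i, Continuous (f2 i) := fun i =>
    ((hf1 i).continuous_fderiv (by norm_num)).clm_apply continuous_const
  have hf2s : ∀ i, HasCompactSupport (f2 i) := fun i => (hf1s i).fderiv_apply ℝ (e i)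
  have hline : ∀ (g : E m → ℝ), Differentiable ℝ g → ∀ (c : ℝ) (x v : E m),
      HasLineDerivAt ℝ (fun y => g (c • y)) (c * fderiv ℝ g (c • x) v) x v := by
    intro g hg c x v
    have h1 : HasFDerivAt (fun y : E m => c • y) (c • ContinuousLinearMap.id ℝ (E m)) x :=
      (hasFDerivAt_id x).const_smul c
    have := ((hg (c • x)).hasFDerivAt.comp x h1).hasLineDerivAt v
    simpa [Function.comp_def] using this
  have hc : ∀ n : ℕ, ((n : ℝ) + 1)⁻¹ ≠ 0 := fun n => by positivity
  have hsupp : ∀ (g : E m → ℝ), HasCompactSupport g → ∀ n : ℕ,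
      HasCompactSupport (fun x => g (((n : ℝ) + 1)⁻¹ • x)) := fun g hg n =>
    hg.comp_homeomorph (Homeomorph.smulOfNeZero _ (hc n))
  choose M hM using fun i => (hf2 i).bounded_above_of_compact_support (hf2s i)
  have hlim : Tendsto (fun n : ℕ => ((n : ℝ) + 1)⁻¹) atTop (𝓝 0) := by
    simpa using tendsto_one_div_add_atTop_nhds_zero_nat (𝕜 := ℝ)
  have hlimx : ∀ x : E m, Tendsto (fun n : ℕ => ((n : ℝ) + 1)⁻¹ • x) atTop (𝓝 0) := by
    intro x
    simpa using hlim.smul_const x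
  refine ⟨fun n =>
    { fn := fun x => f (((n : ℝ) + 1)⁻¹ • x)
      d := fun i x => ((n : ℝ) + 1)⁻¹ * f1 i (((n : ℝ) + 1)⁻¹ • x)
      dd := fun i x => ((n : ℝ) + 1)⁻¹ * (((n : ℝ) + 1)⁻¹ * f2 i (((n : ℝ) + 1)⁻¹ • x))
      cont := hf.continuous.comp (by fun_prop)
      cont_d := fun i => continuous_const.mul ((hf1 i).continuous.comp (by fun_prop))
      cont_dd := fun i => continuous_const.mul (continuous_const.mul ((hf2 i).comp (by fun_prop)))
      supp := hsupp _ hfs n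
      supp_d := fun i => (hsupp _ (hf1s i) n).mul_left
      supp_dd := fun i => ((hsupp _ (hf2s i) n).mul_left).mul_left
      deriv_d := fun i x => hline f (hf.differentiable (by norm_num)) _ x _
      deriv_dd := fun i x =>
        HasDerivAt.const_mul _ (hline (f1 i) ((hf1 i).differentiable (by norm_num)) _ x _)
      nonneg := fun x => f.nonneg
      le_one := fun x => f.le_one }, ∑ i, |M i|, ?_, ?_, ?_⟩
  · intro x
    have h := (hf.continuous.tendsto 0).comp (hlimx x)
    have h1 : f (0 : E m) = 1 := f.one_of_mem_closedBall (by simp [f])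
    rwa [h1] at h
  · intro i x
    have h := hlim.mul (hlim.mul (((hf2 i).tendsto 0).comp (hlimx x)))
    simpa using h
  · intro n i x
    have h1 : |((n : ℝ) + 1)⁻¹| ≤ 1 := by
      rw [abs_of_nonneg (by positivity)]
      exact inv_le_one_of_one_le₀ (by linarith [(Nat.cast_nonneg n : (0 : ℝ) ≤ n)])
    have h2 := hM i (((n : ℝ) + 1)⁻¹ • x)
    rw [Real.norm_eq_abs] at h2
    simp only [abs_mul]
    calc _ ≤ 1 * (1 * M i) := by gcongr
      _ ≤ |M i| := by simpa using le_abs_self _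
      _ ≤ _ := Finset.single_le_sum (f := fun i => |M i|) (fun j _ => abs_nonneg _)
        (Finset.mem_univ i)

lemma integral_mul_lineDeriv_eq_neg {f f' g g' : E m → ℝ} {v : E m} (hf : Continuous f)
    (hf' : Continuous f') (hg : Continuous g) (hg' : Continuous g') (hfs : HasCompactSupport f)
    (hfs' : HasCompactSupport f') (hd : ∀ x, HasLineDerivAt ℝ f (f' x) x v)
    (hd' : ∀ x, HasLineDerivAt ℝ g (g' x) x v) :
    ∫ x, f x * g' x = -∫ x, f' x * g x :=
  integral_bilinear_hasLineDerivAt_right_eq_neg_left_of_integrable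
    (B := ContinuousLinearMap.mul ℝ ℝ)
    ((hf'.mul hg).integrable_of_hasCompactSupport hfs'.mul_right)
    ((hf.mul hg').integrable_of_hasCompactSupport hfs.mul_right)
    ((hf.mul hg).integrable_of_hasCompactSupport hfs.mul_right)
    (fun x _ => hd x) (fun x _ => hd' x)

lemma integrable_cutoff_mul_prod {η : E m → ℝ} {G : ℝ × E m → ℝ} {a b : ℝ} (ha : 0 < a)
    (hη : Continuous η) (hηs : HasCompactSupport η) (hG : ContinuousOn G (Ioi 0 ×ˢ univ)) :
    Integrable (fun p : ℝ × E m => η p.2 * G p) ((volume.restrict (Ioc a b)).prod volume) := by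
  rw [← Measure.restrict_univ (μ := (volume : Measure (E m))), Measure.prod_restrict]
  have h1 : IntegrableOn (fun p : ℝ × E m => η p.2 * G p) (Icc a b ×ˢ tsupport η)
      (volume.prod volume) := by
    refine ContinuousOn.integrableOn_compact (isCompact_Icc.prod hηs) ?_
    refine ContinuousOn.mul (by fun_prop) (hG.mono ?_)
    exact prod_mono (fun s hs => ha.trans_le hs.1) (subset_univ _)
  refine h1.of_forall_sdiff_eq_zero (measurableSet_Ioc.prod MeasurableSet.univ) ?_
  rintro ⟨s, x⟩ ⟨⟨hs, -⟩, hx⟩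
  have : x ∉ tsupport η := fun h => hx ⟨Ioc_subset_Icc_self hs, h⟩
  simp [image_eq_zero_of_notMem_tsupport this]

/-! ### Dissipation of the relative entropy along the heat flow -/

/-- The relative entropy integrand of two heat flows. -/
def heatEnt (μ ν : Measure (E m)) (s : ℝ) (x : E m) : ℝ := ent (heat μ s x) (heat ν s x)

/-- The relative Fisher information integrand of two heat flows. -/
def heatFisher (μ ν : Measure (E m)) (s : ℝ) (x : E m) : ℝ :=
  ∑ i, heat μ s x * (heatD μ i s x / heat μ s x - heatD ν i s x / heat ν s x) ^ 2

/-- The time derivative of `heatEnt`. -/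
def heatEntT (μ ν : Measure (E m)) (s : ℝ) (x : E m) : ℝ :=
  (Real.log (heat μ s x) - Real.log (heat ν s x)) * ((∑ i, heatDD μ i s x) / 2) +
    (1 - heat μ s x / heat ν s x) * ((∑ i, heatDD ν i s x) / 2)

lemma heatFisher_nonneg (μ ν : Measure (E m)) {s : ℝ} (hs : 0 < s) (x : E m) : 0 ≤ heatFisher μ ν s x :=
  Finset.sum_nonneg fun _ _ => mul_nonneg (heat_nonneg μ hs x) (sq_nonneg _)

section Dissipation

variable (μ ν : Measure (E m)) [IsFiniteMeasure μ] [IsFiniteMeasure ν] [NeZero μ] [NeZero ν]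

lemma continuousOn_log_heat :
    ContinuousOn (fun p : ℝ × E m => Real.log (heat μ p.1 p.2)) (Ioi 0 ×ˢ univ) :=
  (continuousOn_heat μ).log fun p hp => (heat_pos μ hp.1 p.2).ne'

lemma continuousOn_div_heat {G : ℝ × E m → ℝ} (hG : ContinuousOn G (Ioi 0 ×ˢ univ)) :
    ContinuousOn (fun p : ℝ × E m => G p / heat μ p.1 p.2) (Ioi 0 ×ˢ univ) :=
  hG.div (continuousOn_heat μ) fun p hp => (heat_pos μ hp.1 p.2).ne'

lemma continuousOn_heatEnt :
    ContinuousOn (fun p : ℝ × E m => heatEnt μ ν p.1 p.2) (Ioi 0 ×ˢ univ) :=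
  ((((continuousOn_heat μ).mul (continuousOn_log_heat μ)).sub
    ((continuousOn_heat μ).mul (continuousOn_log_heat ν))).sub (continuousOn_heat μ)).add
    (continuousOn_heat ν)

lemma continuousOn_heatFisher :
    ContinuousOn (fun p : ℝ × E m => heatFisher μ ν p.1 p.2) (Ioi 0 ×ˢ univ) :=
  continuousOn_finsetSum _ fun i _ => (continuousOn_heat μ).mul
    (((continuousOn_div_heat μ (continuousOn_heatD μ i)).sub
      (continuousOn_div_heat ν (continuousOn_heatD ν i))).pow 2)

lemma continuousOn_heatEntT :
    ContinuousOn (fun p : ℝ × E m => heatEntT μ ν p.1 p.2) (Ioi 0 ×ˢ univ) :=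
  (((continuousOn_log_heat μ).sub (continuousOn_log_heat ν)).mul
    ((continuousOn_finsetSum _ fun i _ => continuousOn_heatDD μ i).div_const 2)).add
  ((continuousOn_const.sub (continuousOn_div_heat ν (continuousOn_heat μ))).mul
    ((continuousOn_finsetSum _ fun i _ => continuousOn_heatDD ν i).div_const 2))

lemma continuous_of_continuousOn_prod {G : ℝ × E m → ℝ} (hG : ContinuousOn G (Ioi 0 ×ˢ univ))
    {s : ℝ} (hs : 0 < s) : Continuous fun x => G (s, x) := by
  rw [← continuousOn_univ]
  exact hG.comp (f := fun y : E m => (s, y)) (by fun_prop) (fun y _ => ⟨hs, mem_univ _⟩)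

lemma continuousOn_time_of_continuousOn_prod {G : ℝ × E m → ℝ}
    (hG : ContinuousOn G (Ioi 0 ×ˢ univ)) (x : E m) : ContinuousOn (fun s => G (s, x)) (Ioi 0) :=
  hG.comp (f := fun s : ℝ => (s, x)) (by fun_prop) (fun s hs => ⟨hs, mem_univ _⟩)

lemma hasDerivAt_heatEnt {s : ℝ} (hs : 0 < s) (x : E m) :
    HasDerivAt (fun t => heatEnt μ ν t x) (heatEntT μ ν s x) s :=
  HasDerivAt.ent (hasDerivAt_heat μ hs x) (hasDerivAt_heat ν hs x) (heat_pos μ hs x).ne'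
    (heat_pos ν hs x).ne'

/-- The spatial integration by parts behind the entropy dissipation. -/
lemma integral_cutoff_mul_heatEntT (χ : Cutoff m) {s : ℝ} (hs : 0 < s) :
    ∫ x, χ.fn x * heatEntT μ ν s x =
      (∑ i, ∫ x, χ.dd i x * heatEnt μ ν s x) / 2 - (∫ x, χ.fn x * heatFisher μ ν s x) / 2 := by
  let e : Fin m → E m := fun i => EuclideanSpace.single i 1
  have hu0 : ∀ x, heat μ s x ≠ 0 := fun x => (heat_pos μ hs x).ne'
  have hv0 : ∀ x, heat ν s x ≠ 0 := fun x => (heat_pos ν hs x).ne'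
  have cu : Continuous (heat μ s) := continuous_of_continuousOn_prod (continuousOn_heat μ) hs
  have cv : Continuous (heat ν s) := continuous_of_continuousOn_prod (continuousOn_heat ν) hs
  have cu1 : ∀ i, Continuous (heatD μ i s) := fun i =>
    continuous_of_continuousOn_prod (continuousOn_heatD μ i) hs
  have cv1 : ∀ i, Continuous (heatD ν i s) := fun i =>
    continuous_of_continuousOn_prod (continuousOn_heatD ν i) hs
  have cu2 : ∀ i, Continuous (heatDD μ i s) := fun i =>
    continuous_of_continuousOn_prod (continuousOn_heatDD μ i) hs
  have cv2 : ∀ i, Continuous (heatDD ν i s) := fun i =>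
    continuous_of_continuousOn_prod (continuousOn_heatDD ν i) hs
  have ch : Continuous (heatEnt μ ν s) :=
    continuous_of_continuousOn_prod (continuousOn_heatEnt μ ν) hs
  have clu : Continuous fun x => Real.log (heat μ s x) := cu.log hu0
  have clv : Continuous fun x => Real.log (heat ν s x) := cv.log hv0
  let h1 : Fin m → E m → ℝ := fun i x =>
    (Real.log (heat μ s x) - Real.log (heat ν s x)) * heatD μ i s x +
      (1 - heat μ s x / heat ν s x) * heatD ν i s x
  let q : Fin m → E m → ℝ := fun i x =>
    heat μ s x * (heatD μ i s x / heat μ s x - heatD ν i s x / heat ν s x) ^ 2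
  let h2 : Fin m → E m → ℝ := fun i x =>
    (Real.log (heat μ s x) - Real.log (heat ν s x)) * heatDD μ i s x +
      (1 - heat μ s x / heat ν s x) * heatDD ν i s x
  have ch1 : ∀ i, Continuous (h1 i) := fun i =>
    ((clu.sub clv).mul (cu1 i)).add ((continuous_const.sub (cu.div cv hv0)).mul (cv1 i))
  have cq : ∀ i, Continuous (q i) := fun i =>
    cu.mul ((((cu1 i).div cu hu0).sub ((cv1 i).div cv hv0)).pow 2)
  have ch2 : ∀ i, Continuous (h2 i) := fun i =>
    ((clu.sub clv).mul (cu2 i)).add ((continuous_const.sub (cu.div cv hv0)).mul (cv2 i))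
  have dh : ∀ i x, HasLineDerivAt ℝ (heatEnt μ ν s) (h1 i x) x (e i) := by
    intro i x
    have := HasDerivAt.ent (hasLineDerivAt_heat μ hs x i) (hasLineDerivAt_heat ν hs x i)
      (by simpa using hu0 x) (by simpa using hv0 x)
    simpa [HasLineDerivAt, h1, e, heatEnt] using this
  -- Differentiating the coefficients `log u - log v` and `1 - u / v` produces terms that complete
  -- to the square `q i`. The remaining `h2 i` sum to twice the time derivative, by the heat
  -- equation.
  have dh1 : ∀ i x, HasLineDerivAt ℝ (h1 i) (h2 i x + q i x) x (e i) := by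
    intro i x
    have du := hasLineDerivAt_heat μ hs x i
    have dv := hasLineDerivAt_heat ν hs x i
    have hu0' : heat μ s (x + (0 : ℝ) • e i) ≠ 0 := hu0 _
    have hv0' : heat ν s (x + (0 : ℝ) • e i) ≠ 0 := hv0 _
    have d1 := ((HasDerivAt.log du hu0').sub (HasDerivAt.log dv hv0')).mul
      (hasLineDerivAt_heatD μ hs x i)
    have d2 := ((HasDerivAt.div du dv hv0').const_sub 1).mul (hasLineDerivAt_heatD ν hs x i)
    refine (d1.add d2).congr_deriv ?_
    have hx1 := hu0 x
    have hx2 := hv0 x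
    simp only [zero_smul, add_zero, h2, q, Pi.sub_apply, Pi.div_apply]
    field_simp
    ring
  have ibp : ∀ i, ∫ x, χ.fn x * h2 i x =
      (∫ x, χ.dd i x * heatEnt μ ν s x) - ∫ x, χ.fn x * q i x := by
    intro i
    have e1 := integral_mul_lineDeriv_eq_neg χ.cont (χ.cont_d i) (ch1 i) ((ch2 i).add (cq i))
      χ.supp (χ.supp_d i) (χ.deriv_d i) (dh1 i)
    have e2 := integral_mul_lineDeriv_eq_neg (χ.cont_d i) (χ.cont_dd i) ch (ch1 i)
      (χ.supp_d i) (χ.supp_dd i) (χ.deriv_dd i) (dh i)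
    rw [e2, neg_neg] at e1
    rw [← e1, ← integral_sub]
    · refine integral_congr_ae (ae_of_all _ fun x => ?_)
      simp only [Pi.add_apply]
      ring
    · exact (χ.cont.mul ((ch2 i).add (cq i))).integrable_of_hasCompactSupport χ.supp.mul_right
    · exact (χ.cont.mul (cq i)).integrable_of_hasCompactSupport χ.supp.mul_right
  have s1 : ∀ x, χ.fn x * heatEntT μ ν s x = (∑ i, χ.fn x * h2 i x) / 2 := by
    intro x
    simp only [heatEntT, h2, ← Finset.mul_sum, Finset.sum_add_distrib]
    ring
  have s2 : ∀ x, χ.fn x * heatFisher μ ν s x = ∑ i, χ.fn x * q i x := by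
    intro x
    simp only [heatFisher, q, Finset.mul_sum]
  simp_rw [s1, s2]
  rw [integral_div, integral_finsetSum, integral_finsetSum, ← sub_div, ← Finset.sum_sub_distrib]
  · simp_rw [ibp]
  · exact fun i _ => (χ.cont.mul (cq i)).integrable_of_hasCompactSupport χ.supp.mul_right
  · exact fun i _ => (χ.cont.mul (ch2 i)).integrable_of_hasCompactSupport χ.supp.mul_right

/-- The space-time integral of the cut-off entropy rate is evaluated in both orders: time first by
the fundamental theorem of calculus, space first by `integral_cutoff_mul_heatEntT`. -/
lemma cutoff_dissipation (χ : Cutoff m) {a b : ℝ} (ha : 0 < a) (hab : a ≤ b) :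
    (∫ x, χ.fn x * heatEnt μ ν a x) +
        (∑ i, ∫ p : ℝ × E m, χ.dd i p.2 * heatEnt μ ν p.1 p.2
          ∂((volume.restrict (Ioc a b)).prod volume)) / 2 =
      (∫ x, χ.fn x * heatEnt μ ν b x) +
        (∫ p : ℝ × E m, χ.fn p.2 * heatFisher μ ν p.1 p.2
          ∂((volume.restrict (Ioc a b)).prod volume)) / 2 := by
  have hb : 0 < b := ha.trans_le hab
  have iT := integrable_cutoff_mul_prod (b := b) ha χ.cont χ.supp (continuousOn_heatEntT μ ν)
  have iQ := integrable_cutoff_mul_prod (b := b) ha χ.cont χ.supp (continuousOn_heatFisher μ ν)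
  have iH := fun i =>
    integrable_cutoff_mul_prod (b := b) ha (χ.cont_dd i) (χ.supp_dd i) (continuousOn_heatEnt μ ν)
  have ih : ∀ s, 0 < s → Integrable fun x => χ.fn x * heatEnt μ ν s x := fun s hs =>
    (χ.cont.mul (continuous_of_continuousOn_prod
      (continuousOn_heatEnt μ ν) hs)).integrable_of_hasCompactSupport χ.supp.mul_right
  have ftc : ∀ x, ∫ s in Ioc a b, χ.fn x * heatEntT μ ν s x =
      χ.fn x * heatEnt μ ν b x - χ.fn x * heatEnt μ ν a x := by
    intro x
    rw [integral_const_mul, ← intervalIntegral.integral_of_le hab,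
      intervalIntegral.integral_eq_sub_of_hasDerivAt (f := fun s => heatEnt μ ν s x), mul_sub]
    · intro s hs
      rw [uIcc_of_le hab] at hs
      exact hasDerivAt_heatEnt μ ν (ha.trans_le hs.1) x
    · refine ContinuousOn.intervalIntegrable ?_
      rw [uIcc_of_le hab]
      exact (continuousOn_time_of_continuousOn_prod (continuousOn_heatEntT μ ν) x).mono
        fun s hs => ha.trans_le hs.1
  have e1 : ∫ p : ℝ × E m, χ.fn p.2 * heatEntT μ ν p.1 p.2
      ∂((volume.restrict (Ioc a b)).prod volume) =
      (∫ x, χ.fn x * heatEnt μ ν b x) - ∫ x, χ.fn x * heatEnt μ ν a x := by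
    rw [integral_prod_symm _ iT, ← integral_sub (ih b hb) (ih a ha)]
    exact integral_congr_ae (ae_of_all _ ftc)
  have e2 : ∫ p : ℝ × E m, χ.fn p.2 * heatEntT μ ν p.1 p.2
      ∂((volume.restrict (Ioc a b)).prod volume) =
      (∑ i, ∫ p : ℝ × E m, χ.dd i p.2 * heatEnt μ ν p.1 p.2
          ∂((volume.restrict (Ioc a b)).prod volume)) / 2 -
        (∫ p : ℝ × E m, χ.fn p.2 * heatFisher μ ν p.1 p.2
          ∂((volume.restrict (Ioc a b)).prod volume)) / 2 := by
    rw [integral_prod _ iT, integral_prod _ iQ]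
    simp_rw [fun i => integral_prod _ (iH i)]
    rw [← integral_finsetSum _ fun i _ => (iH i).integral_prod_left, ← integral_div,
      ← integral_div, ← integral_sub]
    · refine setIntegral_congr_fun measurableSet_Ioc fun s hs => ?_
      exact integral_cutoff_mul_heatEntT μ ν χ (ha.trans hs.1)
    · exact (integrable_finsetSum _ fun i _ => (iH i).integral_prod_left).div_const 2
    · exact iQ.integral_prod_left.div_const 2
  linarith

lemma heatEnt_nonneg {s : ℝ} (hs : 0 < s) (x : E m) : 0 ≤ heatEnt μ ν s x :=
  ent_nonneg (heat_pos μ hs x).le (heat_pos ν hs x)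

/-- Entropy dissipation between two positive times, for flows of comparable size. -/
theorem heatEnt_dissipation {c a b : ℝ} (ha : 0 < a) (hab : a ≤ b)
    (hc : ∀ s, 0 < s → ∀ x, heatEnt μ ν s x ≤ c * (heat μ s x + heat ν s x)) :
    ∫⁻ x, ENNReal.ofReal (heatEnt μ ν a x) =
      (∫⁻ x, ENNReal.ofReal (heatEnt μ ν b x)) +
        (∫⁻ p : ℝ × E m, ENNReal.ofReal (heatFisher μ ν p.1 p.2)
          ∂((volume.restrict (Ioc a b)).prod volume)) / 2 := by
  have hb : 0 < b := ha.trans_le hab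
  set P : Measure (ℝ × E m) := (volume.restrict (Ioc a b)).prod volume with hP
  have hPpos : ∀ᵐ p ∂P, 0 < p.1 := by
    rw [hP, ← Measure.restrict_univ (μ := (volume : Measure (E m))), Measure.prod_restrict]
    filter_upwards [ae_restrict_mem (measurableSet_Ioc.prod MeasurableSet.univ)] with p hp
      using ha.trans hp.1.1
  have hPmeas : ∀ G : ℝ × E m → ℝ, ContinuousOn G (Ioi 0 ×ˢ univ) → AEStronglyMeasurable G P := by
    intro G hG
    rw [hP, ← Measure.restrict_univ (μ := (volume : Measure (E m))), Measure.prod_restrict]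
    exact (hG.mono (prod_mono (fun s hs => ha.trans hs.1) Subset.rfl)).aestronglyMeasurable
      (measurableSet_Ioc.prod MeasurableSet.univ)
  have ih : ∀ s, 0 < s → Integrable (heatEnt μ ν s) := by
    intro s hs
    refine (((integrable_heat μ hs).add (integrable_heat ν hs)).const_mul c).mono'
      (continuous_of_continuousOn_prod (continuousOn_heatEnt μ ν) hs).aestronglyMeasurable
      (ae_of_all _ fun x => ?_)
    rw [Real.norm_of_nonneg (heatEnt_nonneg μ ν hs x)]
    exact hc s hs x
  -- The bound `hc` enters here: the masses are constant in time, so the entropy is integrable over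
  -- the slab and dominates the error terms with second derivatives of the cutoff.
  have iH : Integrable (fun p : ℝ × E m => heatEnt μ ν p.1 p.2) P := by
    refine (((integrable_heat_prod μ ha).add (integrable_heat_prod ν ha)).const_mul c).mono'
      (hPmeas _ (continuousOn_heatEnt μ ν)) ?_
    filter_upwards [hPpos] with p hp
    rw [Real.norm_of_nonneg (heatEnt_nonneg μ ν hp _)]
    exact hc _ hp _
  obtain ⟨χ, M, hχ1, hχ2, hχM⟩ := exists_cutoff_seq m
  have lim1 : ∀ s, 0 < s → Tendsto (fun n => ∫ x, (χ n).fn x * heatEnt μ ν s x) atTop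
      (𝓝 (∫ x, heatEnt μ ν s x)) := by
    intro s hs
    refine tendsto_integral_of_dominated_convergence (heatEnt μ ν s)
      (fun n => ((χ n).cont.aestronglyMeasurable.mul (ih s hs).1)) (ih s hs)
      (fun n => ae_of_all _ fun x => ?_) (ae_of_all _ fun x => ?_)
    · have h0 := heatEnt_nonneg μ ν hs x
      rw [Real.norm_of_nonneg (mul_nonneg ((χ n).nonneg x) h0)]
      exact mul_le_of_le_one_left h0 ((χ n).le_one x)
    · simpa using (hχ1 x).mul_const (heatEnt μ ν s x)
  have lim2 : ∀ i, Tendsto (fun n => ∫ p : ℝ × E m, (χ n).dd i p.2 * heatEnt μ ν p.1 p.2 ∂P) atTop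
      (𝓝 0) := by
    intro i
    rw [← integral_zero (ℝ × E m) ℝ (μ := P)]
    refine tendsto_integral_of_dominated_convergence (fun p => M * heatEnt μ ν p.1 p.2)
      (fun n => ((((χ n).cont_dd i).comp continuous_snd).aestronglyMeasurable.mul iH.1))
      (iH.const_mul M) (fun n => ?_) (ae_of_all _ fun p => ?_)
    · filter_upwards [hPpos] with p hp
      have h0 := heatEnt_nonneg μ ν hp p.2
      rw [norm_mul, Real.norm_of_nonneg h0]
      exact mul_le_mul_of_nonneg_right (hχM n i p.2) h0
    · simpa using (hχ2 i p.2).mul_const (heatEnt μ ν p.1 p.2)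
  set A := ∫ x, heatEnt μ ν a x
  set B := ∫ x, heatEnt μ ν b x
  have lim3 : Tendsto (fun n => ∫ p : ℝ × E m, (χ n).fn p.2 * heatFisher μ ν p.1 p.2 ∂P) atTop
      (𝓝 (2 * (A - B))) := by
    have h1 := (((lim1 a ha).add ((tendsto_finsetSum Finset.univ fun i _ => lim2 i).div_const
      2)).sub (lim1 b hb)).const_mul 2
    simp only [Finset.sum_const_zero, zero_div, add_zero] at h1
    refine h1.congr fun n => ?_
    have := cutoff_dissipation μ ν (χ n) ha hab
    linarith
  have hQn : ∀ n, ENNReal.ofReal (∫ p : ℝ × E m, (χ n).fn p.2 * heatFisher μ ν p.1 p.2 ∂P) =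
      ∫⁻ p : ℝ × E m, ENNReal.ofReal ((χ n).fn p.2 * heatFisher μ ν p.1 p.2) ∂P := by
    intro n
    refine ofReal_integral_eq_lintegral_ofReal
      (integrable_cutoff_mul_prod ha (χ n).cont (χ n).supp (continuousOn_heatFisher μ ν)) ?_
    filter_upwards [hPpos] with p hp
    exact mul_nonneg ((χ n).nonneg _) (heatFisher_nonneg μ ν hp _)
  have lim4 : Tendsto (fun n => ∫⁻ p : ℝ × E m,
      ENNReal.ofReal ((χ n).fn p.2 * heatFisher μ ν p.1 p.2) ∂P) atTop
      (𝓝 (ENNReal.ofReal (2 * (A - B)))) := by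
    simp_rw [← hQn]
    exact (ENNReal.continuous_ofReal.tendsto _).comp lim3
  have hQ : ∫⁻ p : ℝ × E m, ENNReal.ofReal (heatFisher μ ν p.1 p.2) ∂P =
      ENNReal.ofReal (2 * (A - B)) := by
    -- Fatou's lemma gives one inequality and `χ ≤ 1` the other, so integrability of the Fisher
    -- information need not be known beforehand.
    apply le_antisymm
    · rw [← lim4.liminf_eq]
      refine le_trans (le_of_eq ?_) (lintegral_liminf_le' fun n => ?_)
      · refine lintegral_congr fun p => ?_
        refine (Tendsto.liminf_eq ?_).symm
        refine (ENNReal.continuous_ofReal.tendsto _).comp ?_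
        simpa using (hχ1 p.2).mul_const (heatFisher μ ν p.1 p.2)
      · exact ((((χ n).cont.comp continuous_snd).aestronglyMeasurable.mul
          (hPmeas _ (continuousOn_heatFisher μ ν))).aemeasurable).ennreal_ofReal
    · refine le_of_tendsto' lim4 fun n => lintegral_mono_ae ?_
      filter_upwards [hPpos] with p hp
      exact ENNReal.ofReal_le_ofReal
        (mul_le_of_le_one_left (heatFisher_nonneg μ ν hp _) ((χ n).le_one _))
  have hAB : 0 ≤ A - B := by
    have : 0 ≤ 2 * (A - B) := ge_of_tendsto' lim3 fun n => integral_nonneg_of_ae <| by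
      filter_upwards [hPpos] with p hp
      exact mul_nonneg ((χ n).nonneg _) (heatFisher_nonneg μ ν hp _)
    linarith
  have hB : 0 ≤ B := integral_nonneg fun x => heatEnt_nonneg μ ν hb x
  rw [hQ, ← ofReal_integral_eq_lintegral_ofReal (ih a ha)
      (ae_of_all _ fun x => heatEnt_nonneg μ ν ha x),
    ← ofReal_integral_eq_lintegral_ofReal (ih b hb)
      (ae_of_all _ fun x => heatEnt_nonneg μ ν hb x),
    ENNReal.ofReal_mul zero_le_two, ENNReal.ofReal_ofNat, mul_comm (2 : ℝ≥0∞),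
    ENNReal.mul_div_cancel_right two_ne_zero ENNReal.ofNat_ne_top, ← ENNReal.ofReal_add hB hAB]
  congr 1
  ring

end Dissipation

/-! ### Convergence of the heat flow in `L¹` -/

lemma lintegral_comp_smul_pos {c : ℝ} (hc : 0 < c) (G : E m → ℝ≥0∞) :
    ∫⁻ x, G x = ENNReal.ofReal (c ^ m) * ∫⁻ x, G (c • x) := by
  have h := lintegral_map_equiv (μ := (volume : Measure (E m))) G
    (Homeomorph.smulOfNeZero c hc.ne').toMeasurableEquiv
  have h2 : Measure.map (Homeomorph.smulOfNeZero c hc.ne').toMeasurableEquiv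
      (volume : Measure (E m)) = ENNReal.ofReal |(c ^ m)⁻¹| • volume := by
    have := Measure.map_addHaar_smul (volume : Measure (E m)) hc.ne'
    rw [finrank_euclideanSpace, Fintype.card_fin] at this
    exact this
  rw [h2, lintegral_smul_measure] at h
  have h3 : ∫⁻ x, G (c • x) = ENNReal.ofReal |(c ^ m)⁻¹| * ∫⁻ x, G x := h.symm
  rw [h3, ← mul_assoc, ← ENNReal.ofReal_mul (by positivity), abs_of_pos (by positivity),
    mul_inv_cancel₀ (by positivity), ENNReal.ofReal_one, one_mul]

/-- Parabolic scaling. It reduces every time to time `1` in the `L¹` limits and carries the dilation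
between diffusion and heat flow. -/
lemma heatKernel_smul {c s : ℝ} (hc : 0 < c) (hs : 0 < s) (y : E m) :
    c ^ m * heatKernel (c ^ 2 * s) (c • y) = heatKernel s y := by
  unfold heatKernel
  have h1 : 2 * Real.pi * (c ^ 2 * s) = c ^ 2 * (2 * Real.pi * s) := by ring
  have h2 : ‖c • y‖ ^ 2 / (2 * (c ^ 2 * s)) = ‖y‖ ^ 2 / (2 * s) := by
    rw [norm_smul, mul_pow, Real.norm_eq_abs, sq_abs]
    field_simp
  have h3 : (c ^ 2) ^ (-(m : ℝ) / 2) = (c ^ m)⁻¹ := by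
    rw [← Real.rpow_natCast c 2, ← Real.rpow_mul hc.le, ← Real.rpow_natCast c m,
      ← Real.rpow_neg hc.le]
    congr 1
    push_cast
    ring
  rw [h1, h2, Real.mul_rpow (by positivity) (by positivity), h3]
  field_simp

/-- Continuity of translations in `L¹`. -/
lemma tendsto_lintegral_translate_sub {f : E m → ℝ} (hf : Integrable f) :
    Tendsto (fun w : E m => ∫⁻ x, ‖f (x - w) - f x‖ₑ) (𝓝 0) (𝓝 0) := by
  let g : E m → C(E m, E m) := fun w => ⟨fun x => x - w, by fun_prop⟩
  -- The translations are the curried form of a jointly continuous map, hence continuous for the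
  -- compact-open topology.
  have hg : Continuous g := by
    let G : C(E m × E m, E m) := ⟨fun p => p.2 - p.1, by fun_prop⟩
    exact G.curry.continuous
  have hgm : ∀ w, MeasurePreserving (g w) (volume : Measure (E m)) volume := fun w =>
    measurePreserving_sub_right volume w
  let F : Lp ℝ 1 (volume : Measure (E m)) := hf.toL1 f
  have hcont : Continuous fun w => Lp.compMeasurePreserving (g w) (hgm w) F :=
    Continuous.compMeasurePreservingLp continuous_const hg hgm ENNReal.one_ne_top
  have hF : (F : E m → ℝ) =ᵐ[volume] f := hf.coeFn_toL1
  have hlim : Tendsto (fun w => edist (Lp.compMeasurePreserving (g w) (hgm w) F)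
      (Lp.compMeasurePreserving (g 0) (hgm 0) F)) (𝓝 0) (𝓝 0) := by
    have := (hcont.tendsto 0).edist (tendsto_const_nhds
      (x := Lp.compMeasurePreserving (g 0) (hgm 0) F))
    simpa using this
  refine hlim.congr fun w => ?_
  rw [Lp.edist_def, eLpNorm_one_eq_lintegral_enorm]
  refine lintegral_congr_ae ?_
  have hcoe : ∀ w, (Lp.compMeasurePreserving (g w) (hgm w) F : E m → ℝ) =ᵐ[volume]
      fun x => f (x - w) := by
    intro w
    refine (Lp.coeFn_compMeasurePreserving F (hgm w)).trans ?_
    exact (hgm w).quasiMeasurePreserving.ae_eq_comp hF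
  filter_upwards [hcoe w, hcoe 0] with x h1 h2
  simp only [Pi.sub_apply, h1, h2, sub_zero]

lemma lintegral_translate_sub_le (f : E m → ℝ) (hf : Measurable f) (w : E m) :
    ∫⁻ x, ‖f (x - w) - f x‖ₑ ≤ 2 * ∫⁻ x, ‖f x‖ₑ := by
  calc ∫⁻ x, ‖f (x - w) - f x‖ₑ ≤ ∫⁻ x, (‖f (x - w)‖ₑ + ‖f x‖ₑ) :=
        lintegral_mono fun x => enorm_sub_le
    _ = 2 * ∫⁻ x, ‖f x‖ₑ := by
        rw [lintegral_add_right _ hf.enorm, lintegral_sub_right_eq_self (fun x => ‖f x‖ₑ), two_mul]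

lemma measurable_lintegral_translate_sub {f : E m → ℝ} (hf : Measurable f) :
    Measurable fun w : E m => ∫⁻ x, ‖f (x - w) - f x‖ₑ := by
  refine Measurable.lintegral_prod_right' (f := fun p : E m × E m => ‖f (p.2 - p.1) - f p.2‖ₑ) ?_
  fun_prop

lemma measurable_heatKernel (s : ℝ) : Measurable (heatKernel (m := m) s) := by
  unfold heatKernel; fun_prop

lemma lintegral_heatKernel {s : ℝ} (hs : 0 < s) :
    ∫⁻ y : E m, ENNReal.ofReal (heatKernel s y) = 1 := by
  rw [← ofReal_integral_eq_lintegral_ofReal (integrable_heatKernel hs)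
    (ae_of_all _ fun y => (heatKernel_pos hs y).le), integral_heatKernel hs, ENNReal.ofReal_one]

lemma enorm_heatKernel {s : ℝ} (hs : 0 < s) (y : E m) :
    ‖heatKernel s y‖ₑ = ENNReal.ofReal (heatKernel s y) :=
  Real.enorm_of_nonneg (heatKernel_pos hs y).le

lemma integrable_heatKernel_mul {f : E m → ℝ} (hf : Integrable f) {s : ℝ} (hs : 0 < s) (x : E m) :
    Integrable fun z => heatKernel s (x - z) * f z := by
  obtain ⟨C, hC⟩ := admissibleKernel_heatKernel.bounded (m := m) s hs
  exact hf.bdd_mul (c := C)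
    ((admissibleKernel_heatKernel.continuous hs).comp (by fun_prop)).aestronglyMeasurable
    (ae_of_all _ fun z => hC s le_rfl _)

lemma sqrt_sq_mul_one {s : ℝ} (hs : 0 < s) : Real.sqrt s ^ 2 * 1 = s := by
  rw [Real.sq_sqrt hs.le, mul_one]

/-- The heat semigroup is strongly continuous in `L¹` at time `0`. -/
lemma tendsto_lintegral_heatKernel_conv_sub {f : E m → ℝ} (hfm : Measurable f)
    (hf : Integrable f) :
    Tendsto (fun s : ℝ => ∫⁻ x, ‖(∫ z, heatKernel s (x - z) * f z) - f x‖ₑ) (𝓝[>] 0) (𝓝 0) := by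
  let ω : E m → ℝ≥0∞ := fun w => ∫⁻ x, ‖f (x - w) - f x‖ₑ
  have hω : Measurable ω := measurable_lintegral_translate_sub hfm
  -- Since the kernel has mass one, the difference averages `f (x - w) - f x`. Tonelli and the
  -- substitution `w = √s ξ` leave a fixed Gaussian average of the translation modulus `ω`, with the
  -- time only inside `ω`.
  have hbound : ∀ s : ℝ, 0 < s → ∫⁻ x, ‖(∫ z, heatKernel s (x - z) * f z) - f x‖ₑ ≤
      ∫⁻ ξ : E m, ENNReal.ofReal (heatKernel 1 ξ) * ω (Real.sqrt s • ξ) := by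
    intro s hs
    have hsq : 0 < Real.sqrt s := Real.sqrt_pos.2 hs
    have e1 : ∀ x, ‖(∫ z, heatKernel s (x - z) * f z) - f x‖ₑ ≤
        ∫⁻ w, ENNReal.ofReal (heatKernel s w) * ‖f (x - w) - f x‖ₑ := by
      intro x
      have h1 : ∫ z, heatKernel s (x - z) * f z = ∫ w, heatKernel s w * f (x - w) := by
        rw [← integral_sub_left_eq_self (fun z => heatKernel s (x - z) * f z) volume x]
        simp
      have i1 : Integrable fun w => heatKernel s w * f (x - w) := by
        have := (integrable_heatKernel_mul hf hs x).comp_sub_left x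
        simpa using this
      have h2 : f x = ∫ w : E m, heatKernel s w * f x := by
        rw [integral_mul_const, integral_heatKernel hs, one_mul]
      rw [h1]
      nth_rewrite 1 [h2]
      rw [← integral_sub i1 ((integrable_heatKernel hs).mul_const _)]
      refine (enorm_integral_le_lintegral_enorm _).trans (le_of_eq ?_)
      refine lintegral_congr fun w => ?_
      rw [← mul_sub, enorm_mul, enorm_heatKernel hs]
    have hK := measurable_heatKernel (m := m) s
    calc ∫⁻ x, ‖(∫ z, heatKernel s (x - z) * f z) - f x‖ₑ
        ≤ ∫⁻ x, ∫⁻ w, ENNReal.ofReal (heatKernel s w) * ‖f (x - w) - f x‖ₑ := lintegral_mono e1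
      _ = ∫⁻ w, ∫⁻ x, ENNReal.ofReal (heatKernel s w) * ‖f (x - w) - f x‖ₑ := by
          refine lintegral_lintegral_swap ?_
          refine Measurable.aemeasurable ?_
          fun_prop
      _ = ∫⁻ w, ENNReal.ofReal (heatKernel s w) * ω w := by
          refine lintegral_congr fun w => ?_
          rw [lintegral_const_mul]
          fun_prop
      _ = _ := by
          rw [lintegral_comp_smul_pos hsq, ← lintegral_const_mul']
          · refine lintegral_congr fun ξ => ?_
            rw [← mul_assoc, ← ENNReal.ofReal_mul (by positivity)]
            have := heatKernel_smul hsq one_pos ξ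
            rw [sqrt_sq_mul_one hs] at this
            rw [this]
          · exact ENNReal.ofReal_ne_top
  have hK1 := measurable_heatKernel (m := m) 1
  have hlim : Tendsto (fun s : ℝ => ∫⁻ ξ : E m,
      ENNReal.ofReal (heatKernel 1 ξ) * ω (Real.sqrt s • ξ)) (𝓝[>] 0) (𝓝 0) := by
    rw [← lintegral_zero (μ := (volume : Measure (E m)))]
    refine tendsto_lintegral_filter_of_dominated_convergence
      (fun ξ => ENNReal.ofReal (heatKernel 1 ξ) * (2 * ∫⁻ x, ‖f x‖ₑ))
      (Eventually.of_forall fun s => ?_) (Eventually.of_forall fun s => ae_of_all _ fun ξ => ?_)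
      ?_ (ae_of_all _ fun ξ => ?_)
    · exact hK1.ennreal_ofReal.mul (hω.comp (by fun_prop))
    · gcongr
      exact lintegral_translate_sub_le f hfm _
    · rw [lintegral_mul_const _ hK1.ennreal_ofReal, lintegral_heatKernel one_pos, one_mul]
      exact ENNReal.mul_ne_top ENNReal.ofNat_ne_top hf.2.ne
    · have h1 : Tendsto (fun s : ℝ => Real.sqrt s • ξ) (𝓝[>] 0) (𝓝 0) := by
        have : Continuous fun s : ℝ => Real.sqrt s • ξ := by fun_prop
        have h := this.tendsto 0
        simp only [Real.sqrt_zero, zero_smul] at h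
        exact h.mono_left nhdsWithin_le_nhds
      have h2 := ((tendsto_lintegral_translate_sub hf).comp h1)
      have h3 := ENNReal.Tendsto.const_mul (a := ENNReal.ofReal (heatKernel 1 ξ)) h2
        (Or.inr ENNReal.ofReal_ne_top)
      simpa using h3
  refine tendsto_of_tendsto_of_tendsto_of_le_of_le' tendsto_const_nhds hlim
    (Eventually.of_forall fun s => zero_le) ?_
  filter_upwards [self_mem_nhdsWithin] with s hs using hbound s hs

/-- The heat flow of an initial datum of mass zero vanishes in `L¹` for large times. -/
lemma tendsto_lintegral_heatKernel_conv_atTop {f : E m → ℝ} (hfm : Measurable f)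
    (hf : Integrable f) (h0 : ∫ z, f z = 0) :
    Tendsto (fun s : ℝ => ∫⁻ x, ‖∫ z, heatKernel s (x - z) * f z‖ₑ) atTop (𝓝 0) := by
  let κ : E m → ℝ≥0∞ := fun w => ∫⁻ x, ‖heatKernel 1 (x - w) - heatKernel 1 x‖ₑ
  have hκ : Measurable κ := measurable_lintegral_translate_sub (measurable_heatKernel 1)
  -- Mass zero permits subtracting `heatKernel s x` from the kernel. After rescaling to time `1`, a
  -- shift by `z` becomes a shift by `z / √s`, which tends to zero.
  have hbound : ∀ s : ℝ, 0 < s → ∫⁻ x, ‖∫ z, heatKernel s (x - z) * f z‖ₑ ≤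
      ∫⁻ z, ‖f z‖ₑ * κ ((Real.sqrt s)⁻¹ • z) := by
    intro s hs
    have hsq : 0 < Real.sqrt s := Real.sqrt_pos.2 hs
    have hK := measurable_heatKernel (m := m) s
    have e1 : ∀ x, ‖∫ z, heatKernel s (x - z) * f z‖ₑ ≤
        ∫⁻ z, ‖f z‖ₑ * ‖heatKernel s (x - z) - heatKernel s x‖ₑ := by
      intro x
      have h1 : ∫ z, heatKernel s (x - z) * f z =
          ∫ z, f z * (heatKernel s (x - z) - heatKernel s x) := by
        have : ∫ z, heatKernel s x * f z = 0 := by rw [integral_const_mul, h0, mul_zero]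
        rw [← sub_zero (∫ z, heatKernel s (x - z) * f z), ← this,
          ← integral_sub (integrable_heatKernel_mul hf hs x) (hf.const_mul _)]
        congr 1; ext z; ring
      rw [h1]
      refine (enorm_integral_le_lintegral_enorm _).trans (le_of_eq ?_)
      exact lintegral_congr fun w => enorm_mul _ _
    calc ∫⁻ x, ‖∫ z, heatKernel s (x - z) * f z‖ₑ
        ≤ ∫⁻ x, ∫⁻ z, ‖f z‖ₑ * ‖heatKernel s (x - z) - heatKernel s x‖ₑ := lintegral_mono e1
      _ = ∫⁻ z, ∫⁻ x, ‖f z‖ₑ * ‖heatKernel s (x - z) - heatKernel s x‖ₑ := by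
          refine lintegral_lintegral_swap ?_
          refine Measurable.aemeasurable ?_
          fun_prop
      _ = _ := by
          refine lintegral_congr fun z => ?_
          rw [lintegral_const_mul _ (by fun_prop)]
          congr 1
          rw [lintegral_comp_smul_pos hsq, ← lintegral_const_mul' _ _ ENNReal.ofReal_ne_top]
          refine lintegral_congr fun x => ?_
          have k1 := heatKernel_smul hsq one_pos x
          have k2 := heatKernel_smul hsq one_pos (x - (Real.sqrt s)⁻¹ • z)
          rw [sqrt_sq_mul_one hs] at k1 k2
          rw [smul_sub, smul_inv_smul₀ hsq.ne'] at k2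
          rw [← k1, ← k2, ← mul_sub, enorm_mul,
            Real.enorm_of_nonneg (by positivity : 0 ≤ Real.sqrt s ^ m)]
  have hlim : Tendsto (fun s : ℝ => ∫⁻ z, ‖f z‖ₑ * κ ((Real.sqrt s)⁻¹ • z)) atTop (𝓝 0) := by
    rw [← lintegral_zero (μ := (volume : Measure (E m)))]
    refine tendsto_lintegral_filter_of_dominated_convergence (fun z => ‖f z‖ₑ * 2)
      (Eventually.of_forall fun s => ?_) (Eventually.of_forall fun s => ae_of_all _ fun z => ?_)
      ?_ (ae_of_all _ fun z => ?_)
    · exact hfm.enorm.mul (hκ.comp (by fun_prop))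
    · gcongr
      refine (lintegral_translate_sub_le _ (measurable_heatKernel 1) _).trans (le_of_eq ?_)
      simp_rw [enorm_heatKernel one_pos]
      rw [lintegral_heatKernel one_pos, mul_one]
    · rw [lintegral_mul_const _ hfm.enorm]
      exact ENNReal.mul_ne_top hf.2.ne ENNReal.ofNat_ne_top
    · have h1 : Tendsto (fun s : ℝ => (Real.sqrt s)⁻¹ • z) atTop (𝓝 0) := by
        have h := (tendsto_inv_atTop_zero.comp Real.tendsto_sqrt_atTop).smul_const z
        simpa using h
      have h2 := (tendsto_lintegral_translate_sub (integrable_heatKernel (m := m) one_pos)).comp h1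
      have h3 := ENNReal.Tendsto.const_mul (a := ‖f z‖ₑ) h2 (Or.inr enorm_ne_top)
      simpa using h3
  refine tendsto_of_tendsto_of_tendsto_of_le_of_le' tendsto_const_nhds hlim
    (Eventually.of_forall fun s => zero_le) ?_
  filter_upwards [Ioi_mem_atTop 0] with s hs using hbound s hs

/-! ### Regularisation by mixing the two densities -/

/-- The relative entropy integrand after mixing each density with a fraction of the other one. -/
def mixEnt (ε u v : ℝ) : ℝ := ent (u + ε * v) (v + ε * u)

lemma ent_eq {u v : ℝ} (hu : 0 < u) (hv : 0 < v) :
    ent u v = u * Real.log (u / v) + v * (1 - u / v) := by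
  unfold ent
  rw [Real.log_div hu.ne' hv.ne']
  field_simp
  ring

lemma abs_log_div_le {ε u v : ℝ} (hε : 0 < ε) (hu : 0 < u) (hv : 0 < v) (h1 : ε * v ≤ u)
    (h2 : ε * u ≤ v) : |Real.log (u / v)| ≤ ε⁻¹ := by
  have hlog : ∀ {a b : ℝ}, 0 < a → 0 < b → ε * a ≤ b → Real.log (a / b) ≤ ε⁻¹ := by
    intro a b ha hb h
    have h3 := Real.log_le_sub_one_of_pos (by positivity : 0 < a / b)
    have h4 : a / b ≤ ε⁻¹ := by
      rw [div_le_iff₀ hb, ← div_eq_inv_mul, le_div_iff₀ hε]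
      linarith
    linarith
  rw [abs_le]
  refine ⟨?_, hlog hu hv h2⟩
  have := hlog hv hu h1
  rw [← inv_div, Real.log_inv] at this
  linarith

lemma abs_one_sub_div_le {ε u v : ℝ} (hε : 0 < ε) (hε1 : ε ≤ 1) (hu : 0 < u) (hv : 0 < v)
    (h2 : ε * u ≤ v) : |1 - u / v| ≤ ε⁻¹ := by
  have h4 : u / v ≤ ε⁻¹ := by
    rw [div_le_iff₀ hv, ← div_eq_inv_mul, le_div_iff₀ hε]
    linarith
  have h5 : 0 < u / v := by positivity
  have h6 : 1 ≤ ε⁻¹ := (one_le_inv₀ hε).2 hε1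
  rw [abs_le]
  constructor <;> linarith

/-- `ent_ge` for the primed pair is used at the ratio `r = u / v` of the other pair. Comparability
of `u` and `v` bounds the coefficients `log r` and `1 - r` by `ε⁻¹`; the primed pair need not be
comparable. -/
lemma ent_le_ent_add {ε u v u' v' : ℝ} (hε : 0 < ε) (hε1 : ε ≤ 1) (hu : 0 < u) (hv : 0 < v)
    (h1 : ε * v ≤ u) (h2 : ε * u ≤ v) (hu' : 0 < u') (hv' : 0 < v') :
    ent u v ≤ ent u' v' + ε⁻¹ * (|u - u'| + |v - v'|) := by
  have h3 := ent_ge hu'.le hv' (by positivity : 0 < u / v)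
  rw [ent_eq hu hv]
  have h4 : (u - u') * Real.log (u / v) ≤ |u - u'| * ε⁻¹ :=
    (le_abs_self _).trans (by rw [abs_mul]; gcongr; exact abs_log_div_le hε hu hv h1 h2)
  have h5 : (v - v') * (1 - u / v) ≤ |v - v'| * ε⁻¹ :=
    (le_abs_self _).trans (by rw [abs_mul]; gcongr; exact abs_one_sub_div_le hε hε1 hu hv h2)
  linarith

lemma mul_mix_le {ε u v : ℝ} (hε : 0 ≤ ε) (hε1 : ε ≤ 1) (hu : 0 ≤ u) :
    ε * (v + ε * u) ≤ u + ε * v := by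
  nlinarith [mul_nonneg hε hu, mul_le_mul_of_nonneg_right hε1 (mul_nonneg hε hu)]

lemma mixEnt_le_mixEnt_add {ε u v u' v' : ℝ} (hε : 0 < ε) (hε1 : ε ≤ 1) (hu : 0 ≤ u) (hv : 0 < v)
    (hu' : 0 ≤ u') (hv' : 0 < v') :
    mixEnt ε u v ≤ mixEnt ε u' v' + 2 * ε⁻¹ * (|u - u'| + |v - v'|) := by
  have h := ent_le_ent_add hε hε1 (by positivity : 0 < u + ε * v) (by positivity : 0 < v + ε * u)
    (mul_mix_le hε.le hε1 hu) (mul_mix_le hε.le hε1 hv.le) (by positivity : 0 < u' + ε * v')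
    (by positivity : 0 < v' + ε * u')
  refine h.trans ?_
  have e1 : |u + ε * v - (u' + ε * v')| ≤ |u - u'| + |v - v'| := by
    calc _ = |(u - u') + ε * (v - v')| := by congr 1; ring
      _ ≤ |u - u'| + |ε * (v - v')| := abs_add_le _ _
      _ ≤ _ := by
        rw [abs_mul, abs_of_pos hε]
        gcongr
        exact mul_le_of_le_one_left (abs_nonneg _) hε1
  have e2 : |v + ε * u - (v' + ε * u')| ≤ |u - u'| + |v - v'| := by
    calc _ = |ε * (u - u') + (v - v')| := by congr 1; ring
      _ ≤ |ε * (u - u')| + |v - v'| := abs_add_le _ _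
      _ ≤ _ := by
        rw [abs_mul, abs_of_pos hε]
        gcongr
        exact mul_le_of_le_one_left (abs_nonneg _) hε1
  have : ε⁻¹ * (|u + ε * v - (u' + ε * v')| + |v + ε * u - (v' + ε * u')|) ≤
      ε⁻¹ * ((|u - u'| + |v - v'|) + (|u - u'| + |v - v'|)) := by gcongr
  unfold mixEnt
  linarith

/-- The mixtures differ by `(1 - ε) (u - v)` and their log-ratio is at most `ε⁻¹`, so `ent_le`
applies. This supplies both the domination in `heatEnt_dissipation` and the decay at infinite time.
-/
lemma mixEnt_le {ε u v : ℝ} (hε : 0 < ε) (hε1 : ε ≤ 1) (hu : 0 < u) (hv : 0 < v) :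
    mixEnt ε u v ≤ ε⁻¹ * |u - v| := by
  have hp : 0 < u + ε * v := by positivity
  have hq : 0 < v + ε * u := by positivity
  have h := ent_le hp hq
  refine h.trans ((le_abs_self _).trans ?_)
  rw [← Real.log_div hp.ne' hq.ne', abs_mul]
  refine mul_le_mul ?_ ?_ (abs_nonneg _) (by positivity)
  · exact abs_log_div_le hε hp hq (mul_mix_le hε.le hε1 hu.le) (mul_mix_le hε.le hε1 hv.le)
  · have : u + ε * v - (v + ε * u) = (1 - ε) * (u - v) := by ring
    rw [this, abs_mul]
    refine mul_le_of_le_one_left (abs_nonneg _) ?_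
    rw [abs_le]; constructor <;> linarith

/-- With `r` the ratio of the mixtures at `ε'`, the lower bound of `ent_ge` is affine in the mixing
parameter and exact at `ε'`. Its slope `v log r + u (1 - r)` is at most `(r - 1) (v - u) ≤ 0`, since
`r - 1` has the sign of `u - v`. -/
lemma mixEnt_anti {ε ε' u v : ℝ} (hε : 0 ≤ ε) (hεε' : ε < ε') (hε1 : ε' ≤ 1) (hu : 0 ≤ u) (hv : 0 < v) :
    mixEnt ε' u v ≤ mixEnt ε u v := by
  have hε' : 0 < ε' := hε.trans_lt hεε'
  have hp : 0 < u + ε' * v := by positivity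
  have hq : 0 < v + ε' * u := by positivity
  set r := (u + ε' * v) / (v + ε' * u) with hr
  have hr0 : 0 < r := by positivity
  have h := ent_ge (by positivity : 0 ≤ u + ε * v) (by positivity : 0 < v + ε * u) hr0
  unfold mixEnt
  refine le_trans ?_ h
  rw [ent_eq hp hq, ← hr]
  have h1 : v * Real.log r ≤ v * (r - 1) := by
    gcongr; exact Real.log_le_sub_one_of_pos hr0
  have h2 : (r - 1) * (v - u) ≤ 0 := by
    have : r - 1 = (1 - ε') * (u - v) / (v + ε' * u) := by rw [hr]; field_simp; ring
    rw [this, div_mul_eq_mul_div]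
    refine div_nonpos_of_nonpos_of_nonneg ?_ hq.le
    nlinarith [mul_nonneg (by linarith : 0 ≤ 1 - ε') (sq_nonneg (u - v))]
  have h3 : (ε' - ε) * (v * Real.log r + u * (1 - r)) ≤ 0 :=
    mul_nonpos_of_nonneg_of_nonpos (by linarith) (by linarith)
  linarith

/-! ### The relative entropy and Fisher information of the mixed flows -/

lemma measurable_ent {α : Type*} [MeasurableSpace α] {u v : α → ℝ} (hu : Measurable u)
    (hv : Measurable v) : Measurable fun x => ent (u x) (v x) := by
  unfold ent; fun_prop

lemma measurable_mixEnt {α : Type*} [MeasurableSpace α] {u v : α → ℝ} (hu : Measurable u)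
    (hv : Measurable v) (ε : ℝ) : Measurable fun x => mixEnt ε (u x) (v x) :=
  measurable_ent (by fun_prop) (by fun_prop)

lemma measurable_smear {k : ℝ → E m → ℝ} (hk : Measurable (Function.uncurry k))
    (μ : Measure (E m)) [IsFiniteMeasure μ] :
    Measurable fun p : ℝ × E m => smear k μ p.1 p.2 := by
  have h : Measurable fun q : (ℝ × E m) × E m => k q.1.1 (q.1.2 - q.2) :=
    hk.comp (by fun_prop : Measurable fun q : (ℝ × E m) × E m => (q.1.1, q.1.2 - q.2))
  exact (h.stronglyMeasurable.integral_prod_right').measurable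

lemma measurable_heat (μ : Measure (E m)) [IsFiniteMeasure μ] :
    Measurable fun p : ℝ × E m => heat μ p.1 p.2 :=
  measurable_smear (by unfold heatKernel Function.uncurry; fun_prop) μ

lemma measurable_heatD (μ : Measure (E m)) [IsFiniteMeasure μ] (i : Fin m) :
    Measurable fun p : ℝ × E m => heatD μ i p.1 p.2 :=
  measurable_smear (by unfold heatKernelD heatKernel Function.uncurry; fun_prop) μ

lemma measurable_heatFisher (μ ν : Measure (E m)) [IsFiniteMeasure μ] [IsFiniteMeasure ν] :
    Measurable fun p : ℝ × E m => heatFisher μ ν p.1 p.2 := by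
  have h1 := measurable_heat μ
  have h2 := measurable_heat ν
  have h3 := measurable_heatD μ
  have h4 := measurable_heatD ν
  unfold heatFisher
  fun_prop

section Mix

variable (μ ν : Measure (E m)) [IsFiniteMeasure μ] [IsFiniteMeasure ν]

lemma smear_add_smul {k : ℝ → E m → ℝ} (hk : AdmissibleKernel k) (c : NNReal) {s : ℝ} (hs : 0 < s)
    (x : E m) : smear k (μ + c • ν) s x = smear k μ s x + c * smear k ν s x := by
  unfold smear
  rw [integral_add_measure (hk.integrable hs x) (hk.integrable hs x), integral_smul_nnreal_measure]
  rfl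

lemma heat_add_smul (c : NNReal) {s : ℝ} (hs : 0 < s) (x : E m) :
    heat (μ + c • ν) s x = heat μ s x + c * heat ν s x :=
  smear_add_smul μ ν admissibleKernel_heatKernel c hs x

lemma heatD_add_smul (c : NNReal) (i : Fin m) {s : ℝ} (hs : 0 < s) (x : E m) :
    heatD (μ + c • ν) i s x = heatD μ i s x + c * heatD ν i s x :=
  smear_add_smul μ ν (admissibleKernel_heatKernelD i) c hs x

/-- The relative Fisher information integrand of the mixed flows. -/
lemma heatFisher_add_smul [NeZero μ] [NeZero ν] (c : NNReal) {s : ℝ} (hs : 0 < s) (x : E m) :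
    heatFisher (μ + c • ν) (ν + c • μ) s x =
      ∑ i, ((1 - (c : ℝ) ^ 2) *
        (heatD μ i s x * heat ν s x - heatD ν i s x * heat μ s x)) ^ 2 /
        ((heat μ s x + c * heat ν s x) * (heat ν s x + c * heat μ s x) ^ 2) := by
  unfold heatFisher
  refine Finset.sum_congr rfl fun i _ => ?_
  rw [heat_add_smul _ _ _ hs, heat_add_smul _ _ _ hs, heatD_add_smul _ _ _ _ hs,
    heatD_add_smul _ _ _ _ hs]
  have hu := heat_pos μ hs x
  have hv := heat_pos ν hs x
  have hp : heat μ s x + c * heat ν s x ≠ 0 := by positivity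
  have hq : heat ν s x + c * heat μ s x ≠ 0 := by positivity
  rw [div_sub_div _ _ hp hq]
  field_simp
  ring

/-- In the closed form of `heatFisher_add_smul` the parameter occurs only in `(1 - c²)²`, which
decreases on `[0, 1]`, and in a denominator that increases. -/
lemma heatFisher_add_smul_anti [NeZero μ] [NeZero ν] {c c' : NNReal} (hcc' : c ≤ c')
    (hc' : c' ≤ 1) {s : ℝ} (hs : 0 < s) (x : E m) :
    heatFisher (μ + c' • ν) (ν + c' • μ) s x ≤ heatFisher (μ + c • ν) (ν + c • μ) s x := by
  rw [heatFisher_add_smul _ _ _ hs, heatFisher_add_smul _ _ _ hs]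
  have hu := heat_pos μ hs x
  have hv := heat_pos ν hs x
  have h1 : (c' : ℝ) ≤ 1 := by exact_mod_cast hc'
  have h2 : (c : ℝ) ≤ c' := by exact_mod_cast hcc'
  have h3 : (0 : ℝ) ≤ 1 - (c' : ℝ) ^ 2 := by nlinarith [c'.coe_nonneg]
  refine Finset.sum_le_sum fun i _ => ?_
  rw [mul_pow, mul_pow]
  gcongr

lemma tendsto_heatFisher_add_smul [NeZero μ] [NeZero ν] {c : ℕ → NNReal}
    (hc : Tendsto c atTop (𝓝 0)) {s : ℝ} (hs : 0 < s) (x : E m) :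
    Tendsto (fun n => heatFisher (μ + c n • ν) (ν + c n • μ) s x) atTop
      (𝓝 (heatFisher μ ν s x)) := by
  have h0 : heatFisher μ ν s x = heatFisher (μ + (0 : NNReal) • ν) (ν + (0 : NNReal) • μ) s x := by
    simp
  rw [h0]
  simp_rw [heatFisher_add_smul _ _ _ hs]
  have hu := heat_pos μ hs x
  have hv := heat_pos ν hs x
  have hc' : Tendsto (fun n => (c n : ℝ)) atTop (𝓝 ((0 : NNReal) : ℝ)) :=
    (NNReal.continuous_coe.tendsto 0).comp hc
  refine tendsto_finsetSum _ fun i _ => Tendsto.div ?_ ?_ ?_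
  · exact ((tendsto_const_nhds.sub (hc'.pow 2)).mul_const _).pow 2
  · exact (tendsto_const_nhds.add (hc'.mul_const _)).mul
      ((tendsto_const_nhds.add (hc'.mul_const _)).pow 2)
  · simp only [NNReal.coe_zero, zero_mul, add_zero]
    positivity

lemma tendsto_mixEnt {c : ℕ → NNReal} (hc : Tendsto c atTop (𝓝 0)) (u : ℝ) {v : ℝ} (hv : 0 < v) :
    Tendsto (fun n => mixEnt (c n) u v) atTop (𝓝 (ent u v)) := by
  have hc' : Tendsto (fun n => (c n : ℝ)) atTop (𝓝 0) := by
    exact_mod_cast (NNReal.continuous_coe.tendsto 0).comp hc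
  have h : ContinuousAt (fun ε : ℝ => mixEnt ε u v) 0 := by
    unfold mixEnt ent
    -- `u` may be zero, so the continuity used is that of `x log x`, not of the logarithm.
    have h1 : Continuous fun ε : ℝ => (u + ε * v) * Real.log (u + ε * v) :=
      Real.continuous_mul_log.comp (by fun_prop : Continuous fun ε : ℝ => u + ε * v)
    have h2 : ContinuousAt (fun ε : ℝ => Real.log (v + ε * u)) 0 :=
      ContinuousAt.log (by fun_prop) (by simpa using hv.ne')
    exact ((h1.continuousAt.sub (ContinuousAt.mul (by fun_prop) h2)).sub (by fun_prop)).add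
      (by fun_prop)
  have h3 := h.tendsto.comp hc'
  simpa [mixEnt, Function.comp_def] using h3

end Mix

/-! ### The de Bruijn identity for the relative entropy of two heat flows -/

/-- The relative Fisher information of two heat flows at time `s`. -/
def heatFisherInfo (μ ν : Measure (E m)) (s : ℝ) : ℝ≥0∞ :=
  ∫⁻ x, ENNReal.ofReal (heatFisher μ ν s x)

lemma measurable_heatFisherInfo (μ ν : Measure (E m)) [IsFiniteMeasure μ] [IsFiniteMeasure ν] :
    Measurable (heatFisherInfo μ ν) :=
  Measurable.lintegral_prod_right' (f := fun p : ℝ × E m => ENNReal.ofReal (heatFisher μ ν p.1 p.2))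
    (measurable_heatFisher μ ν).ennreal_ofReal

instance neZero_measure_add (μ ν : Measure (E m)) [NeZero μ] : NeZero (μ + ν) :=
  ⟨fun h => NeZero.ne μ (Measure.measure_univ_eq_zero.1 (by
    have := congrArg (fun ρ : Measure (E m) => ρ univ) h
    simp only [Measure.add_apply, Measure.coe_zero, Pi.zero_apply, add_eq_zero] at this
    exact this.1))⟩

lemma heatEnt_add_smul (μ ν : Measure (E m)) [IsFiniteMeasure μ] [IsFiniteMeasure ν] (c : NNReal) {s : ℝ} (hs : 0 < s) (x : E m) :
    heatEnt (μ + c • ν) (ν + c • μ) s x = mixEnt c (heat μ s x) (heat ν s x) := by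
  unfold heatEnt mixEnt
  rw [heat_add_smul _ _ _ hs, heat_add_smul _ _ _ hs]

section Mix

variable (μ ν : Measure (E m)) [IsFiniteMeasure μ] [IsFiniteMeasure ν] [NeZero μ] [NeZero ν]

lemma mixEnt_dissipation {c : NNReal} (hc : 0 < c) (hc1 : c ≤ 1) {a b : ℝ} (ha : 0 < a)
    (hab : a ≤ b) :
    ∫⁻ x, ENNReal.ofReal (mixEnt c (heat μ a x) (heat ν a x)) =
      (∫⁻ x, ENNReal.ofReal (mixEnt c (heat μ b x) (heat ν b x))) +
        (∫⁻ s in Ioc a b, heatFisherInfo (μ + c • ν) (ν + c • μ) s) / 2 := by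
  have hcR : (0 : ℝ) < c := hc
  have hc1R : (c : ℝ) ≤ 1 := by exact_mod_cast hc1
  -- One factor `c⁻¹` comes from `mixEnt_le`; the second is slack.
  have h := heatEnt_dissipation (μ + c • ν) (ν + c • μ) (c := (c : ℝ)⁻¹ * (c : ℝ)⁻¹) ha hab ?_
  · simp_rw [heatEnt_add_smul μ ν c ha, heatEnt_add_smul μ ν c (ha.trans_le hab)] at h
    rw [h, lintegral_prod]
    · rfl
    · exact (measurable_heatFisher _ _).ennreal_ofReal.aemeasurable
  · intro s hs x
    rw [heatEnt_add_smul μ ν c hs, heat_add_smul _ _ _ hs, heat_add_smul _ _ _ hs]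
    have hu := heat_pos μ hs x
    have hv := heat_pos ν hs x
    refine (mixEnt_le hcR hc1R hu hv).trans ?_
    have h1 : (1 : ℝ) ≤ (c : ℝ)⁻¹ := (one_le_inv₀ hcR).2 hc1R
    rw [mul_assoc]
    gcongr
    have h2 : |heat μ s x - heat ν s x| ≤ heat μ s x + heat ν s x := by
      rw [abs_le]; constructor <;> linarith
    have h3 : 0 ≤ (c : ℝ) * heat ν s x := by positivity
    have h4 : 0 ≤ (c : ℝ) * heat μ s x := by positivity
    nlinarith

end Mix

/-- The measure with the real density `f`. -/
def densityMeasure (f : E m → ℝ) : Measure (E m) :=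
  (volume : Measure (E m)).withDensity fun x => ENNReal.ofReal (f x)

lemma heat_densityMeasure {f : E m → ℝ} (hf : Measurable f) (h0 : ∀ x, 0 ≤ f x) (s : ℝ) (x : E m) :
    heat (densityMeasure f) s x = ∫ z, heatKernel s (x - z) * f z := by
  unfold heat smear densityMeasure
  rw [integral_withDensity_eq_integral_toReal_smul hf.ennreal_ofReal
    (ae_of_all _ fun x => ENNReal.ofReal_lt_top)]
  refine integral_congr_ae (ae_of_all _ fun z => ?_)
  simp only [ENNReal.toReal_ofReal (h0 z), smul_eq_mul, mul_comm]

/-- Both comparisons are additive, so the squeeze between `B - D` and `B + D` is valid also for `B =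
∞`. -/
lemma tendsto_of_le_add {α : Type*} {l : Filter α} {A D : α → ℝ≥0∞} {B : ℝ≥0∞}
    (h1 : ∀ᶠ a in l, A a ≤ B + D a) (h2 : ∀ᶠ a in l, B ≤ A a + D a) (hD : Tendsto D l (𝓝 0)) :
    Tendsto A l (𝓝 B) := by
  have hlo : Tendsto (fun a => B - D a) l (𝓝 B) := by
    simpa using ENNReal.Tendsto.sub (tendsto_const_nhds (x := B)) hD (Or.inr ENNReal.zero_ne_top)
  have hhi : Tendsto (fun a => B + D a) l (𝓝 B) := by
    simpa using (tendsto_const_nhds (x := B)).add hD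
  refine tendsto_of_tendsto_of_tendsto_of_le_of_le' hlo hhi ?_ h1
  filter_upwards [h2] with a ha using tsub_le_iff_right.2 ha

/-! ### De Bruijn's identity with initial densities: limits in time, then vanishing mixing -/

section Density

variable {f g : E m → ℝ} (hfm : Measurable f) (hgm : Measurable g) (hf : Integrable f)
  (hg : Integrable g) (hf0 : ∀ x, 0 ≤ f x) (hg0 : ∀ x, 0 < g x)

include hfm hgm hf hg hf0 hg0

/-- By `mixEnt_le_mixEnt_add` the change of the mixed entropy is controlled by the `L¹` distance of
the flows from their initial densities, which tends to zero. -/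
lemma tendsto_mixEnt_heat_zero [NeZero (densityMeasure f)] [NeZero (densityMeasure g)]
    [IsFiniteMeasure (densityMeasure f)] [IsFiniteMeasure (densityMeasure g)]
    {c : NNReal} (hc : 0 < c) (hc1 : c ≤ 1) :
    Tendsto (fun s => ∫⁻ x, ENNReal.ofReal
      (mixEnt c (heat (densityMeasure f) s x) (heat (densityMeasure g) s x))) (𝓝[>] 0)
      (𝓝 (∫⁻ x, ENNReal.ofReal (mixEnt c (f x) (g x)))) := by
  have hcR : (0 : ℝ) < c := hc
  have hc1R : (c : ℝ) ≤ 1 := by exact_mod_cast hc1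
  let μ := densityMeasure f
  let ν := densityMeasure g
  have hum : ∀ s, Measurable (heat μ s) := fun s =>
    (measurable_heat μ).comp (by fun_prop : Measurable fun x : E m => (s, x))
  have hvm : ∀ s, Measurable (heat ν s) := fun s =>
    (measurable_heat ν).comp (by fun_prop : Measurable fun x : E m => (s, x))
  let d : ℝ → E m → ℝ := fun s x => 2 * (c : ℝ)⁻¹ * (|heat μ s x - f x| + |heat ν s x - g x|)
  have hd0 : ∀ s x, 0 ≤ d s x := fun s x => by positivity
  have hdm : ∀ s, Measurable (d s) := fun s => by
    have := hum s
    have := hvm s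
    simp only [d]
    fun_prop
  have hcmp : ∀ s, 0 < s → ∀ x,
      ENNReal.ofReal (mixEnt c (heat μ s x) (heat ν s x)) ≤
        ENNReal.ofReal (mixEnt c (f x) (g x)) + ENNReal.ofReal (d s x) ∧
      ENNReal.ofReal (mixEnt c (f x) (g x)) ≤
        ENNReal.ofReal (mixEnt c (heat μ s x) (heat ν s x)) + ENNReal.ofReal (d s x) := by
    intro s hs x
    have hu := heat_pos μ hs x
    have hv := heat_pos ν hs x
    constructor
    · refine le_trans (ENNReal.ofReal_le_ofReal ?_) ENNReal.ofReal_add_le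
      exact mixEnt_le_mixEnt_add hcR hc1R hu.le hv (hf0 x) (hg0 x)
    · refine le_trans (ENNReal.ofReal_le_ofReal ?_) ENNReal.ofReal_add_le
      have := mixEnt_le_mixEnt_add hcR hc1R (hf0 x) (hg0 x) hu.le hv
      rwa [abs_sub_comm (f x), abs_sub_comm (g x)] at this
  refine tendsto_of_le_add (D := fun s => ∫⁻ x, ENNReal.ofReal (d s x)) ?_ ?_ ?_
  · filter_upwards [self_mem_nhdsWithin] with s hs
    rw [← lintegral_add_right _ (hdm s).ennreal_ofReal]
    exact lintegral_mono fun x => (hcmp s hs x).1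
  · filter_upwards [self_mem_nhdsWithin] with s hs
    rw [← lintegral_add_right _ (hdm s).ennreal_ofReal]
    exact lintegral_mono fun x => (hcmp s hs x).2
  · have h1 := tendsto_lintegral_heatKernel_conv_sub hfm hf
    have h2 := tendsto_lintegral_heatKernel_conv_sub hgm hg
    have h3 := ENNReal.Tendsto.const_mul (a := ENNReal.ofReal (2 * (c : ℝ)⁻¹)) (h1.add h2)
      (Or.inr ENNReal.ofReal_ne_top)
    simp only [add_zero, mul_zero] at h3
    refine h3.congr fun s => ?_
    have e1 : ∀ x, ENNReal.ofReal (d s x) = ENNReal.ofReal (2 * (c : ℝ)⁻¹) *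
        (‖(∫ z, heatKernel s (x - z) * f z) - f x‖ₑ + ‖(∫ z, heatKernel s (x - z) * g z) - g x‖ₑ) := by
      intro x
      rw [← heat_densityMeasure hfm hf0, ← heat_densityMeasure hgm fun x => (hg0 x).le,
        ENNReal.ofReal_mul (by positivity), ENNReal.ofReal_add (abs_nonneg _) (abs_nonneg _),
        Real.enorm_eq_ofReal_abs, Real.enorm_eq_ofReal_abs]
    simp_rw [e1]
    rw [lintegral_const_mul' _ _ ENNReal.ofReal_ne_top]
    congr 1
    simp_rw [← heat_densityMeasure hfm hf0, ← heat_densityMeasure hgm fun x => (hg0 x).le]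
    rw [lintegral_add_right]
    exact ((hvm s).sub hgm).enorm

/-- By `mixEnt_le` the integral is at most `c⁻¹` times the `L¹` norm of the heat flow of `f - g`,
and `hfg` makes the mass of `f - g` zero. -/
lemma tendsto_mixEnt_heat_atTop [NeZero (densityMeasure f)] [NeZero (densityMeasure g)]
    [IsFiniteMeasure (densityMeasure f)] [IsFiniteMeasure (densityMeasure g)]
    (hfg : ∫ x, f x = ∫ x, g x) {c : NNReal} (hc : 0 < c) (hc1 : c ≤ 1) :
    Tendsto (fun s => ∫⁻ x, ENNReal.ofReal
      (mixEnt c (heat (densityMeasure f) s x) (heat (densityMeasure g) s x))) atTop (𝓝 0) := by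
  have hcR : (0 : ℝ) < c := hc
  have hc1R : (c : ℝ) ≤ 1 := by exact_mod_cast hc1
  have h1 := tendsto_lintegral_heatKernel_conv_atTop (hfm.sub hgm) (hf.sub hg)
    (by simp only [Pi.sub_apply]; rw [integral_sub hf hg, hfg, sub_self])
  have h2 := ENNReal.Tendsto.const_mul (a := ENNReal.ofReal ((c : ℝ)⁻¹)) h1
    (Or.inr ENNReal.ofReal_ne_top)
  rw [mul_zero] at h2
  refine tendsto_of_tendsto_of_tendsto_of_le_of_le' tendsto_const_nhds h2
    (Eventually.of_forall fun s => zero_le) ?_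
  filter_upwards [Ioi_mem_atTop 0] with s hs
  rw [← lintegral_const_mul' _ _ ENNReal.ofReal_ne_top]
  refine lintegral_mono fun x => ?_
  have hu := heat_pos (densityMeasure f) hs x
  have hv := heat_pos (densityMeasure g) hs x
  have h3 := mixEnt_le hcR hc1R hu hv
  refine (ENNReal.ofReal_le_ofReal h3).trans (le_of_eq ?_)
  rw [ENNReal.ofReal_mul (by positivity), ← Real.enorm_eq_ofReal_abs,
    heat_densityMeasure hfm hf0, heat_densityMeasure hgm fun x => (hg0 x).le,
    ← integral_sub (integrable_heatKernel_mul hf hs x) (integrable_heatKernel_mul hg hs x)]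
  simp_rw [Pi.sub_apply, mul_sub]

lemma mixEnt_heat_eq [NeZero (densityMeasure f)] [NeZero (densityMeasure g)]
    [IsFiniteMeasure (densityMeasure f)] [IsFiniteMeasure (densityMeasure g)]
    {c : NNReal} (hc : 0 < c) (hc1 : c ≤ 1) {b : ℝ} (hb : 0 < b) :
    ∫⁻ x, ENNReal.ofReal (mixEnt c (f x) (g x)) =
      (∫⁻ x, ENNReal.ofReal
        (mixEnt c (heat (densityMeasure f) b x) (heat (densityMeasure g) b x))) +
        (∫⁻ s in Ioc 0 b, heatFisherInfo (densityMeasure f + c • densityMeasure g)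
          (densityMeasure g + c • densityMeasure f) s) / 2 := by
  let F := heatFisherInfo (densityMeasure f + c • densityMeasure g)
    (densityMeasure g + c • densityMeasure f)
  have hF : Measurable F := measurable_heatFisherInfo _ _
  -- The dissipation identity holds between positive times; its lower time is sent to `0` along `b /
  -- (n + 1)`.
  have ha : Tendsto (fun n : ℕ => b / ((n : ℝ) + 1)) atTop (𝓝 0) := by
    have h := (tendsto_one_div_add_atTop_nhds_zero_nat (𝕜 := ℝ)).const_mul b
    simpa [div_eq_mul_inv] using h
  have hapos : ∀ n : ℕ, 0 < b / ((n : ℝ) + 1) := fun n => by positivity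
  have haw : Tendsto (fun n : ℕ => b / ((n : ℝ) + 1)) atTop (𝓝[>] 0) :=
    tendsto_nhdsWithin_iff.2 ⟨ha, Eventually.of_forall hapos⟩
  have hcov := (aecover_Ioc_of_Ioc (μ := volume) ha (tendsto_const_nhds (x := b))).lintegral_tendsto_of_nat
    (f := F) hF.aemeasurable
  have h1 := (tendsto_mixEnt_heat_zero hfm hgm hf hg hf0 hg0 hc hc1).comp haw
  refine tendsto_nhds_unique h1 ?_
  have h2 := (tendsto_const_nhds (x := ∫⁻ x, ENNReal.ofReal
        (mixEnt c (heat (densityMeasure f) b x) (heat (densityMeasure g) b x)))).add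
    (ENNReal.Tendsto.div_const hcov (b := 2) (Or.inr two_ne_zero))
  refine h2.congr fun n => ?_
  have hle : b / ((n : ℝ) + 1) ≤ b := div_le_self hb.le (by linarith [(Nat.cast_nonneg n : (0 : ℝ) ≤ n)])
  simp only [Function.comp]
  rw [mixEnt_dissipation _ _ hc hc1 (hapos n) hle, Measure.restrict_restrict measurableSet_Ioc,
    inter_eq_self_of_subset_left (Ioc_subset_Ioc_left (hapos n).le)]

lemma mixEnt_heat_eq_top [NeZero (densityMeasure f)] [NeZero (densityMeasure g)]
    [IsFiniteMeasure (densityMeasure f)] [IsFiniteMeasure (densityMeasure g)]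
    (hfg : ∫ x, f x = ∫ x, g x) {c : NNReal} (hc : 0 < c) (hc1 : c ≤ 1) :
    ∫⁻ x, ENNReal.ofReal (mixEnt c (f x) (g x)) =
        (∫⁻ s in Ioi 0, heatFisherInfo (densityMeasure f + c • densityMeasure g)
          (densityMeasure g + c • densityMeasure f) s) / 2 := by
  let F := heatFisherInfo (densityMeasure f + c • densityMeasure g)
    (densityMeasure g + c • densityMeasure f)
  have hF : Measurable F := measurable_heatFisherInfo _ _
  have hn : Tendsto (fun n : ℕ => (n : ℝ) + 1) atTop atTop :=
    tendsto_atTop_add_const_right _ _ tendsto_natCast_atTop_atTop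
  have hcov := (aecover_Iic (μ := volume.restrict (Ioi (0 : ℝ))) hn).lintegral_tendsto_of_nat
    (f := F) hF.aemeasurable
  have h1 := (tendsto_mixEnt_heat_atTop hfm hgm hf hg hf0 hg0 hfg hc hc1).comp hn
  have h2 := h1.add (ENNReal.Tendsto.div_const hcov (b := 2) (Or.inr two_ne_zero))
  rw [zero_add] at h2
  refine tendsto_nhds_unique ((tendsto_const_nhds).congr fun n => ?_) h2
  simp only [Function.comp]
  rw [Measure.restrict_restrict measurableSet_Iic, inter_comm, Ioi_inter_Iic]
  exact mixEnt_heat_eq hfm hgm hf hg hf0 hg0 hc hc1 (by positivity)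

-- Monotone convergence along the mixing parameters `1 / (n + 1)`, by `mixEnt_anti`; the limit may
-- be infinite.
omit hfm hgm hf hg hf0 hg0 in
lemma tendsto_lintegral_mixEnt {u v : E m → ℝ} (hum : Measurable u) (hvm : Measurable v)
    (hu : ∀ x, 0 ≤ u x) (hv : ∀ x, 0 < v x) :
    Tendsto (fun n : ℕ => ∫⁻ x, ENNReal.ofReal (mixEnt ((1 / ((n : NNReal) + 1) : NNReal)) (u x) (v x)))
      atTop (𝓝 (∫⁻ x, ENNReal.ofReal (ent (u x) (v x)))) := by
  have hc : Tendsto (fun n : ℕ => 1 / ((n : NNReal) + 1)) atTop (𝓝 0) :=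
    tendsto_one_div_add_atTop_nhds_zero_nat
  refine lintegral_tendsto_of_tendsto_of_monotone
    (fun n => (measurable_mixEnt hum hvm _).ennreal_ofReal.aemeasurable)
    (ae_of_all _ fun x => ?_) (ae_of_all _ fun x => ?_)
  · refine monotone_nat_of_le_succ fun n => ENNReal.ofReal_le_ofReal ?_
    refine mixEnt_anti (NNReal.coe_nonneg _) ?_ ?_ (hu x) (hv x)
    · rw [NNReal.coe_lt_coe]
      refine one_div_lt_one_div_of_lt (by positivity) ?_
      push_cast
      simp
    · rw [← NNReal.coe_one, NNReal.coe_le_coe]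
      exact div_le_one_of_le₀ (by simp) (by positivity)
  · exact (ENNReal.continuous_ofReal.tendsto _).comp (tendsto_mixEnt hc (u x) (hv x))

omit hfm hgm hf hg hf0 hg0 in
lemma tendsto_lintegral_heatFisherInfo (μ ν : Measure (E m)) [IsFiniteMeasure μ] [IsFiniteMeasure ν]
    [NeZero μ] [NeZero ν] {I : Set ℝ} (hIm : MeasurableSet I) (hI : I ⊆ Ioi 0) :
    Tendsto (fun n : ℕ => ∫⁻ s in I, heatFisherInfo (μ + (1 / ((n : NNReal) + 1) : NNReal) • ν)
      (ν + (1 / ((n : NNReal) + 1) : NNReal) • μ) s) atTop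
      (𝓝 (∫⁻ s in I, heatFisherInfo μ ν s)) := by
  have hc : Tendsto (fun n : ℕ => 1 / ((n : NNReal) + 1)) atTop (𝓝 0) :=
    tendsto_one_div_add_atTop_nhds_zero_nat
  have hmono : ∀ s, 0 < s → ∀ x, Monotone fun n : ℕ => ENNReal.ofReal
      (heatFisher (μ + (1 / ((n : NNReal) + 1) : NNReal) • ν)
        (ν + (1 / ((n : NNReal) + 1) : NNReal) • μ) s x) := by
    intro s hs x
    refine monotone_nat_of_le_succ fun n => ENNReal.ofReal_le_ofReal ?_
    refine heatFisher_add_smul_anti μ ν ?_ ?_ hs x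
    · refine one_div_le_one_div_of_le (by positivity) ?_
      push_cast
      simp
    · exact div_le_one_of_le₀ (by simp) (by positivity)
  refine lintegral_tendsto_of_tendsto_of_monotone
    (fun n => (measurable_heatFisherInfo _ _).aemeasurable) ?_ ?_
  · filter_upwards [ae_restrict_mem hIm] with s hs
    exact fun n n' hn => lintegral_mono fun x => hmono s (hI hs) x hn
  · filter_upwards [ae_restrict_mem hIm] with s hs
    refine lintegral_tendsto_of_tendsto_of_monotone (fun n => ?_)
      (ae_of_all _ fun x => hmono s (hI hs) x) (ae_of_all _ fun x => ?_)
    · exact ((measurable_heatFisher _ _).comp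
        (by fun_prop : Measurable fun x : E m => (s, x))).ennreal_ofReal.aemeasurable
    · exact (ENNReal.continuous_ofReal.tendsto _).comp
        (tendsto_heatFisher_add_smul μ ν hc (hI hs) x)

/-- De Bruijn's identity for the relative entropy on a finite time interval, in `[0, ∞]`. -/
theorem lintegral_ent_eq_add [NeZero (densityMeasure f)] [NeZero (densityMeasure g)]
    [IsFiniteMeasure (densityMeasure f)] [IsFiniteMeasure (densityMeasure g)] {b : ℝ}
    (hb : 0 < b) :
    ∫⁻ x, ENNReal.ofReal (ent (f x) (g x)) =
      (∫⁻ x, ENNReal.ofReal (heatEnt (densityMeasure f) (densityMeasure g) b x)) +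
        (∫⁻ s in Ioc 0 b, heatFisherInfo (densityMeasure f) (densityMeasure g) s) / 2 := by
  have hum : ∀ s, Measurable (heat (densityMeasure f) s) := fun s =>
    (measurable_heat _).comp (by fun_prop : Measurable fun x : E m => (s, x))
  have hvm : ∀ s, Measurable (heat (densityMeasure g) s) := fun s =>
    (measurable_heat _).comp (by fun_prop : Measurable fun x : E m => (s, x))
  have h1 := tendsto_lintegral_mixEnt hfm hgm hf0 hg0
  have h2 := tendsto_lintegral_mixEnt (hum b) (hvm b) (fun x => (heat_pos _ hb x).le)
    (fun x => heat_pos _ hb x)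
  have h3 := tendsto_lintegral_heatFisherInfo (densityMeasure f) (densityMeasure g)
    (measurableSet_Ioc (a := (0 : ℝ)) (b := b)) (fun s hs => hs.1)
  refine tendsto_nhds_unique h1
    ((h2.add (ENNReal.Tendsto.div_const h3 (b := 2) (Or.inr two_ne_zero))).congr fun n => ?_)
  exact (mixEnt_heat_eq hfm hgm hf hg hf0 hg0 (by positivity)
    (div_le_one_of_le₀ (by simp) (by positivity)) hb).symm

/-- De Bruijn's identity for the relative entropy on the time interval `(0, ∞)`. -/
theorem lintegral_ent_eq_top [NeZero (densityMeasure f)] [NeZero (densityMeasure g)]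
    [IsFiniteMeasure (densityMeasure f)] [IsFiniteMeasure (densityMeasure g)]
    (hfg : ∫ x, f x = ∫ x, g x) :
    ∫⁻ x, ENNReal.ofReal (ent (f x) (g x)) =
      (∫⁻ s in Ioi 0, heatFisherInfo (densityMeasure f) (densityMeasure g) s) / 2 := by
  have h1 := tendsto_lintegral_mixEnt hfm hgm hf0 hg0
  have h3 := tendsto_lintegral_heatFisherInfo (densityMeasure f) (densityMeasure g)
    measurableSet_Ioi (Subset.refl (Ioi (0 : ℝ)))
  refine tendsto_nhds_unique h1
    ((ENNReal.Tendsto.div_const h3 (b := 2) (Or.inr two_ne_zero)).congr fun n => ?_)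
  exact (mixEnt_heat_eq_top hfm hgm hf hg hf0 hg0 hfg (by positivity)
    (div_le_one_of_le₀ (by simp) (by positivity))).symm

end Density

/-! ### The Kullback-Leibler divergence of measures with densities -/

/-- Pointwise `ent f g = g * klFun (f / g)`. Positivity of `g` makes `volume` absolutely continuous
with respect to its measure and identifies the Radon-Nikodym derivative with `f / g`. -/
lemma klDiv_withDensity {f g : E m → ℝ} (hfm : Measurable f) (hgm : Measurable g)
    (hf0 : ∀ x, 0 ≤ f x) (hg0 : ∀ x, 0 < g x) [IsFiniteMeasure (densityMeasure f)]
    [IsFiniteMeasure (densityMeasure g)] :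
    klDiv (densityMeasure f) (densityMeasure g) = ∫⁻ x, ENNReal.ofReal (ent (f x) (g x)) := by
  have hvol : (volume : Measure (E m)) ≪ densityMeasure g :=
    withDensity_absolutelyContinuous' hgm.ennreal_ofReal.aemeasurable
      (ae_of_all _ fun x => by simpa using hg0 x)
  have hac : densityMeasure f ≪ densityMeasure g :=
    (withDensity_absolutelyContinuous _ _).trans hvol
  rw [klDiv_eq_lintegral_klFun_of_ac hac]
  have hr : (densityMeasure f).rnDeriv (densityMeasure g) =ᵐ[volume]
      fun x => (ENNReal.ofReal (g x))⁻¹ * ENNReal.ofReal (f x) := by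
    refine (Measure.rnDeriv_withDensity_right (densityMeasure f) volume
      hgm.ennreal_ofReal.aemeasurable (ae_of_all _ fun x => by simpa using hg0 x)
      (ae_of_all _ fun x => ENNReal.ofReal_ne_top)).trans ?_
    filter_upwards [Measure.rnDeriv_withDensity (volume : Measure (E m)) hfm.ennreal_ofReal]
      with x hx
    have hx' : (densityMeasure f).rnDeriv volume x = ENNReal.ofReal (f x) := hx
    rw [hx']
  conv_lhs => rw [densityMeasure.eq_def g]
  rw [lintegral_withDensity_eq_lintegral_mul _ hgm.ennreal_ofReal (by
    exact (measurable_klFun.comp (Measure.measurable_rnDeriv _ _).ennreal_toReal).ennreal_ofReal)]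
  refine lintegral_congr_ae ?_
  filter_upwards [hr] with x hx
  have hx' : (densityMeasure f).rnDeriv (volume.withDensity fun x => ENNReal.ofReal (g x)) x =
      (ENNReal.ofReal (g x))⁻¹ * ENNReal.ofReal (f x) := hx
  have hg := hg0 x
  simp only [Pi.mul_apply]
  rw [hx', ENNReal.toReal_mul, ENNReal.toReal_inv, ENNReal.toReal_ofReal hg.le,
    ENNReal.toReal_ofReal (hf0 x), ← ENNReal.ofReal_mul hg.le]
  congr 1
  unfold klFun ent
  rcases (hf0 x).eq_or_lt with h | h
  · simp [← h]
  · rw [Real.log_mul (by positivity) h.ne', Real.log_inv]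
    field_simp
    ring

/-! ### The diffusion as a rescaled heat flow -/

/-- The hypothesis says `σ² = α² s`, so division by `α` turns `N(α z₀, σ² I)` into `N(z₀, s I)`. -/
lemma transDensity_eq {β : ℝ → ℝ} {τ : ℝ≥0∞} {s : ℝ} (hα : 0 < alpha β τ) (hs : 0 < s)
    (h : alpha β τ ^ 2 * (1 + s) = 1) (z₀ z : E m) :
    transDensity β τ z₀ z =
      ((alpha β τ) ^ m)⁻¹ * heatKernel s ((alpha β τ)⁻¹ • z - z₀) := by
  have hσ : sigmaSq β τ = alpha β τ ^ 2 * s := by unfold sigmaSq; linarith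
  have hk := heatKernel_smul hα hs ((alpha β τ)⁻¹ • z - z₀)
  rw [smul_sub, smul_inv_smul₀ hα.ne'] at hk
  rw [← hk, inv_mul_cancel_left₀ (by positivity)]
  unfold transDensity heatKernel
  rw [hσ, neg_div (2 * (alpha β τ ^ 2 * s))]

section Flow

variable (μ ν : Measure (E m))

lemma diffusedDensity_eq {β : ℝ → ℝ} {τ : ℝ≥0∞} {s : ℝ} (hα : 0 < alpha β τ) (hs : 0 < s)
    (h : alpha β τ ^ 2 * (1 + s) = 1) (z : E m) :
    diffusedDensity β τ μ z = ((alpha β τ) ^ m)⁻¹ * heat μ s ((alpha β τ)⁻¹ • z) := by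
  unfold diffusedDensity heat smear
  simp_rw [transDensity_eq hα hs h]
  rw [integral_const_mul]

variable [IsFiniteMeasure μ] [IsFiniteMeasure ν]

lemma measurable_heat_right (s : ℝ) : Measurable (heat μ s) :=
  (measurable_heat μ).comp (by fun_prop : Measurable fun x : E m => (s, x))

lemma lintegral_heat_ne_top {s : ℝ} (hs : 0 < s) :
    ∫⁻ x, ENNReal.ofReal (heat μ s x) ≠ ∞ := by
  rw [← ofReal_integral_eq_lintegral_ofReal (integrable_heat μ hs)
    (ae_of_all _ fun x => heat_nonneg μ hs x)]
  exact ENNReal.ofReal_ne_top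

variable [NeZero μ] [NeZero ν]

lemma score_apply {β : ℝ → ℝ} {τ : ℝ≥0∞} {s : ℝ} (hα : 0 < alpha β τ) (hs : 0 < s)
    (h : alpha β τ ^ 2 * (1 + s) = 1) (z : E m) (i : Fin m) :
    score β τ μ z i = (alpha β τ)⁻¹ * (heatD μ i s ((alpha β τ)⁻¹ • z) /
      heat μ s ((alpha β τ)⁻¹ • z)) := by
  set a := alpha β τ with ha
  have hc : (a ^ m)⁻¹ ≠ 0 := by positivity
  have hpos : ∀ x, (a ^ m)⁻¹ * heat μ s x ≠ 0 := fun x => mul_ne_zero hc (heat_pos μ hs x).ne'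
  have hfun : (fun z' => Real.log (diffusedDensity β τ μ z')) =
      fun z' => Real.log ((a ^ m)⁻¹ * heat μ s (a⁻¹ • z')) := by
    ext z'
    rw [diffusedDensity_eq μ hα hs h]
  unfold score
  rw [hfun]
  have hdiff : DifferentiableAt ℝ (fun z' => Real.log ((a ^ m)⁻¹ * heat μ s (a⁻¹ • z'))) z := by
    refine DifferentiableAt.log ?_ (hpos _)
    refine DifferentiableAt.const_mul ?_ _
    exact DifferentiableAt.comp (g := heat μ s) (f := fun z' : E m => a⁻¹ • z') z
      (differentiableAt_heat μ hs _) (by fun_prop)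
  have hline : HasLineDerivAt ℝ (fun z' => Real.log ((a ^ m)⁻¹ * heat μ s (a⁻¹ • z')))
      (a⁻¹ * (heatD μ i s (a⁻¹ • z) / heat μ s (a⁻¹ • z))) z (EuclideanSpace.single i 1) := by
    have h1 : HasDerivAt (fun t : ℝ => a⁻¹ * t) a⁻¹ 0 := by
      simpa using (hasDerivAt_id (0 : ℝ)).const_mul a⁻¹
    have h2 : HasDerivAt (fun t : ℝ => heat μ s (a⁻¹ • z + t • EuclideanSpace.single i (1 : ℝ)))
        (heatD μ i s (a⁻¹ • z)) (a⁻¹ * 0) := by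
      simpa [HasLineDerivAt] using hasLineDerivAt_heat μ hs (a⁻¹ • z) i
    have h3 := ((HasDerivAt.comp (h := fun t : ℝ => a⁻¹ * t) 0 h2 h1).const_mul (a ^ m)⁻¹).log
      (by simpa using hpos (a⁻¹ • z))
    have h4 : HasDerivAt (fun t : ℝ => Real.log ((a ^ m)⁻¹ *
        heat μ s (a⁻¹ • (z + t • EuclideanSpace.single i (1 : ℝ)))))
        (a⁻¹ * (heatD μ i s (a⁻¹ • z) / heat μ s (a⁻¹ • z))) 0 := by
      refine (h3.congr_deriv ?_).congr_of_eventuallyEq (Eventually.of_forall fun t => ?_)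
      · have := (heat_pos μ hs (a⁻¹ • z)).ne'
        simp only [Function.comp, mul_zero, zero_smul, add_zero]
        field_simp
      · simp only [Function.comp, smul_add, smul_smul]
    exact h4
  have h5 := (hdiff.hasFDerivAt.hasLineDerivAt (EuclideanSpace.single i 1)).lineDeriv.symm.trans
    hline.lineDeriv
  rw [← h5, ← inner_gradient_left, EuclideanSpace.inner_single_right]
  simp

/-- Each score carries a factor `α⁻¹`, and `α⁻² = 1 + s`. The normalisation of the density cancels
in the substitution `z = α x`. -/
lemma fisherDiv_eq {β : ℝ → ℝ} {τ : ℝ≥0∞} {s : ℝ} (hα : 0 < alpha β τ) (hs : 0 < s)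
    (h : alpha β τ ^ 2 * (1 + s) = 1) :
    fisherDiv β τ μ ν = ENNReal.ofReal (1 + s) * heatFisherInfo μ ν s := by
  set a := alpha β τ with ha
  have ha2 : a⁻¹ ^ 2 = 1 + s := by
    rw [inv_pow]
    exact inv_eq_of_mul_eq_one_right h
  have hmeas : Measurable fun z : E m => diffusedDensity β τ μ z := by
    simp_rw [diffusedDensity_eq μ hα hs h]
    exact ((measurable_heat_right μ s).comp (by fun_prop)).const_mul _
  unfold fisherDiv diffusedLaw
  -- This form needs measurability of the density only, not of the squared score difference.
  rw [lintegral_withDensity_eq_lintegral_mul_non_measurable _ hmeas.ennreal_ofReal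
    (ae_of_all _ fun z => ENNReal.ofReal_lt_top), lintegral_comp_smul_pos hα, heatFisherInfo,
    ← lintegral_const_mul' _ _ ENNReal.ofReal_ne_top,
    ← lintegral_const_mul' _ _ ENNReal.ofReal_ne_top]
  refine lintegral_congr fun x => ?_
  have hnorm : ‖score β τ μ (a • x) - score β τ ν (a • x)‖ ^ 2 =
      (1 + s) * ∑ i, (heatD μ i s x / heat μ s x - heatD ν i s x / heat ν s x) ^ 2 := by
    rw [EuclideanSpace.real_norm_sq_eq, Finset.mul_sum]
    refine Finset.sum_congr rfl fun i _ => ?_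
    rw [PiLp.sub_apply, score_apply μ hα hs h, score_apply ν hα hs h, inv_smul_smul₀ hα.ne',
      ← mul_sub, mul_pow, ha2]
  have hu := heat_pos μ hs x
  have hfish : heatFisher μ ν s x = heat μ s x *
      ∑ i, (heatD μ i s x / heat μ s x - heatD ν i s x / heat ν s x) ^ 2 := by
    unfold heatFisher; rw [Finset.mul_sum]
  simp only [Pi.mul_apply]
  rw [hnorm, hfish, diffusedDensity_eq μ hα hs h, ← ha, inv_smul_smul₀ hα.ne',
    ← ENNReal.ofReal_mul (by positivity), ← ENNReal.ofReal_mul (by positivity),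
    ← ENNReal.ofReal_mul (by positivity)]
  congr 1
  field_simp

lemma ent_mul {c u v : ℝ} (hc : 0 < c) (hu : 0 < u) (hv : 0 < v) :
    ent (c * u) (c * v) = c * ent u v := by
  unfold ent
  rw [Real.log_mul hc.ne' hu.ne', Real.log_mul hc.ne' hv.ne']
  ring

/-- The relative entropy is invariant under the dilation by `α`, because `ent` is homogeneous of
degree one (`ent_mul`). -/
lemma klDiv_diffusedLaw {β : ℝ → ℝ} {τ : ℝ≥0∞} {s : ℝ} (hα : 0 < alpha β τ) (hs : 0 < s)
    (h : alpha β τ ^ 2 * (1 + s) = 1) :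
    klDiv (diffusedLaw β τ μ) (diffusedLaw β τ ν) =
      ∫⁻ x, ENNReal.ofReal (heatEnt μ ν s x) := by
  set a := alpha β τ with ha
  have hc : 0 < (a ^ m)⁻¹ := by positivity
  have hcm : ENNReal.ofReal (a ^ m) * ENNReal.ofReal (a ^ m)⁻¹ = 1 := by
    rw [← ENNReal.ofReal_mul (by positivity), mul_inv_cancel₀ (by positivity), ENNReal.ofReal_one]
  have hmeas : ∀ (ρ : Measure (E m)) [IsFiniteMeasure ρ],
      Measurable fun z : E m => diffusedDensity β τ ρ z := by
    intro ρ _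
    simp_rw [diffusedDensity_eq ρ hα hs h]
    exact ((measurable_heat_right ρ s).comp (by fun_prop)).const_mul _
  have hpos : ∀ (ρ : Measure (E m)) [IsFiniteMeasure ρ] [NeZero ρ] (z : E m),
      0 < diffusedDensity β τ ρ z := by
    intro ρ _ _ z
    rw [diffusedDensity_eq ρ hα hs h]
    exact mul_pos hc (heat_pos ρ hs _)
  have hfin : ∀ (ρ : Measure (E m)) [IsFiniteMeasure ρ],
      IsFiniteMeasure (densityMeasure fun z : E m => diffusedDensity β τ ρ z) := by
    intro ρ _
    refine isFiniteMeasure_withDensity ?_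
    rw [lintegral_comp_smul_pos hα]
    simp_rw [fun z => diffusedDensity_eq ρ hα hs h z, ← ha, inv_smul_smul₀ hα.ne',
      ENNReal.ofReal_mul hc.le]
    rw [lintegral_const_mul' _ _ ENNReal.ofReal_ne_top, ← mul_assoc, hcm, one_mul]
    exact lintegral_heat_ne_top ρ hs
  have := hfin μ
  have := hfin ν
  have hkl := klDiv_withDensity (hmeas μ) (hmeas ν) (fun z => (hpos μ z).le) (hpos ν)
  refine hkl.trans ?_
  rw [lintegral_comp_smul_pos hα]
  simp_rw [diffusedDensity_eq μ hα hs h, diffusedDensity_eq ν hα hs h, ← ha, inv_smul_smul₀ hα.ne',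
    ent_mul hc (heat_pos μ hs _) (heat_pos ν hs _), ENNReal.ofReal_mul hc.le]
  rw [lintegral_const_mul' _ _ ENNReal.ofReal_ne_top, ← mul_assoc, hcm, one_mul]
  rfl

end Flow

/-! ### The time change -/

lemma timeInterval_ofReal (t : ℝ) : timeInterval (ENNReal.ofReal t) = Ioo 0 t := by
  ext s
  constructor
  · rintro ⟨h1, h2⟩
    exact ⟨h1, (ENNReal.ofReal_lt_ofReal_iff_of_nonneg h1.le).1 h2⟩
  · rintro ⟨h1, h2⟩
    exact ⟨h1, (ENNReal.ofReal_lt_ofReal_iff_of_nonneg h1.le).2 h2⟩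

lemma timeInterval_top : timeInterval ∞ = Ioi 0 := by
  ext s
  simp [timeInterval]

lemma isOpen_timeInterval (T : ℝ≥0∞) : IsOpen (timeInterval T) :=
  (isOpen_lt continuous_const continuous_id).inter
    (isOpen_lt ENNReal.continuous_ofReal continuous_const)

/-- At accumulated noise `r` the signal level is `exp (-r / 2)` and the heat time is `exp r - 1`. -/
lemma exp_neg_half_sq_mul (r : ℝ) :
    Real.exp (-r / 2) ^ 2 * (1 + (Real.exp r - 1)) = 1 := by
  rw [← Real.exp_nat_mul, add_sub_cancel, ← Real.exp_add]
  simp only [Nat.cast_ofNat]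
  rw [mul_div_cancel₀ _ (two_ne_zero), neg_add_cancel, Real.exp_zero]

lemma exists_lt_mem_timeInterval {T : ℝ≥0∞} {t : ℝ} (ht : t ∈ timeInterval T) :
    ∃ t' ∈ timeInterval T, t < t' := by
  have h : timeInterval T ∈ 𝓝[>] t :=
    mem_nhdsWithin_of_mem_nhds ((isOpen_timeInterval T).mem_nhds ht)
  exact (nonempty_of_mem (inter_mem h self_mem_nhdsWithin) : (timeInterval T ∩ Ioi t).Nonempty)

/-- At signal level zero the transition density no longer depends on `z₀`, so both laws coincide. By
definition `alpha` vanishes exactly when the accumulated noise is infinite. -/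
lemma klDiv_diffusedLaw_of_alpha_eq_zero {β : ℝ → ℝ} {τ : ℝ≥0∞} (h : alpha β τ = 0) (μ ν : Measure (E m))
    [IsProbabilityMeasure μ] [IsProbabilityMeasure ν] :
    klDiv (diffusedLaw β τ μ) (diffusedLaw β τ ν) = 0 := by
  have : diffusedLaw β τ μ = diffusedLaw β τ ν := by
    unfold diffusedLaw diffusedDensity transDensity
    simp [h]
  rw [this]
  have : SigmaFinite (diffusedLaw β τ ν) := SigmaFinite.withDensity_ofReal _
  exact klDiv_self _

lemma image_exp_sub_one_top : (fun r => Real.exp r - 1) '' timeInterval ∞ = Ioi 0 := by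
  rw [timeInterval_top]
  ext s
  constructor
  · rintro ⟨r, hr, rfl⟩
    have := Real.add_one_lt_exp (ne_of_gt hr)
    simp only [mem_Ioi] at *
    linarith
  · intro hs
    have hs' : 0 < s := hs
    exact ⟨Real.log (s + 1), Real.log_pos (by linarith), by
      simp only; rw [Real.exp_log (by linarith)]; ring⟩

lemma image_exp_sub_one {N : ℝ} :
    (fun r => Real.exp r - 1) '' timeInterval (ENNReal.ofReal N) = Ioo 0 (Real.exp N - 1) := by
  rw [timeInterval_ofReal]
  ext s
  constructor
  · rintro ⟨r, hr, rfl⟩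
    have := Real.add_one_lt_exp (ne_of_gt hr.1)
    have h1 := hr.1
    exact ⟨by simp only; linarith, sub_lt_sub_right (Real.exp_lt_exp.2 hr.2) 1⟩
  · intro hs
    have hs1 : 0 < s := hs.1
    have hs2 : s < Real.exp N - 1 := hs.2
    refine ⟨Real.log (s + 1), ⟨Real.log_pos (by linarith), ?_⟩, ?_⟩
    · rw [Real.log_lt_iff_lt_exp (by linarith)]; linarith
    · simp only; rw [Real.exp_log (by linarith)]; ring

section TimeChange

variable {T : ℝ≥0∞} {β : ℝ → ℝ}
  (hβc : ContinuousOn β {t : ℝ | 0 ≤ t ∧ ENNReal.ofReal t < T})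
  (hβ : ∀ t : ℝ, 0 ≤ t → ENNReal.ofReal t < T → 0 < β t)

/-- The accumulated noise as a real number. -/
def realNoise (β : ℝ → ℝ) (t : ℝ) : ℝ := ∫ s in (0 : ℝ)..t, β s

lemma Icc_subset_of_mem {t : ℝ} (ht : t ∈ timeInterval T) :
    Icc 0 t ⊆ {t : ℝ | 0 ≤ t ∧ ENNReal.ofReal t < T} := fun _ hs =>
  ⟨hs.1, (ENNReal.ofReal_le_ofReal hs.2).trans_lt ht.2⟩

include hβc

lemma intervalIntegrable_noise {t : ℝ} (ht : t ∈ timeInterval T) :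
    IntervalIntegrable β volume 0 t := by
  refine ContinuousOn.intervalIntegrable ?_
  rw [uIcc_of_le ht.1.le]
  exact hβc.mono (Icc_subset_of_mem ht)

lemma hasDerivAt_realNoise {t : ℝ} (ht : t ∈ timeInterval T) :
    HasDerivAt (realNoise β) (β t) t := by
  have hc : ContinuousOn β (timeInterval T) := hβc.mono fun s hs => ⟨hs.1.le, hs.2⟩
  exact intervalIntegral.integral_hasDerivAt_right (intervalIntegrable_noise hβc ht)
    (hc.stronglyMeasurableAtFilter (isOpen_timeInterval T) t ht)
    (hc.continuousAt ((isOpen_timeInterval T).mem_nhds ht))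

include hβ

lemma accNoise_ofReal {t : ℝ} (ht : t ∈ timeInterval T) :
    accNoise β (ENNReal.ofReal t) = ENNReal.ofReal (realNoise β t) := by
  have hi := intervalIntegrable_noise hβc ht
  rw [accNoise, timeInterval_ofReal, realNoise, intervalIntegral.integral_of_le ht.1.le,
    ofReal_integral_eq_lintegral_ofReal]
  · exact setLIntegral_congr Ioo_ae_eq_Ioc
  · exact (intervalIntegrable_iff_integrableOn_Ioc_of_le ht.1.le).1 hi
  · filter_upwards [ae_restrict_mem measurableSet_Ioc] with s hs
    have := Icc_subset_of_mem ht ⟨hs.1.le, hs.2⟩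
    exact (hβ s this.1 this.2).le

lemma realNoise_lt {s t : ℝ} (hs : 0 ≤ s) (hst : s < t) (ht : t ∈ timeInterval T) :
    realNoise β s < realNoise β t := by
  have hi := intervalIntegrable_noise hβc ht
  have hsub : ∀ {a b : ℝ}, 0 ≤ a → a ≤ b → b ≤ t → IntervalIntegrable β volume a b := by
    intro a b h1 h2 h3
    refine hi.mono_set ?_
    rw [uIcc_of_le h2, uIcc_of_le ht.1.le]
    exact Icc_subset_Icc h1 h3
  have h := intervalIntegral.intervalIntegral_pos_of_pos_on (hsub hs hst.le le_rfl)
    (fun r hr => by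
      have := Icc_subset_of_mem ht ⟨hs.trans hr.1.le, hr.2.le⟩
      exact hβ r this.1 this.2) hst
  have h2 := intervalIntegral.integral_add_adjacent_intervals (hsub le_rfl hs hst.le)
    (hsub hs hst.le le_rfl)
  unfold realNoise
  linarith

lemma realNoise_pos {t : ℝ} (ht : t ∈ timeInterval T) : 0 < realNoise β t := by
  have := realNoise_lt hβc hβ le_rfl ht.1 ht
  simpa [realNoise] using this

/-- Continuity from below along times increasing to `T`; this covers `T = ∞` and infinite
accumulated noise alike. -/
lemma exists_realNoise_gt {r : ℝ} (hr : ENNReal.ofReal r < accNoise β T) :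
    ∃ t ∈ timeInterval T, ENNReal.ofReal r < ENNReal.ofReal (realNoise β t) := by
  have hT : 0 < T := by
    by_contra h
    have h0 : timeInterval T = ∅ := by
      ext s
      simp [timeInterval, nonpos_iff_eq_zero.1 (not_lt.1 h)]
    simp [accNoise, h0] at hr
  obtain ⟨u, hu1, hu2, hu3⟩ := exists_seq_strictMono_tendsto' hT
  have hun : timeInterval T = ⋃ n, timeInterval (u n) := by
    ext s
    simp only [mem_iUnion]
    constructor
    · rintro ⟨h1, h2⟩
      obtain ⟨n, hn⟩ := (hu3.eventually (lt_mem_nhds h2)).exists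
      exact ⟨n, h1, hn⟩
    · rintro ⟨n, h1, h2⟩
      exact ⟨h1, h2.trans (hu2 n).2⟩
  have hdir : Directed (· ⊆ ·) fun n => timeInterval (u n) :=
    Monotone.directed_le fun n n' hn s hs => ⟨hs.1, hs.2.trans_le (hu1.monotone hn)⟩
  have hsup : accNoise β T = ⨆ n, accNoise β (u n) := by
    unfold accNoise
    rw [hun, setLIntegral_iUnion_of_directed _ hdir]
  rw [hsup, lt_iSup_iff] at hr
  obtain ⟨n, hn⟩ := hr
  have hfin : u n ≠ ∞ := ((hu2 n).2.trans_le le_top).ne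
  have hmem : (u n).toReal ∈ timeInterval T :=
    ⟨ENNReal.toReal_pos (hu2 n).1.ne' hfin, by rw [ENNReal.ofReal_toReal hfin]; exact (hu2 n).2⟩
  refine ⟨(u n).toReal, hmem, ?_⟩
  rwa [← accNoise_ofReal hβc hβ hmem, ENNReal.ofReal_toReal hfin]

lemma image_realNoise : realNoise β '' timeInterval T = timeInterval (accNoise β T) := by
  ext r
  constructor
  · rintro ⟨t, ht, rfl⟩
    refine ⟨realNoise_pos hβc hβ ht, ?_⟩
    -- A later time in the interval makes the comparison with `accNoise β T` strict.
    obtain ⟨t', ht', htt'⟩ := exists_lt_mem_timeInterval ht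
    have h1 := realNoise_lt hβc hβ ht.1.le htt' ht'
    calc ENNReal.ofReal (realNoise β t) < ENNReal.ofReal (realNoise β t') :=
          (ENNReal.ofReal_lt_ofReal_iff_of_nonneg (realNoise_pos hβc hβ ht).le).2 h1
      _ = accNoise β (ENNReal.ofReal t') := (accNoise_ofReal hβc hβ ht').symm
      _ ≤ accNoise β T := lintegral_mono_set fun s hs => ⟨hs.1, hs.2.trans ht'.2⟩
  · rintro ⟨hr, hr2⟩
    obtain ⟨t, ht, hrt⟩ := exists_realNoise_gt hβc hβ hr2
    rw [ENNReal.ofReal_lt_ofReal_iff_of_nonneg hr.le] at hrt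
    have hcont : ContinuousOn (realNoise β) (Icc 0 t) := by
      have := intervalIntegral.continuousOn_primitive_interval' (μ := volume)
        (intervalIntegrable_noise hβc ht) (left_mem_uIcc)
      rwa [uIcc_of_le ht.1.le] at this
    have h0 : realNoise β 0 = 0 := by simp [realNoise]
    obtain ⟨t', ht', h⟩ := intermediate_value_Ioo ht.1.le hcont (by rw [h0]; exact ⟨hr, hrt⟩)
    exact ⟨t', ⟨ht'.1, (Icc_subset_of_mem ht ⟨ht'.1.le, ht'.2.le⟩).2⟩, h⟩

lemma alpha_ofReal {t : ℝ} (ht : t ∈ timeInterval T) :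
    alpha β (ENNReal.ofReal t) = Real.exp (-realNoise β t / 2) := by
  unfold alpha
  rw [accNoise_ofReal hβc hβ ht, if_neg ENNReal.ofReal_ne_top,
    ENNReal.toReal_ofReal (realNoise_pos hβc hβ ht).le]

/-- The score-matching integral of the diffusion in terms of the heat flow. -/
lemma scoreMatching_eq (μ ν : Measure (E m)) [IsFiniteMeasure μ] [IsFiniteMeasure ν] [NeZero μ]
    [NeZero ν] :
    scoreMatching β T μ ν =
      ∫⁻ s in (fun r => Real.exp r - 1) '' timeInterval (accNoise β T),
        heatFisherInfo μ ν s / 2 := by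
  have hI := (isOpen_timeInterval T).measurableSet
  -- In the substitution `s = exp N(t) - 1`, with `N` the accumulated noise, the Jacobian is `exp
  -- N(t) * β t = (1 + s) * β t`. The factor `1 + s` is the one in `fisherDiv_eq`.
  rw [← image_realNoise hβc hβ, image_image,
    lintegral_image_eq_lintegral_abs_deriv_mul (f := fun t => Real.exp (realNoise β t) - 1)
      (f' := fun t => Real.exp (realNoise β t) * β t) hI]
  · refine setLIntegral_congr_fun hI fun t ht => ?_
    have hpos := realNoise_pos hβc hβ ht
    have hβt : 0 < β t := hβ t ht.1.le ht.2
    have hs : 0 < Real.exp (realNoise β t) - 1 := by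
      have := Real.add_one_lt_exp hpos.ne'
      linarith
    have hα := alpha_ofReal hβc hβ ht
    rw [fisherDiv_eq μ ν (s := Real.exp (realNoise β t) - 1) (by rw [hα]; positivity) hs
      (by rw [hα]; exact exp_neg_half_sq_mul _), add_sub_cancel,
      abs_of_pos (by positivity), ENNReal.ofReal_mul (by positivity),
      ENNReal.ofReal_div_of_pos two_pos, ENNReal.ofReal_ofNat]
    simp only [div_eq_mul_inv]
    ring
  · intro t ht
    exact ((hasDerivAt_realNoise hβc ht).exp.sub_const 1).hasDerivWithinAt
  · have hmono : StrictMonoOn (fun t => Real.exp (realNoise β t) - 1) (timeInterval T) := by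
      intro s hs t ht hst
      have := Real.exp_lt_exp.2 (realNoise_lt hβc hβ hs.1.le hst ht)
      simpa using this
    exact hmono.injOn

lemma accNoise_pos (hT : 0 < T) : 0 < accNoise β T := by
  obtain ⟨t, h1, h2⟩ := exists_between hT
  have hfin : t ≠ ∞ := (h2.trans_le le_top).ne
  have hmem : t.toReal ∈ timeInterval T :=
    ⟨ENNReal.toReal_pos h1.ne' hfin, by rwa [ENNReal.ofReal_toReal hfin]⟩
  calc 0 < ENNReal.ofReal (realNoise β t.toReal) :=
        ENNReal.ofReal_pos.2 (realNoise_pos hβc hβ hmem)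
    _ = accNoise β (ENNReal.ofReal t.toReal) := (accNoise_ofReal hβc hβ hmem).symm
    _ ≤ accNoise β T := lintegral_mono_set fun s hs => ⟨hs.1, hs.2.trans hmem.2⟩

/-- The divergence of the initial laws is the divergence of the terminal laws plus the
score-matching integral. -/
theorem klDiv_densityMeasure_eq {f g : E m → ℝ} (hT : 0 < T) (hfm : Measurable f)
    (hgm : Measurable g) (hf : Integrable f) (hg : Integrable g) (hf0 : ∀ x, 0 ≤ f x)
    (hg0 : ∀ x, 0 < g x) (hfg : ∫ x, f x = ∫ x, g x)
    [IsProbabilityMeasure (densityMeasure f)] [IsProbabilityMeasure (densityMeasure g)] :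
    klDiv (densityMeasure f) (densityMeasure g) =
      klDiv (diffusedLaw β T (densityMeasure f)) (diffusedLaw β T (densityMeasure g)) +
        scoreMatching β T (densityMeasure f) (densityMeasure g) := by
  have hdiv : ∀ I : Set ℝ, ∫⁻ s in I, heatFisherInfo (densityMeasure f) (densityMeasure g) s / 2 =
      (∫⁻ s in I, heatFisherInfo (densityMeasure f) (densityMeasure g) s) / 2 := by
    intro I
    simp_rw [div_eq_mul_inv]
    rw [lintegral_mul_const' _ _ (by simp)]
  rw [klDiv_withDensity hfm hgm hf0 hg0, scoreMatching_eq hβc hβ, hdiv]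
  -- With infinite noise the heat time runs over `(0, ∞)` and the terminal laws agree; otherwise it
  -- ends at `exp N - 1`, where the terminal entropy remains.
  by_cases hN : accNoise β T = ∞
  · rw [klDiv_diffusedLaw_of_alpha_eq_zero (by simp [alpha, hN]), zero_add, hN,
      image_exp_sub_one_top]
    exact lintegral_ent_eq_top hfm hgm hf hg hf0 hg0 hfg
  · have hα : alpha β T = Real.exp (-(accNoise β T).toReal / 2) := by simp [alpha, hN]
    have hNpos : 0 < (accNoise β T).toReal :=
      ENNReal.toReal_pos (accNoise_pos hβc hβ hT).ne' hN
    have hs : 0 < Real.exp (accNoise β T).toReal - 1 := by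
      have := Real.add_one_lt_exp hNpos.ne'
      linarith
    rw [klDiv_diffusedLaw _ _ (s := Real.exp (accNoise β T).toReal - 1)
      (by rw [hα]; positivity) hs (by rw [hα]; exact exp_neg_half_sq_mul _)]
    have hNe : timeInterval (accNoise β T) =
        timeInterval (ENNReal.ofReal (accNoise β T).toReal) := by rw [ENNReal.ofReal_toReal hN]
    rw [hNe, image_exp_sub_one, setLIntegral_congr Ioo_ae_eq_Ioc]
    exact lintegral_ent_eq_add hfm hgm hf hg hf0 hg0 hs

end TimeChange

/-! ### Integrability of sums of functions bounded below -/

section Sums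

variable {α : Type*} [MeasurableSpace α] {μ ν : Measure α}

/-- The function `f` lies between `b` and `(f + h) - c`. This recovers integrability of a summand
from that of the sum when both summands are bounded below by integrable functions. -/
lemma integrable_left_of_add {f h b c : α → ℝ} (hf : AEStronglyMeasurable f μ)
    (hfh : Integrable (fun x => f x + h x) μ) (hb : Integrable b μ) (hc : Integrable c μ)
    (hbf : ∀ᵐ x ∂μ, b x ≤ f x) (hch : ∀ᵐ x ∂μ, c x ≤ h x) : Integrable f μ := by
  refine ((hfh.norm.add hb.norm).add hc.norm).mono' hf ?_
  filter_upwards [hbf, hch] with x h1 h2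
  simp only [Pi.add_apply, Real.norm_eq_abs]
  rw [abs_le]
  have a1 := le_abs_self (f x + h x)
  have a2 := neg_abs_le (b x)
  have a3 := neg_abs_le (c x)
  have a4 := abs_nonneg (b x)
  have a5 := abs_nonneg (c x)
  have a6 := abs_nonneg (f x + h x)
  constructor <;> linarith

lemma integrable_right_of_add {f h : α → ℝ}
    (hfh : Integrable (fun x => f x + h x) μ) (hf : Integrable f μ) : Integrable h μ := by
  refine (hfh.sub hf).congr (ae_of_all _ fun x => ?_)
  simp

lemma ae_rnDeriv_toReal_pos [SigmaFinite μ]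
    [SigmaFinite ν] (hμν : μ ≪ ν) : ∀ᵐ x ∂μ, 0 < (μ.rnDeriv ν x).toReal := by
  filter_upwards [Measure.rnDeriv_pos hμν, hμν.ae_le (Measure.rnDeriv_ne_top μ ν)] with x h1 h2
    using ENNReal.toReal_pos h1.ne' h2

/-- The negative part of the log-ratio of a probability density to an integrable function is
integrable. -/
lemma integrable_max_log_sub_log [IsFiniteMeasure μ] [SigmaFinite ν] (hμν : μ ≪ ν) {b : α → ℝ}
    (hb : Measurable b) (hfin : ∫⁻ x, ENNReal.ofReal (b x) ∂ν ≠ ∞) (hpos : ∀ᵐ x ∂μ, 0 < b x) :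
    Integrable (fun x => max (Real.log (b x) - Real.log (μ.rnDeriv ν x).toReal) 0) μ := by
  have ha := Measure.measurable_rnDeriv μ ν
  have hapos := ae_rnDeriv_toReal_pos hμν
  -- The `μ`-integral of `b / (dμ/dν)` is at most the `ν`-integral of `b`: only the set where
  -- `dμ/dν` vanishes is lost. This quotient dominates the positive part of its logarithm.
  have hq : Integrable (fun x => b x / (μ.rnDeriv ν x).toReal) μ := by
    refine ⟨(hb.div ha.ennreal_toReal).aestronglyMeasurable, ?_⟩
    rw [hasFiniteIntegral_iff_ofReal]
    · have hm : Measurable fun x => ENNReal.ofReal (b x / (μ.rnDeriv ν x).toReal) :=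
        (hb.div ha.ennreal_toReal).ennreal_ofReal
      rw [← lintegral_rnDeriv_mul hμν hm.aemeasurable]
      refine lt_of_le_of_lt (lintegral_mono_ae ?_) (lt_top_iff_ne_top.2 hfin)
      filter_upwards [Measure.rnDeriv_ne_top μ ν] with x hx
      rcases eq_or_ne (μ.rnDeriv ν x) 0 with h | h
      · simp [h]
      · have h1 : 0 < (μ.rnDeriv ν x).toReal := ENNReal.toReal_pos h hx
        conv_lhs => enter [1]; rw [← ENNReal.ofReal_toReal hx]
        rw [← ENNReal.ofReal_mul h1.le, mul_div_cancel₀ _ h1.ne']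
    · filter_upwards [hpos, hapos] with x h1 h2 using (div_pos h1 h2).le
  refine hq.mono' ?_ ?_
  · exact ((hb.log.sub ha.ennreal_toReal.log).max measurable_const).aestronglyMeasurable
  · filter_upwards [hpos, hapos] with x h1 h2
    rw [Real.norm_of_nonneg (le_max_right _ _), ← Real.log_div h1.ne' h2.ne']
    refine max_le ?_ (div_pos h1 h2).le
    linarith [Real.log_le_sub_one_of_pos (div_pos h1 h2)]

end Sums

/-! ### The augmented posterior -/

section Posterior

variable {m n k : ℕ} {f : E n → E k} {D : E m → E n} {g : E m → ℝ} {y : E k} {σv lam ρ : ℝ}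

lemma misfit_nonneg (x : E n) : 0 ≤ misfit f y σv x := by
  unfold misfit; positivity

lemma coupling_nonneg (w : E m × E n) : 0 ≤ coupling D ρ w := by
  unfold coupling; positivity

lemma measurable_misfit (hf : Measurable f) : Measurable (misfit f y σv) := by
  unfold misfit; fun_prop

lemma measurable_coupling (hD : Measurable D) : Measurable (coupling D ρ) := by
  unfold coupling; fun_prop

lemma measurable_potential (hf : Measurable f) (hD : Measurable D) (hg : Measurable g) :
    Measurable (potential f D g y σv lam ρ) := by
  have h1 := measurable_misfit (y := y) (σv := σv) hf
  have h2 := measurable_coupling (ρ := ρ) hD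
  unfold potential
  fun_prop

/-- By translation invariance the inner Gaussian integral does not depend on `D z`, so measurability
of `D` suffices. -/
lemma integrable_mul_exp_neg_sq (hD : Measurable D) {h : E m → ℝ} (hh : Measurable h)
    (hi : Integrable h) {c : ℝ} (hc : 0 < c) :
    Integrable (fun w : E m × E n => h w.1 * Real.exp (-c * ‖w.2 - D w.1‖ ^ 2)) := by
  have hm : Measurable fun w : E m × E n => h w.1 * Real.exp (-c * ‖w.2 - D w.1‖ ^ 2) := by
    fun_prop
  have hgauss := GaussianFourier.integral_rexp_neg_mul_sq_norm (V := E n) hc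
  have hint : Integrable fun x : E n => Real.exp (-c * ‖x‖ ^ 2) := by
    by_contra hcon
    rw [integral_undef hcon] at hgauss
    have : (0 : ℝ) < (Real.pi / c) ^ ((Module.finrank ℝ (E n) : ℝ) / 2) := by positivity
    linarith
  rw [Measure.volume_eq_prod, integrable_prod_iff hm.aestronglyMeasurable]
  constructor
  · exact ae_of_all _ fun z => (hint.comp_sub_right (D z)).const_mul (h z)
  · refine (hi.norm.mul_const ((Real.pi / c) ^ ((Module.finrank ℝ (E n) : ℝ) / 2))).congr
      (ae_of_all _ fun z => ?_)
    simp_rw [norm_mul, Real.norm_of_nonneg (Real.exp_pos _).le]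
    rw [integral_const_mul, integral_sub_right_eq_self (fun x : E n => Real.exp (-c * ‖x‖ ^ 2)),
      hgauss]

lemma integrable_exp_neg_potential (hf : Measurable f) (hD : Measurable D) (hg : Measurable g)
    (hρ : 0 < ρ) (hprior : Integrable (fun z : E m => Real.exp (-(lam * g z)))) :
    Integrable fun w : E m × E n => Real.exp (-potential f D g y σv lam ρ w) := by
  refine (integrable_mul_exp_neg_sq (c := 1 / (2 * ρ ^ 2)) hD (by fun_prop) hprior
    (by positivity)).mono' (measurable_potential hf hD hg).neg.exp.aestronglyMeasurable
    (ae_of_all _ fun w => ?_)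
  rw [Real.norm_of_nonneg (Real.exp_pos _).le, ← Real.exp_add]
  refine Real.exp_le_exp.2 ?_
  have := misfit_nonneg (f := f) (y := y) (σv := σv) w.2
  unfold potential coupling
  linarith

variable {q : Measure (E m × E n)}

lemma fst_absolutelyContinuous (hq : q ≪ volume) : q.fst ≪ volume := by
  rw [Measure.volume_eq_prod] at hq
  exact (hq.map measurable_fst).trans Measure.quasiMeasurePreserving_fst.absolutelyContinuous

lemma ae_of_ae_fst {p : E m → Prop} (h : ∀ᵐ z ∂q.fst, p z) : ∀ᵐ w ∂q, p w.1 :=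
  ae_of_ae_map measurable_fst.aemeasurable h

lemma integrable_fst_iff {h : E m → ℝ} (hh : Measurable h) :
    Integrable h q.fst ↔ Integrable (fun w => h w.1) q :=
  integrable_map_measure hh.aestronglyMeasurable measurable_fst.aemeasurable

lemma integral_fst {h : E m → ℝ} (hh : Measurable h) : ∫ z, h z ∂q.fst = ∫ w, h w.1 ∂q :=
  integral_map measurable_fst.aemeasurable hh.aestronglyMeasurable

lemma measurable_condDensity :
    Measurable fun w : E m × E n => condDensity q w.1 w.2 := by
  have h1 := (Measure.measurable_rnDeriv q (volume : Measure (E m × E n))).ennreal_toReal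
  have h2 := (Measure.measurable_rnDeriv q.fst (volume : Measure (E m))).ennreal_toReal
  exact h1.div (h2.comp measurable_fst)

variable [IsProbabilityMeasure q]

lemma log_condDensity (hq : q ≪ volume) : ∀ᵐ w ∂q, Real.log (condDensity q w.1 w.2) =
    Real.log (q.rnDeriv volume w).toReal - Real.log (q.fst.rnDeriv volume w.1).toReal := by
  filter_upwards [ae_rnDeriv_toReal_pos hq,
    ae_of_ae_fst (ae_rnDeriv_toReal_pos (fst_absolutelyContinuous hq))] with w h1 h2
  unfold condDensity
  rw [Real.log_div h1.ne' h2.ne']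

/-- The chain rule for the log-likelihood ratio with respect to the augmented posterior. -/
lemma llr_posterior_eq (hf : Measurable f) (hD : Measurable D) (hg : Measurable g) (hρ : 0 < ρ)
    (hprior : Integrable (fun z : E m => Real.exp (-(lam * g z)))) (hq : q ≪ volume) :
    ∀ᵐ w ∂q, llr q (posterior f D g y σv lam ρ) w =
      llr q.fst (prior g lam) w.1 + Real.log (condDensity q w.1 w.2) + misfit f y σv w.2 +
        coupling D ρ w + logEvidence f D g y σv lam ρ := by
  filter_upwards [llr_tilted_right hq
      (integrable_exp_neg_potential (y := y) (σv := σv) hf hD hg hρ hprior),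
    ae_of_ae_fst (llr_tilted_right (fst_absolutelyContinuous hq) hprior),
    log_condDensity hq] with w h1 h2 h3
  unfold posterior prior
  rw [h1, h2, h3]
  unfold logEvidence potential llr
  ring

/-- The log-likelihood ratio with respect to the posterior is integrable if and only if all terms
of its chain rule are. -/
lemma integrable_llr_posterior_iff (hf : Measurable f) (hD : Measurable D) (hg : Measurable g)
    (hρ : 0 < ρ) (hprior : Integrable (fun z : E m => Real.exp (-(lam * g z))))
    (hq : q ≪ volume) :
    Integrable (llr q (posterior f D g y σv lam ρ)) q ↔
      Integrable (llr q.fst (prior g lam)) q.fst ∧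
      Integrable (fun w : E m × E n => Real.log (condDensity q w.1 w.2)) q ∧
      Integrable (fun w : E m × E n => misfit f y σv w.2) q ∧
      Integrable (fun w : E m × E n => coupling D ρ w) q := by
  have hchain := llr_posterior_eq (y := y) (σv := σv) hf hD hg hρ hprior hq
  have hq1 := fst_absolutelyContinuous hq
  have mA : Measurable (llr q.fst (prior g lam)) := measurable_llr _ _
  have mB : Measurable fun w : E m × E n => Real.log (condDensity q w.1 w.2) :=
    measurable_condDensity.log
  have mM : Measurable fun w : E m × E n => misfit f y σv w.2 :=
    (measurable_misfit hf).comp measurable_snd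
  have mC : Measurable fun w : E m × E n => coupling D ρ w := measurable_coupling hD
  rw [integrable_fst_iff mA, integrable_congr hchain]
  constructor
  · intro h
    -- The log conditional density alone has no evident integrable lower bound. Half of the coupling
    -- is added to it for this purpose; the other half stays with the misfit, where it is
    -- nonnegative.
    have h' : Integrable (fun w : E m × E n => llr q.fst (prior g lam) w.1 +
        ((Real.log (condDensity q w.1 w.2) + coupling D ρ w / 2) +
          (misfit f y σv w.2 + coupling D ρ w / 2))) q := by
      have := h.sub (integrable_const (logEvidence f D g y σv lam ρ))
      refine this.congr (ae_of_all _ fun w => ?_)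
      simp only [Pi.sub_apply]
      ring
    set Zg := Real.log (∫ z : E m, Real.exp (-(lam * g z)))
    -- The log-ratio to the prior is `log q(z₀) + λ g(z₀) + Zg`, whose negative part is controlled
    -- because `exp (-λ g)` is integrable.
    have bA : Integrable (fun w : E m × E n => Zg - max (Real.log (Real.exp (-(lam * g w.1))) -
        Real.log (q.fst.rnDeriv volume w.1).toReal) 0) q := by
      have h1 := integrable_max_log_sub_log (μ := q.fst) (ν := volume) hq1
        (b := fun z => Real.exp (-(lam * g z))) (by fun_prop)
        (by rw [← ofReal_integral_eq_lintegral_ofReal hprior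
              (ae_of_all _ fun z => (Real.exp_pos _).le)]; exact ENNReal.ofReal_ne_top)
        (ae_of_all _ fun z => Real.exp_pos _)
      rw [integrable_fst_iff] at h1
      · exact (integrable_const Zg).sub h1
      · have := (Measure.measurable_rnDeriv q.fst (volume : Measure (E m))).ennreal_toReal
        fun_prop
    have lA : ∀ᵐ w ∂q, Zg - max (Real.log (Real.exp (-(lam * g w.1))) -
        Real.log (q.fst.rnDeriv volume w.1).toReal) 0 ≤ llr q.fst (prior g lam) w.1 := by
      filter_upwards [ae_of_ae_fst (llr_tilted_right hq1 hprior)] with w hw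
      unfold prior
      rw [hw, Real.log_exp]
      have := le_max_left (-(lam * g w.1) - Real.log (q.fst.rnDeriv volume w.1).toReal) 0
      unfold llr
      linarith
    have hb0 : Measurable fun z : E m => (q.fst.rnDeriv volume z).toReal :=
      (Measure.measurable_rnDeriv q.fst (volume : Measure (E m))).ennreal_toReal
    have hbi : Integrable fun z : E m => (q.fst.rnDeriv volume z).toReal :=
      Measure.integrable_toReal_rnDeriv
    -- The marginal density times a Gaussian with exponent `-coupling / 2`, so that `log b - log q`
    -- is minus the sum of the log conditional density and half the coupling.
    let b : E m × E n → ℝ := fun w => (q.fst.rnDeriv volume w.1).toReal *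
      Real.exp (-(1 / (4 * ρ ^ 2)) * ‖w.2 - D w.1‖ ^ 2)
    have hbint : Integrable b := integrable_mul_exp_neg_sq hD hb0 hbi (by positivity)
    have hqpos := ae_of_ae_fst (ae_rnDeriv_toReal_pos hq1)
    have bB : Integrable (fun w => -max (Real.log (b w) -
        Real.log (q.rnDeriv volume w).toReal) 0) q := by
      refine (integrable_max_log_sub_log hq ?_ ?_ ?_).neg
      · simp only [b]; fun_prop
      · rw [← ofReal_integral_eq_lintegral_ofReal hbint (ae_of_all _ fun w => by
          simp only [b]; positivity)]
        exact ENNReal.ofReal_ne_top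
      · filter_upwards [hqpos] with w hw
        simp only [b]
        positivity
    have lB : ∀ᵐ w ∂q, -max (Real.log (b w) - Real.log (q.rnDeriv volume w).toReal) 0 ≤
        Real.log (condDensity q w.1 w.2) + coupling D ρ w / 2 := by
      filter_upwards [log_condDensity hq, hqpos] with w hw hpos
      have h1 : Real.log (b w) =
          Real.log (q.fst.rnDeriv volume w.1).toReal - coupling D ρ w / 2 := by
        simp only [b]
        rw [Real.log_mul hpos.ne' (Real.exp_pos _).ne', Real.log_exp]
        unfold coupling
        field_simp
        ring
      have := le_max_left (Real.log (b w) - Real.log (q.rnDeriv volume w).toReal) 0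
      rw [hw]
      linarith
    have lC : ∀ w : E m × E n, 0 ≤ misfit f y σv w.2 + coupling D ρ w / 2 := fun w => by
      have h1 := misfit_nonneg (f := f) (y := y) (σv := σv) w.2
      have h2 := coupling_nonneg (D := D) (ρ := ρ) w
      positivity
    have i1 : Integrable (fun w : E m × E n => llr q.fst (prior g lam) w.1) q := by
      refine integrable_left_of_add (mA.comp measurable_fst).aestronglyMeasurable h' bA bB lA ?_
      filter_upwards [lB] with w hw
      linarith [lC w]
    have h2 := integrable_right_of_add h' i1
    have i2 : Integrable (fun w : E m × E n =>
        Real.log (condDensity q w.1 w.2) + coupling D ρ w / 2) q :=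
      integrable_left_of_add (mB.add (mC.div_const 2)).aestronglyMeasurable h2 bB
        (integrable_zero _ _ _) lB (ae_of_all _ lC)
    have h3 := integrable_right_of_add h2 i2
    have i3 : Integrable (fun w : E m × E n => misfit f y σv w.2) q :=
      integrable_left_of_add mM.aestronglyMeasurable h3 (integrable_zero _ _ _)
        (integrable_zero _ _ _) (ae_of_all _ fun w => misfit_nonneg _)
        (ae_of_all _ fun w => div_nonneg (coupling_nonneg _) zero_le_two)
    have h4 := integrable_right_of_add h3 i3
    have i4 : Integrable (fun w : E m × E n => coupling D ρ w) q := by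
      refine (h4.const_mul 2).congr (ae_of_all _ fun w => ?_)
      simp only
      ring
    refine ⟨i1, ?_, i3, i4⟩
    refine (i2.sub h4).congr (ae_of_all _ fun w => ?_)
    simp only [Pi.sub_apply]
    ring
  · rintro ⟨h1, h2, h3, h4⟩
    exact (((h1.add h2).add h3).add h4).add (integrable_const _)

/-- The expected conditional entropy term is the mean of the logarithm of the conditional
density. -/
lemma integral_entropyTerm (hq : q ≪ volume)
    (hi : Integrable (fun w : E m × E n => Real.log (condDensity q w.1 w.2)) q) :
    ∫ z, entropyTerm (condDensity q z) ∂q.fst = ∫ w, Real.log (condDensity q w.1 w.2) ∂q := by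
  have hq1 := fst_absolutelyContinuous hq
  rw [← integral_rnDeriv_smul hq, ← integral_rnDeriv_smul hq1]
  have hi' := (integrable_rnDeriv_smul_iff hq).2 hi
  rw [Measure.volume_eq_prod] at hi' ⊢
  rw [integral_prod _ hi']
  refine integral_congr_ae (ae_of_all _ fun z => ?_)
  simp only [smul_eq_mul, entropyTerm]
  rw [← integral_const_mul]
  refine integral_congr_ae (ae_of_all _ fun x => ?_)
  simp only [condDensity, ← Measure.volume_eq_prod]
  -- Where the marginal density vanishes, `condDensity` is `0` by division by zero and both sides
  -- are `0`.
  rcases eq_or_ne (q.fst.rnDeriv volume z).toReal 0 with h | h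
  · simp [h]
  · field_simp

end Posterior

/-! ### The decomposition of the divergence -/

section Main

variable {m n k : ℕ} {f : E n → E k} {D : E m → E n} {g : E m → ℝ} {y : E k} {σv lam ρ : ℝ}
  {T : ℝ≥0∞} {β : ℝ → ℝ}

/-- De Bruijn's identity for the diffusion started at an absolutely continuous law and at the
prior. -/
lemma klDiv_prior_eq (hg : Measurable g)
    (hprior : Integrable (fun z : E m => Real.exp (-(lam * g z)))) (hT : 0 < T)
    (hβc : ContinuousOn β {t : ℝ | 0 ≤ t ∧ ENNReal.ofReal t < T})
    (hβ : ∀ t : ℝ, 0 ≤ t → ENNReal.ofReal t < T → 0 < β t)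
    {μ : Measure (E m)} [IsProbabilityMeasure μ] (hμ : μ ≪ volume) :
    klDiv μ (prior g lam) = klDiv (diffusedLaw β T μ) (diffusedLaw β T (prior g lam)) +
      scoreMatching β T μ (prior g lam) := by
  let u : E m → ℝ := fun z => (μ.rnDeriv volume z).toReal
  let v : E m → ℝ := fun z => Real.exp (-(lam * g z)) / ∫ z : E m, Real.exp (-(lam * g z))
  have hZ : 0 < ∫ z : E m, Real.exp (-(lam * g z)) := integral_exp_pos hprior
  have hu : densityMeasure u = μ := by
    refine Eq.trans (withDensity_congr_ae ?_) (Measure.withDensity_rnDeriv_eq μ volume hμ)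
    filter_upwards [Measure.rnDeriv_ne_top μ volume] with z hz
    exact ENNReal.ofReal_toReal hz
  have hv : densityMeasure v = prior g lam := rfl
  have : IsProbabilityMeasure (prior g lam) := isProbabilityMeasure_tilted hprior
  have : IsProbabilityMeasure (densityMeasure u) := by rw [hu]; infer_instance
  have : IsProbabilityMeasure (densityMeasure v) := by rw [hv]; infer_instance
  have hint : ∫ z, u z = ∫ z, v z := by
    simp only [u, v]
    rw [Measure.integral_toReal_rnDeriv hμ, integral_div, div_self hZ.ne']
    simp
  have h := klDiv_densityMeasure_eq hβc hβ (f := u) (g := v) hT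
    (Measure.measurable_rnDeriv _ _).ennreal_toReal (by simp only [v]; fun_prop)
    Measure.integrable_toReal_rnDeriv (hprior.div_const _) (fun z => ENNReal.toReal_nonneg)
    (fun z => div_pos (Real.exp_pos _) hZ) hint
  rwa [hu, hv] at h

lemma coe_toReal_of_ne_top {x : ℝ≥0∞} (hx : x ≠ ∞) : ((x.toReal : ℝ) : EReal) = (x : EReal) :=
  EReal.coe_ennreal_toReal hx

lemma terminalKL_nonneg {q : Measure (E m × E n)} : 0 ≤ terminalKL g lam β T q :=
  EReal.coe_ennreal_nonneg _

/-- The divergence from the augmented posterior is the variational bound plus the log-evidence plus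
the terminal divergence. -/
theorem klDiv_posterior_eq (hf : Measurable f) (hD : Measurable D) (hg : Measurable g)
    (hρ : 0 < ρ) (hprior : Integrable (fun z : E m => Real.exp (-(lam * g z)))) (hT : 0 < T)
    (hβc : ContinuousOn β {t : ℝ | 0 ≤ t ∧ ENNReal.ofReal t < T})
    (hβ : ∀ t : ℝ, 0 ≤ t → ENNReal.ofReal t < T → 0 < β t)
    (q : Measure (E m × E n)) [IsProbabilityMeasure q] :
    ((klDiv q (posterior f D g y σv lam ρ) : ℝ≥0∞) : EReal) =
      bound f D g y σv lam ρ β T q + (logEvidence f D g y σv lam ρ : EReal) +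
        terminalKL g lam β T q := by
  have hpot := integrable_exp_neg_potential (f := f) (y := y) (σv := σv) hf hD hg hρ hprior
  have : IsProbabilityMeasure (posterior f D g y σv lam ρ) := isProbabilityMeasure_tilted hpot
  have : IsProbabilityMeasure (prior g lam) := isProbabilityMeasure_tilted hprior
  have htop : ¬ HasFiniteBound f D g y σv lam ρ β T q →
      bound f D g y σv lam ρ β T q + (logEvidence f D g y σv lam ρ : EReal) +
        terminalKL g lam β T q = ⊤ := by
    intro h
    have hb : bound f D g y σv lam ρ β T q = ⊤ := by unfold bound; rw [if_neg h]
    rw [hb, EReal.top_add_coe, EReal.top_add_of_ne_bot]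
    exact EReal.coe_ennreal_ne_bot _
  by_cases hq : q ≪ volume
  swap
  -- The posterior has a Lebesgue density, so a `q` without one makes both sides infinite.
  · have hnot : ¬ q ≪ posterior f D g y σv lam ρ := fun h =>
      hq (h.trans (tilted_absolutelyContinuous _ _))
    rw [klDiv_of_not_ac hnot, htop fun h => hq h.absCont, EReal.coe_ennreal_top]
  have hqp : q ≪ posterior f D g y σv lam ρ := hq.trans (absolutelyContinuous_tilted hpot)
  have hq1 := fst_absolutelyContinuous hq
  have hq1p : q.fst ≪ prior g lam := hq1.trans (absolutelyContinuous_tilted hprior)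
  have hz := klDiv_prior_eq hg hprior hT hβc hβ hq1
  have hiff := integrable_llr_posterior_iff (y := y) (σv := σv) hf hD hg hρ hprior hq
  by_cases hi : Integrable (llr q (posterior f D g y σv lam ρ)) q
  · obtain ⟨iA, iB, iM, iC⟩ := hiff.1 hi
    have hzfin : klDiv q.fst (prior g lam) ≠ ∞ := klDiv_ne_top hq1p iA
    have hsum := hzfin
    rw [hz] at hsum
    obtain ⟨htfin, hsfin⟩ := ENNReal.add_ne_top.1 hsum
    have hb : HasFiniteBound f D g y σv lam ρ β T q := ⟨hq, iB, iM, iC, hsfin⟩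
    have hzr := congrArg ENNReal.toReal hz
    rw [ENNReal.toReal_add htfin hsfin,
      toReal_klDiv_of_measure_eq hq1p (by rw [measure_univ, measure_univ]),
      integral_fst (measurable_llr _ _)] at hzr
    have iA' := (integrable_fst_iff (measurable_llr q.fst (prior g lam))).1 iA
    have iAB : Integrable (fun w : E m × E n => llr q.fst (prior g lam) w.1 +
        Real.log (condDensity q w.1 w.2)) q := iA'.add iB
    have iABM : Integrable (fun w : E m × E n => llr q.fst (prior g lam) w.1 +
        Real.log (condDensity q w.1 w.2) + misfit f y σv w.2) q := iAB.add iM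
    have iABMC : Integrable (fun w : E m × E n => llr q.fst (prior g lam) w.1 +
        Real.log (condDensity q w.1 w.2) + misfit f y σv w.2 + coupling D ρ w) q := iABM.add iC
    have hval := toReal_klDiv_of_measure_eq hqp (by rw [measure_univ, measure_univ])
    rw [integral_congr_ae (llr_posterior_eq (y := y) (σv := σv) hf hD hg hρ hprior hq),
      integral_add iABMC (integrable_const _), integral_add iABM iC, integral_add iAB iM,
      integral_add iA' iB,
      integral_const, probReal_univ, one_smul, hzr] at hval
    rw [← coe_toReal_of_ne_top (klDiv_ne_top hqp hi), hval]
    unfold bound terminalKL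
    rw [if_pos hb, ← coe_toReal_of_ne_top htfin, integral_entropyTerm hq iB]
    norm_cast
    ring
  · rw [klDiv_of_not_integrable hi, EReal.coe_ennreal_top]
    -- If the bound is finite while the total log-ratio is not integrable, the marginal log-ratio
    -- must fail to be integrable. De Bruijn's identity with a finite score term then forces the
    -- terminal divergence to be infinite.
    by_cases hb : HasFiniteBound f D g y σv lam ρ β T q
    · have hA : ¬ Integrable (llr q.fst (prior g lam)) q.fst := fun hA =>
        hi (hiff.2 ⟨hA, hb.entropy, hb.misfit, hb.coupling⟩)
      rw [klDiv_of_not_integrable hA] at hz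
      have ht : klDiv (diffusedLaw β T q.fst) (diffusedLaw β T (prior g lam)) = ∞ := by
        by_contra h
        exact ENNReal.add_ne_top.2 ⟨h, hb.score⟩ hz.symm
      unfold bound terminalKL
      rw [if_pos hb, ht, EReal.coe_ennreal_top, ← EReal.coe_add, EReal.coe_add_top]
    · exact (htop hb).symm

end Main

/-- A real summand can be cancelled from inequalities in `EReal`, even when the other summands are
infinite. -/
lemma coe_klDiv_le_iff {a b : ℝ≥0∞} {A B : EReal} {c : ℝ} (ha : (a : EReal) = A + c)
    (hb : (b : EReal) = B + c) : a ≤ b ↔ A ≤ B := by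
  rw [← EReal.coe_ennreal_le_coe_ennreal_iff, ha, hb,
    (EReal.addLECancellable_coe c).add_le_add_iff_right]

end RSD

end

theorem proposition1 {m n k : ℕ}
    (f : RSD.E n → RSD.E k) (D : RSD.E m → RSD.E n) (g : RSD.E m → ℝ) (y : RSD.E k)
    (σv lam ρ : ℝ)
    (hf : Measurable f) (hD : Measurable D) (hg : Measurable g)
    (hσv : 0 < σv) (hρ : 0 < ρ)
    (hprior : Integrable (fun z : RSD.E m => Real.exp (-(lam * g z))))
    (T : ℝ≥0∞) (hT : 0 < T) (β : ℝ → ℝ)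
    (hβc : ContinuousOn β {t : ℝ | 0 ≤ t ∧ ENNReal.ofReal t < T})
    (hβ : ∀ t : ℝ, 0 ≤ t → ENNReal.ofReal t < T → 0 < β t) :
    -- the exact decomposition of the divergence, for every horizon `T ≤ ∞`
    (∀ q : Measure (RSD.E m × RSD.E n), IsProbabilityMeasure q →
      ((klDiv q (RSD.posterior f D g y σv lam ρ) : ℝ≥0∞) : EReal) =
        RSD.bound f D g y σv lam ρ β T q + (RSD.logEvidence f D g y σv lam ρ : EReal)
          + RSD.terminalKL g lam β T q) ∧
    -- the four-term functional is a lower bound, up to a constant independent of `q`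
    (∀ q : Measure (RSD.E m × RSD.E n), IsProbabilityMeasure q →
      RSD.bound f D g y σv lam ρ β T q + (RSD.logEvidence f D g y σv lam ρ : EReal) ≤
        ((klDiv q (RSD.posterior f D g y σv lam ρ) : ℝ≥0∞) : EReal)) ∧
    -- the equivalence of the minimisation problems, for every horizon `T ≤ ∞`
    (∀ Q : Set (Measure (RSD.E m × RSD.E n)), (∀ q ∈ Q, IsProbabilityMeasure q) → ∀ q ∈ Q,
      (IsMinOn (fun r => klDiv r (RSD.posterior f D g y σv lam ρ)) Q q ↔
        IsMinOn (fun r => RSD.bound f D g y σv lam ρ β T r + RSD.terminalKL g lam β T r) Q q)) ∧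
    -- the diffusion ends in pure noise: no terminal term
    (RSD.alpha β T = 0 →
      (∀ q : Measure (RSD.E m × RSD.E n), IsProbabilityMeasure q →
        ((klDiv q (RSD.posterior f D g y σv lam ρ) : ℝ≥0∞) : EReal) =
          RSD.bound f D g y σv lam ρ β T q + (RSD.logEvidence f D g y σv lam ρ : EReal)) ∧
      (∀ Q : Set (Measure (RSD.E m × RSD.E n)), (∀ q ∈ Q, IsProbabilityMeasure q) → ∀ q ∈ Q,
        (IsMinOn (fun r => klDiv r (RSD.posterior f D g y σv lam ρ)) Q q ↔
          IsMinOn (RSD.bound f D g y σv lam ρ β T) Q q))) := by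
  have main := fun (q : Measure (RSD.E m × RSD.E n)) (_ : IsProbabilityMeasure q) =>
    RSD.klDiv_posterior_eq (y := y) (σv := σv) hf hD hg hρ hprior hT hβc hβ q
  -- The log-evidence is moved to the end, where it can be cancelled as the common real constant.
  have main' := fun (q : Measure (RSD.E m × RSD.E n)) (hq : IsProbabilityMeasure q) =>
    (main q hq).trans (add_right_comm _ _ _)
  refine ⟨main, fun q hq => ?_, fun Q hQ q hq => ?_, fun hα => ?_⟩
  · rw [main q hq]
    exact le_add_of_nonneg_right RSD.terminalKL_nonneg
  · exact forall₂_congr fun r hr => RSD.coe_klDiv_le_iff (main' q (hQ q hq)) (main' r (hQ r hr))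
  · have : IsProbabilityMeasure (RSD.prior g lam) := isProbabilityMeasure_tilted hprior
    have pure_noise : ∀ q : Measure (RSD.E m × RSD.E n), IsProbabilityMeasure q →
        ((klDiv q (RSD.posterior f D g y σv lam ρ) : ℝ≥0∞) : EReal) =
          RSD.bound f D g y σv lam ρ β T q + (RSD.logEvidence f D g y σv lam ρ : EReal) := by
      intro q hq
      rw [main q hq, RSD.terminalKL, RSD.klDiv_diffusedLaw_of_alpha_eq_zero hα,
        EReal.coe_ennreal_zero, add_zero]
    exact ⟨pure_noise, fun Q hQ q hq => forall₂_congr fun r hr =>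
      RSD.coe_klDiv_le_iff (pure_noise q (hQ q hq)) (pure_noise r (hQ r hr))⟩
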